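/- **Single-level problem.** For each $n$ let $X=\{0,1\}^n$, let $A=A_n$ be a set of bit strings of length $m=m(n)$ with $|A_n|\ge 2^{\alpha n}$ for some constant $\alpha>0$ and all large $n$, and let $f=f_n:A\times X\to\{0,1\}$. For $a\in A$ put $|\varphi_a\rangle=2^{-n/2}\sum_{x\in X}(-1)^{f(a,x)}|x\rangle$. Let $U=U_n$ be a quantum circuit of $\mathrm{poly}(n)$ two-qubit unitary gates on $n$ input qubits and $\mathrm{poly}(n)$ workspace qubits, with $m$ designated output qubits. Suppose that $U$ solves the single-level problem: for some constant $\delta>0$, for all large $n$ and all $a\in A$, measuring the output qubits of $U|\varphi_a\rangle|0\cdots0\rangle$ gives $a$ with probability at least $\delta$ (without workspace and with $m=n$ this says $|\langle a|U|\varphi_a\rangle|^2\ge\delta$). **Recursive problem.** Put $\ell=\lfloor\log_2 n\rfloor$. An instance consists of an arbitrary function $s:\bigcup_{k=0}^{\ell-1}X^k\to A$ and a bit $b_\emptyset$. It defines an oracle $\mathcal O$ with values in $\{0,1,\mathrm{FAIL}\}$. For $0\le k<\ell$, $x\in X^k$ and a label $a$, $\mathcal O(x,a)=\mathrm{FAIL}$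 if $a\ne s(x)$. If $a=s(x)$, then $\mathcal O(x,a)=f(s(x_1,\dots,x_{k-1}),x_k)$ when $k\ge1$, and $\mathcal O(x,a)=b_\emptyset$ when $k=0$. For $x\in X^\ell$, $\mathcal O(x)=f(s(x_1,\dots,x_{\ell-1}),x_\ell)$. The task is to determine $b_\emptyset$ given access to $\mathcal O$. **Theorem.** Under these assumptions: 1. The recursive problem is solved by a quantum computer in polynomial time and with polynomially many queries. That is, there are one classical random-access-machine program, which does not depend on $n$, and a polynomial $p$, such that for all large $n$ the program, on input $n$ (and the label length and workspace size of the problem of size $n$), prints a sequence of Hadamard, NOT, CNOT and Toffoli gates, queries to $\mathcal O$ and calls of $U$ and $U^{-1}$; the running time of the program, the total cost of the printed sequence (with calls of $U^{\pm1}$ charged the size of $U$) and the number of qubits sum to at most $p(n)$, and there are at most $p(n)$ queries; and for every instance $(s,b_\emptyset)$, running the sequence on $|0\cdots0\rangle$ and measuring one qubit gives $b_\emptyset$ with probability at least $2/3$. 2. There is a constant $c>0$ such that for every function $g(n)=o(\log n)$ and all sufficiently large $n$, every randomized classical algorithm that, on every instance, outputs $b_\emptyset$ with probability at least $\frac12+n^{-g(n)}$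 makes at least $n^{c\log n}$ queries to $\mathcal O$ in the worst case. -/

import Mathlib

open Filter Asymptotics

namespace RecOracle

/-! ### Qubit registers and gates -/

/-- The (not necessarily normalised) pure states of a register of `W` qubits, written as amplitude
functions on the computational basis. -/
abbrev State (W : ℕ) : Type := (Fin W → Bool) → ℂ

/-- The all-zero basis state. -/
def zeroState (W : ℕ) : State W := Pi.single (fun _ => false) 1

open Classical in
/-- Apply the matrix `G` to the qubits `ws i`, `i : ι`, of a `W`-qubit register, and the identity to
the other qubits. If the listed wires are not distinct wires of the register, nothing happens. -/
noncomputable def applyOn {W : ℕ} {ι : Type} [Fintype ι] [DecidableEq ι] (ws : ι → ℕ)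
    (G : Matrix (ι → Bool) (ι → Bool) ℂ) (Ψ : State W) : State W :=
  if h : Function.Injective ws ∧ ∀ i, ws i < W then
    fun b => ∑ c : ι → Bool, G (fun i => b ⟨ws i, h.2 i⟩) c *
      Ψ (Function.extend (fun i => (⟨ws i, h.2 i⟩ : Fin W)) c b)
  else Ψ

open Classical in
/-- The matrix of the map `|c⟩ ↦ |π c⟩`. -/
noncomputable def basisMap {ι : Type} (π : (ι → Bool) → (ι → Bool)) :
    Matrix (ι → Bool) (ι → Bool) ℂ :=
  fun b c => if b = π c then 1 else 0

/-- The Hadamard matrix. -/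
noncomputable def hadamard : Matrix (Fin 1 → Bool) (Fin 1 → Bool) ℂ :=
  fun b c => (if b 0 && c 0 then -1 else 1) / (Real.sqrt 2 : ℂ)

/-- A gate of a quantum circuit on `N` qubits: an arbitrary unitary on two distinct qubits. -/
structure TwoQubitGate (N : ℕ) where
  fst : Fin N
  snd : Fin N
  ne : fst ≠ snd
  mat : Matrix.unitaryGroup (Fin 2 → Bool) ℂ

/-- The inverse gate. -/
def TwoQubitGate.adj {N : ℕ} (g : TwoQubitGate N) : TwoQubitGate N :=
  { g with mat := star g.mat }

/-- Run a circuit, given as the list of its gates, on the block of qubits starting at `base`. -/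
noncomputable def runCircuit {N W : ℕ} (base : ℕ) (C : List (TwoQubitGate N)) (Ψ : State W) :
    State W :=
  C.foldl (fun Φ g => applyOn (ι := Fin 2) ![base + g.fst, base + g.snd] g.mat.1 Φ) Ψ

/-- The inverse circuit. -/
def adjCircuit {N : ℕ} (C : List (TwoQubitGate N)) : List (TwoQubitGate N) :=
  (C.map TwoQubitGate.adj).reverse

/-! ### The single-level oracle identification problem -/

/-- A single-level oracle identification problem of size `n`: the inputs are `X = {0,1}ⁿ`, the
secrets form a set `A` of bit strings of length `m`, and `f : A × X → {0,1}`. -/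
structure SingleLevel (n : ℕ) where
  m : ℕ
  A : Finset (Fin m → Bool)
  f : A → (Fin n → Bool) → Bool

/-- A quantum circuit with `n` input qubits, `work` workspace qubits that start in `|0⟩`, and `m`
output qubits, which are the first `m` qubits. -/
structure IdCircuit (n m : ℕ) where
  work : ℕ
  out_le : m ≤ n + work
  gates : List (TwoQubitGate (n + work))

open Classical in
/-- The state `|φ_a⟩ = 2^{-n/2} ∑ₓ (-1)^{f(a,x)} |x⟩` followed by `work` qubits in `|0⟩`. -/
noncomputable def SingleLevel.phi {n : ℕ} (P : SingleLevel n) (work : ℕ) (a : P.A) :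
    State (n + work) :=
  fun b => if ∀ j : Fin work, b (Fin.natAdd n j) = false then
    (if P.f a (fun i => b (Fin.castAdd work i)) then -1 else 1) / (Real.sqrt (2 ^ n) : ℂ)
  else 0

open Classical in
/-- The probability that measuring the output qubits of `U |φ_a⟩|0⟩` gives `a`. Without workspace and
with `m = n` this is `|⟨a|U|φ_a⟩|²`. -/
noncomputable def successProb {n : ℕ} (P : SingleLevel n) (U : IdCircuit n P.m) (a : P.A) : ℝ :=
  ∑ b : Fin (n + U.work) → Bool,
    if (fun i : Fin P.m => b (Fin.castLE U.out_le i)) = a.1 then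
      ‖runCircuit 0 U.gates (P.phi U.work a) b‖ ^ 2
    else 0

/-! ### The recursive oracle identification problem -/

/-- The inputs of the oracle of the level-`l` problem: `⋃_{k<l} (Xᵏ × {0,1}ᵐ) ∪ Xˡ`, where
`X = {0,1}ⁿ`. -/
inductive Query (n m l : ℕ) : Type
  | node (k : Fin l) (x : Fin k → Fin n → Bool) (a : Fin m → Bool) : Query n m l
  | leaf (x : Fin l → Fin n → Bool) : Query n m l

/-- A secret for every internal node of the tree of depth `l`. -/
abbrev Secret {n : ℕ} (P : SingleLevel n) (l : ℕ) : Type :=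
  (k : Fin l) → (Fin k → Fin n → Bool) → P.A

/-- The bit of the node `x ∈ Xᵏ`: it is `b` at the root, and `f(s(x₁,…,x_{k-1}), x_k)` elsewhere. -/
def nodeBit {n : ℕ} (P : SingleLevel n) {l : ℕ} (s : Secret P l) (b : Bool) :
    (k : ℕ) → k ≤ l → (Fin k → Fin n → Bool) → Bool
  | 0, _, _ => b
  | k + 1, hk, x => P.f (s ⟨k, hk⟩ (fun i => x i.castSucc)) (x (Fin.last k))

/-- The oracle with secrets `s` and answer `b` at the root; `none` stands for FAIL. -/
def oracle {n : ℕ} (P : SingleLevel n) {l : ℕ} (s : Secret P l) (b : Bool) :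
    Query n P.m l → Option Bool
  | .node k x a => if a = (s k x).1 then some (nodeBit P s b k k.2.le x) else none
  | .leaf x => some (nodeBit P s b l le_rfl x)

/-! ### Quantum query algorithms -/

/-- The elementary operations of a quantum algorithm that may query the oracle and use a circuit `U`
as a subroutine. The arguments are wires, except that the first argument of `node` is a depth.
* `node k px pa r` queries the oracle at depth `k < l`: the `i`-th of the strings `x₁,…,x_k` is read
  from the block of wires starting at `px + i * n`, the label `a` from the block starting at `pa`,
  and the answer is added to the wires `r`, `r + 1`;
* `leaf px r` queries the oracle at depth `l`;
* `sub inv q` runs `U`, or its inverse, on the block of wires starting at `q`. -/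
inductive Op : Type
  | had (i : ℕ)
  | not (i : ℕ)
  | cnot (i j : ℕ)
  | toffoli (i j k : ℕ)
  | node (k px pa r : ℕ)
  | leaf (px r : ℕ)
  | sub (inv : Bool) (q : ℕ)

/-- Replace every numerical argument `i` by `M i`. -/
def Op.map (M : ℕ → ℕ) : Op → Op
  | .had i => .had (M i)
  | .not i => .not (M i)
  | .cnot i j => .cnot (M i) (M j)
  | .toffoli i j k => .toffoli (M i) (M j) (M k)
  | .node k px pa r => .node (M k) (M px) (M pa) (M r)
  | .leaf px r => .leaf (M px) (M r)
  | .sub inv q => .sub inv (M q)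

/-- Is the operation a query? -/
def Op.isQuery : Op → Bool
  | .node .. => true
  | .leaf .. => true
  | _ => false

/-- The time taken by an operation: a query costs the number of wires it touches, a call of the
subroutine the number of its gates, any other gate one. -/
def Op.cost (n m l sizeU : ℕ) : Op → ℕ
  | .node k _ _ _ => k * n + m + 2
  | .leaf _ _ => l * n + 2
  | .sub _ _ => sizeU
  | _ => 1

/-- Two-bit encoding of the oracle's answers. -/
def encAnswer : Option Bool → Fin 2 → Bool
  | none => ![false, false]
  | some v => ![true, v]

/-- The map `|c⟩|t⟩ ↦ |c⟩|t ⊕ enc (ans c)⟩`. -/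
noncomputable def queryMatrix {ι : Type} (ans : (ι → Bool) → Option Bool) :
    Matrix (ι ⊕ Fin 2 → Bool) (ι ⊕ Fin 2 → Bool) ℂ :=
  basisMap fun c => Sum.elim (fun i => c (.inl i))
    (fun t => xor (c (.inr t)) (encAnswer (ans fun i => c (.inl i)) t))

/-- The action of an operation on a `W`-qubit register, for the oracle `O` and the subroutine `C`. -/
noncomputable def Op.apply {n m l N W : ℕ} (O : Query n m l → Option Bool)
    (C : List (TwoQubitGate N)) : Op → State W → State W
  | .had i, Ψ => applyOn (ι := Fin 1) ![i] hadamard Ψ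
  | .not i, Ψ => applyOn (ι := Fin 1) ![i] (basisMap fun c => ![!(c 0)]) Ψ
  | .cnot i j, Ψ => applyOn (ι := Fin 2) ![i, j] (basisMap fun c => ![c 0, xor (c 1) (c 0)]) Ψ
  | .toffoli i j k, Ψ =>
      applyOn (ι := Fin 3) ![i, j, k] (basisMap fun c => ![c 0, c 1, xor (c 2) (c 0 && c 1)]) Ψ
  | .node k px pa r, Ψ =>
      if hk : k < l then
        applyOn (ι := (Fin k × Fin n ⊕ Fin m) ⊕ Fin 2)
          (Sum.elim (Sum.elim (fun p => px + p.1 * n + p.2) (fun j => pa + j)) (fun t => r + t))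
          (queryMatrix fun c =>
            O (.node ⟨k, hk⟩ (fun i j => c (.inl (i, j))) (fun j => c (.inr j)))) Ψ
      else Ψ
  | .leaf px r, Ψ =>
      applyOn (ι := (Fin l × Fin n) ⊕ Fin 2)
        (Sum.elim (fun p => px + p.1 * n + p.2) (fun t => r + t))
        (queryMatrix fun c => O (.leaf fun i j => c (i, j))) Ψ
  | .sub inv q, Ψ => runCircuit q (if inv then adjCircuit C else C) Ψ

/-- The final state of a sequence of operations started on `|0…0⟩`. -/
noncomputable def runOps {n m l N : ℕ} (W : ℕ) (O : Query n m l → Option Bool)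
    (C : List (TwoQubitGate N)) (ops : List Op) : State W :=
  ops.foldl (fun Ψ o => o.apply O C Ψ) (zeroState W)

open Classical in
/-- The probability that measuring qubit `0` gives `v`. -/
noncomputable def outputProb {W : ℕ} (Ψ : State W) (v : Bool) : ℝ :=
  ∑ b : Fin W → Bool, if ∃ h : 0 < W, b ⟨0, h⟩ = v then ‖Ψ b‖ ^ 2 else 0

/-! ### The classical control: random access machines with addition and subtraction -/

/-- Structured programs of a random access machine with memory `ℕ → ℕ` which can emit quantum
operations. All arguments are memory addresses, except the value `c` in `const`. -/
inductive Prog : Type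
  | const (i c : ℕ)
  | add (i j k : ℕ)
  | sub (i j k : ℕ)
  | load (i j : ℕ)
  | store (i j : ℕ)
  | emit (o : Op)
  | seq (p q : Prog)
  | ite (i : ℕ) (p q : Prog)
  | while (i : ℕ) (p : Prog)

/-- `Exec p M ops M' t`: started with memory `M`, the program `p` halts after `t` steps with memory
`M'`, having emitted the sequence `ops`. -/
inductive Exec : Prog → (ℕ → ℕ) → List Op → (ℕ → ℕ) → ℕ → Prop
  | const (i c : ℕ) (M : ℕ → ℕ) : Exec (.const i c) M [] (Function.update M i c) 1
  | add (i j k : ℕ) (M : ℕ → ℕ) : Exec (.add i j k) M [] (Function.update M i (M j + M k)) 1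
  | sub (i j k : ℕ) (M : ℕ → ℕ) : Exec (.sub i j k) M [] (Function.update M i (M j - M k)) 1
  | load (i j : ℕ) (M : ℕ → ℕ) : Exec (.load i j) M [] (Function.update M i (M (M j))) 1
  | store (i j : ℕ) (M : ℕ → ℕ) : Exec (.store i j) M [] (Function.update M (M i) (M j)) 1
  | emit (o : Op) (M : ℕ → ℕ) : Exec (.emit o) M [o.map M] M 1
  | seq {p q : Prog} {M M₁ M₂ : ℕ → ℕ} {ops₁ ops₂ : List Op} {t₁ t₂ : ℕ} :
      Exec p M ops₁ M₁ t₁ → Exec q M₁ ops₂ M₂ t₂ →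
      Exec (.seq p q) M (ops₁ ++ ops₂) M₂ (t₁ + t₂)
  | ite_true {i : ℕ} {p q : Prog} {M M₁ : ℕ → ℕ} {ops : List Op} {t : ℕ} :
      M i ≠ 0 → Exec p M ops M₁ t → Exec (.ite i p q) M ops M₁ (t + 1)
  | ite_false {i : ℕ} {p q : Prog} {M M₁ : ℕ → ℕ} {ops : List Op} {t : ℕ} :
      M i = 0 → Exec q M ops M₁ t → Exec (.ite i p q) M ops M₁ (t + 1)
  | while_done {i : ℕ} {p : Prog} {M : ℕ → ℕ} :
      M i = 0 → Exec (.while i p) M [] M 1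
  | while_step {i : ℕ} {p : Prog} {M M₁ M₂ : ℕ → ℕ} {ops₁ ops₂ : List Op} {t₁ t₂ : ℕ} :
      M i ≠ 0 → Exec p M ops₁ M₁ t₁ → Exec (.while i p) M₁ ops₂ M₂ t₂ →
      Exec (.while i p) M (ops₁ ++ ops₂) M₂ (t₁ + t₂ + 1)

/-- The initial memory: the size `n`, the length `m` of the labels, the size `work` of the workspace
of the subroutine, and zeros. -/
def initMem (n m work : ℕ) : ℕ → ℕ
  | 0 => n
  | 1 => m
  | 2 => work
  | _ => 0

/-- On problems of size `n`, the quantum algorithm `prog`, with subroutine `U`, solves the level-`l`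
recursive problem built from `P`, with error probability at most `1/3`. It makes at most `q` queries,
and its time (steps of the classical control plus costs of the emitted operations) and its number
of qubits are together at most `T`. -/
def SolvesWithin (prog : Prog) {n : ℕ} (P : SingleLevel n) (U : IdCircuit n P.m)
    (l q T : ℕ) : Prop :=
  ∃ (ops : List Op) (M : ℕ → ℕ) (t W : ℕ),
    Exec prog (initMem n P.m U.work) ops M t ∧
    ops.countP Op.isQuery ≤ q ∧
    t + (ops.map (Op.cost n P.m l U.gates.length)).sum + W ≤ T ∧
    ∀ (s : Secret P l) (b : Bool), 2 / 3 ≤ outputProb (runOps W (oracle P s b) U.gates ops) b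

/-! ### Classical query algorithms -/

/-- Deterministic classical query algorithms: adaptive decision trees. -/
inductive DecisionTree (I R : Type) : Type
  | answer (b : Bool) : DecisionTree I R
  | query (i : I) (next : R → DecisionTree I R) : DecisionTree I R

/-- The output on oracle `O`. -/
def DecisionTree.run {I R : Type} (O : I → R) : DecisionTree I R → Bool
  | .answer b => b
  | .query i next => (next (O i)).run O

/-- The number of queries made on oracle `O`. -/
def DecisionTree.queries {I R : Type} (O : I → R) : DecisionTree I R → ℕ
  | .answer _ => 0
  | .query i next => (next (O i)).queries O + 1

/-- A randomized classical query algorithm for the level-`l` recursive problem built from `P`. -/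
abbrev ClassicalAlg {n : ℕ} (P : SingleLevel n) (l : ℕ) : Type :=
  PMF (DecisionTree (Query n P.m l) (Option Bool))

/-- The algorithm never makes more than `q` queries. -/
def MakesAtMost {n : ℕ} {P : SingleLevel n} {l : ℕ} (D : ClassicalAlg P l) (q : ℕ) : Prop :=
  ∀ t ∈ D.support, ∀ (s : Secret P l) (b : Bool), t.queries (oracle P s b) ≤ q

/-- On every instance, the algorithm outputs the bit at the root with probability at least `r`. -/
def SucceedsWithProb {n : ℕ} {P : SingleLevel n} {l : ℕ} (D : ClassicalAlg P l) (r : ℝ) : Prop :=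
  ∀ (s : Secret P l) (b : Bool), r ≤ ((D.map fun t => t.run (oracle P s b)) b).toReal

end RecOracle

/-! Classical bound. Call a node hit when the oracle answers there without FAIL, and call it lucky
when its secret is guessed while fewer than `t` of its children have been hit. If no node is lucky,
every hit internal node has at least `t` hit children, so hitting the root costs at least `t ^ l`
queries. Luck is rare: a hit child reveals one bit about the secret of its parent, so before `t`
children are hit an algorithm distinguishes at most `2 ^ t` cases, and in each of them it rules out
at most `q` labels. Resampling the secret of one node with all others fixed bounds its chance of
being lucky by `2 ^ t * q / |A|`, and this can only occur at nodes that are touched, meaning that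
the node or one of its children is queried. Touching a node does not depend on its secret, and at
most `2 * q` nodes are touched, so the root is hit with probability at most `2 ^ t * q * (2 * q) /
|A|` when `q < t ^ l`. Without a hit at the root the output does not depend on the root bit. Taking
`t` about `α n / 2` leaves `|A| / 2 ^ t` exponentially large while `t ^ l` is still superpolynomial.
The carriers are `card_lucky_le`, `card_mul_card_root_hit_le` and `advantage_le`.

Quantum algorithm. To add the sign of the bit of a node, put the next string in superposition,
recursively add the signs of the children's bits, run `U`, query the node with the label obtained,
and keep the answer if it is not FAIL. One attempt succeeds with probability only `δ`, so a constant
number `R` of attempts is nested: each works on fresh wires and passes on an accumulator that holds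
the answer if the label was right and the previous accumulator otherwise. After the last attempt the
sign of the accumulator is added and all attempts are undone. The amplitude on states with a wrong
accumulator shrinks by a factor `θ = √(1 - δ) + ε` per attempt, where `ε` is the error of the
recursive call for the children. The error of the whole call is at most `2 * θ ^ R`, so if `2 * θ ^
R ≤ ε` the error does not grow with the depth. The choice `ε = δ / 4` makes `θ ≤ 1 - δ / 4`, and a
constant `R` suffices. The carriers are `nm_trialOps_le` and `nm_treeOps_sub_le`.

Each call makes at most three further calls, and the recursion height is `l * (R + 1) + R` with `l =
⌊log₂ n⌋`, so time and space are polynomial in `n`. Ancillas are allocated like the nodes of a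
binary heap, which makes wires of different calls disjoint. A stack machine prints the sequence;
since the call sequence is its own inverse, it never has to print a recursive call backwards. -/

namespace RecOracle

/-! ### The classical lower bound -/

/-! ### Decision trees that look for a hidden element -/

section Hidden

variable {I R α Y : Type}

/-- Run on the oracle `O`, the tree guesses the hidden element `a` while it has seen less than `t`
of the children, of which those in `K` were seen before. -/
def DecisionTree.Lucky [DecidableEq Y] (O : I → R) (guess : I → Option α) (child : I → Option Y)
    (t : ℕ) (a : α) : DecisionTree I R → Finset Y → Prop
  | .answer _, _ => False
  | .query i next, K => (guess i = some a ∧ K.card < t) ∨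
      (next (O i)).Lucky O guess child t a (K ∪ (child i).toFinset)

/-- Run on the oracle `O`, the tree makes a guess or sees a child. -/
def DecisionTree.Touches (O : I → R) (guess : I → Option α) (child : I → Option Y) :
    DecisionTree I R → Prop
  | .answer _ => False
  | .query i next => guess i ≠ none ∨ child i ≠ none ∨ (next (O i)).Touches O guess child

theorem DecisionTree.Lucky.touches [DecidableEq Y] {O : I → R} {guess : I → Option α}
    {child : I → Option Y}
    {t : ℕ} {a : α} {T : DecisionTree I R} {K : Finset Y} (h : T.Lucky O guess child t a K) :
    T.Touches O guess child := by
  induction T generalizing K with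
  | answer b => exact h
  | query i next ih =>
    rcases h with h | h
    · exact Or.inl (by simp [h.1])
    · exact Or.inr (Or.inr (ih _ h))

theorem DecisionTree.Lucky.card_lt [DecidableEq Y] {O : I → R} {guess : I → Option α}
    {child : I → Option Y}
    {t : ℕ} {a : α} {T : DecisionTree I R} {K : Finset Y} (h : T.Lucky O guess child t a K) :
    K.card < t := by
  induction T generalizing K with
  | answer b => exact h.elim
  | query i next ih =>
    rcases h with h | h
    · exact h.2
    · exact (Finset.card_le_card Finset.subset_union_left).trans_lt (ih _ h)

/-- Until the first guess or child query all answers are the same for every hidden element, so the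
runs for `a` and `a'` coincide up to that point. -/
theorem DecisionTree.Touches.of_touches {O : α → I → R} {guess : I → Option α}
    {child : I → Option Y}
    (h₁ : ∀ i, guess i = none → child i = none → ∀ a a', O a i = O a' i)
    {a a' : α} {T : DecisionTree I R} (h : T.Touches (O a) guess child) :
    T.Touches (O a') guess child := by
  induction T with
  | answer b => exact h
  | query i next ih =>
    by_cases hg : guess i = none
    · by_cases hc : child i = none
      · refine Or.inr (Or.inr ?_)
        rcases h with h | h | h
        · exact (h hg).elim
        · exact (h hc).elim
        · rw [h₁ i hg hc a' a]
          exact ih _ h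
      · exact Or.inr (Or.inl hc)
    · exact Or.inl hg

-- The set `C` holds the hidden elements still compatible with the answers. Only a child outside `K`
-- splits `C`, into two halves, and this happens at most `t - K.card` times before luck is excluded,
-- which gives the power of two. Along each resulting branch every guess catches at most one
-- element, which gives the factor `q`. The hypotheses say that other queries reveal nothing, that a
-- failed guess reveals only the failure, and that a child reveals only its bit.
open Classical in
theorem DecisionTree.card_lucky_le [DecidableEq α] [DecidableEq Y] {O : α → I → R}
    {guess : I → Option α} {child : I → Option Y}
    {v : Y → α → Bool} {t : ℕ}
    (h₁ : ∀ i, guess i = none → child i = none → ∀ a a', O a i = O a' i)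
    (h₂ : ∀ i a₀, guess i = some a₀ → child i = none ∧
      ∀ a a', a ≠ a₀ → a' ≠ a₀ → O a i = O a' i)
    (h₃ : ∀ i y, child i = some y → guess i = none ∧
      ∀ a a', v y a = v y a' → O a i = O a' i)
    (T : DecisionTree I R) (K : Finset Y) (C : Finset α) (q : ℕ)
    (hK : ∀ y ∈ K, ∀ a ∈ C, ∀ a' ∈ C, v y a = v y a')
    (hq : ∀ a ∈ C, T.queries (O a) ≤ q) :
    (C.filter fun a => T.Lucky (O a) guess child t a K).card ≤ 2 ^ (t - K.card) * q := by
  induction T generalizing K C q with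
  | answer b =>
    rw [Finset.filter_false_of_mem
      (p := fun a => (answer b).Lucky (O a) guess child t a K) fun a _ h => h]
    simp
  | query i next ih =>
    rcases C.eq_empty_or_nonempty with rfl | ⟨c, hc⟩
    · simp
    obtain ⟨q, rfl⟩ : ∃ q', q = q' + 1 :=
      ⟨q - 1, by have := hq c hc; simp only [DecisionTree.queries] at this; omega⟩
    have hq' : ∀ a ∈ C, (next (O a i)).queries (O a) ≤ q := fun a ha => by
      have := hq a ha; simp only [DecisionTree.queries] at this; omega
    rcases hg : guess i with _ | a₀
    · rcases hch : child i with _ | y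
      · have hr : ∀ a, O a i = O c i := fun a => h₁ i hg hch a c
        have := ih (O c i) K C q hK (fun a ha => by rw [← hr a]; exact hq' a ha)
        refine le_trans (le_of_eq ?_) (this.trans (Nat.mul_le_mul_left _ (Nat.le_succ q)))
        congr 1
        refine Finset.filter_congr fun a _ => ?_
        simp [DecisionTree.Lucky, hg, hch, hr a]
      · have h3 := (h₃ i y hch).2
        by_cases hy : y ∈ K
        · have hr : ∀ a ∈ C, O a i = O c i := fun a ha => h3 a c (hK y hy a ha c hc)
          have := ih (O c i) K C q hK (fun a ha => by rw [← hr a ha]; exact hq' a ha)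
          refine le_trans (le_of_eq ?_) (this.trans (Nat.mul_le_mul_left _ (Nat.le_succ q)))
          congr 1
          refine Finset.filter_congr fun a ha => ?_
          have : K ∪ {y} = K := by simpa using hy
          simp [DecisionTree.Lucky, hg, hch, hr a ha, this]
        · by_cases ht : K.card < t
          · have key : ∀ w : Bool, ((C.filter fun a => v y a = w).filter fun a =>
                (DecisionTree.query i next).Lucky (O a) guess child t a K).card ≤
                2 ^ (t - K.card - 1) * q := by
              intro w
              rcases (C.filter fun a => v y a = w).eq_empty_or_nonempty with he | ⟨d, hd⟩
              · simp [he]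
              have hr : ∀ a ∈ C.filter fun a => v y a = w, O a i = O d i := fun a ha =>
                h3 a d ((Finset.mem_filter.1 ha).2.trans (Finset.mem_filter.1 hd).2.symm)
              have hcard : (insert y K).card = K.card + 1 := Finset.card_insert_of_notMem hy
              have := ih (O d i) (insert y K) (C.filter fun a => v y a = w) q ?_ ?_
              · rw [hcard, ← Nat.sub_sub] at this
                refine le_trans (le_of_eq ?_) this
                congr 1
                refine Finset.filter_congr fun a ha => ?_
                have hu : K ∪ {y} = insert y K := by rw [Finset.union_comm]; rfl
                simp [DecisionTree.Lucky, hg, hch, hr a ha, hu]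
              · intro z hz a ha a' ha'
                rcases Finset.mem_insert.1 hz with rfl | hz
                · exact (Finset.mem_filter.1 ha).2.trans (Finset.mem_filter.1 ha').2.symm
                · exact hK z hz a (Finset.mem_filter.1 ha).1 a' (Finset.mem_filter.1 ha').1
              · intro a ha
                rw [← hr a ha]
                exact hq' a (Finset.mem_filter.1 ha).1
            have hsplit : (C.filter fun a =>
                (DecisionTree.query i next).Lucky (O a) guess child t a K) ⊆
                ((C.filter fun a => v y a = true).filter fun a =>
                  (DecisionTree.query i next).Lucky (O a) guess child t a K) ∪
                ((C.filter fun a => v y a = false).filter fun a =>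
                  (DecisionTree.query i next).Lucky (O a) guess child t a K) := by
              intro a ha
              simp only [Finset.mem_union, Finset.mem_filter] at ha ⊢
              cases v y a <;> simp [ha]
            refine (Finset.card_le_card hsplit).trans ((Finset.card_union_le _ _).trans ?_)
            have h2 : 2 ^ (t - K.card) = 2 * 2 ^ (t - K.card - 1) := by
              rw [← pow_succ']; congr 1; omega
            rw [h2]
            nlinarith [key true, key false, Nat.zero_le (2 ^ (t - K.card - 1))]
          · rw [Finset.filter_false_of_mem (fun a _ h => ht h.card_lt)]
            simp
    · have h2 := h₂ i a₀ hg
      -- The guess may catch `a₀`. All other candidates receive the same answer and continue in one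
      -- branch with one query less; the element `a₀` is absorbed by passing from `q` to `q + 1`.
      have hsub : (C.filter fun a => (DecisionTree.query i next).Lucky (O a) guess child t a K) ⊆
          insert a₀ ((C.erase a₀).filter fun a =>
            (next (O a i)).Lucky (O a) guess child t a K) := by
        intro a ha
        simp only [Finset.mem_insert, Finset.mem_filter, Finset.mem_erase] at ha ⊢
        by_cases h : a = a₀
        · exact Or.inl h
        · refine Or.inr ⟨⟨h, ha.1⟩, ?_⟩
          rcases ha.2 with h' | h'
          · rw [hg] at h'
            exact (h (Option.some.inj h'.1).symm).elim
          · simpa [h2.1] using h'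
      refine (Finset.card_le_card hsub).trans ((Finset.card_insert_le _ _).trans ?_)
      have key : ((C.erase a₀).filter fun a =>
            (next (O a i)).Lucky (O a) guess child t a K).card ≤ 2 ^ (t - K.card) * q := by
        rcases (C.erase a₀).eq_empty_or_nonempty with he | ⟨d, hd⟩
        · simp [he]
        have hr : ∀ a ∈ C.erase a₀, O a i = O d i := fun a ha =>
          h2.2 a d (Finset.mem_erase.1 ha).1 (Finset.mem_erase.1 hd).1
        refine le_trans (le_of_eq ?_) (ih (O d i) K (C.erase a₀) q ?_ ?_)
        · congr 1
          exact Finset.filter_congr fun a ha => by rw [hr a ha]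
        · exact fun y hy a ha a' ha' =>
            hK y hy a (Finset.mem_of_mem_erase ha) a' (Finset.mem_of_mem_erase ha')
        · intro a ha
          rw [← hr a ha]
          exact hq' a (Finset.mem_of_mem_erase ha)
      have : 1 ≤ 2 ^ (t - K.card) := Nat.one_le_two_pow
      nlinarith

end Hidden

/-! ### Runs on a random instance -/

/-- The path from a node to the root. -/
def nodeId {n : ℕ} : (k : ℕ) → (Fin k → Fin n → Bool) → List (Fin n → Bool)
  | 0, _ => []
  | k + 1, x => x (Fin.last k) :: nodeId k (fun i => x i.castSucc)

theorem length_nodeId {n : ℕ} (k : ℕ) (x : Fin k → Fin n → Bool) : (nodeId k x).length = k := by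
  induction k with
  | zero => rfl
  | succ k ih => simp [nodeId, ih]

theorem nodeId_injective {n : ℕ} (k : ℕ) :
    Function.Injective (nodeId k : (Fin k → Fin n → Bool) → _) := by
  induction k with
  | zero => exact fun x y _ => Subsingleton.elim _ _
  | succ k ih =>
    intro x y h
    simp only [nodeId, List.cons.injEq] at h
    funext i
    refine Fin.lastCases h.1 (fun j => congrFun (ih h.2) j) i

theorem nodeId_inj {n l : ℕ} {k k' : Fin l} {x : Fin k → Fin n → Bool} {x' : Fin k' → Fin n → Bool}
    (h : nodeId k x = nodeId k' x') :
      (⟨k, x⟩ : (k : Fin l) × (Fin k → Fin n → Bool)) = ⟨k', x'⟩ := by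
  have hk : k = k' := by
    have := congrArg List.length h
    rw [length_nodeId, length_nodeId] at this
    exact Fin.ext this
  subst hk
  rw [nodeId_injective _ h]

/-- The node to which a query refers. -/
def Query.id {n m l : ℕ} : Query n m l → List (Fin n → Bool)
  | .node k x _ => nodeId k x
  | .leaf x => nodeId l x

/-! ### Hit nodes and the growth of the hit tree -/

section Runs

variable {n : ℕ} {P : SingleLevel n} {l : ℕ}

/-- The query is not answered by FAIL. -/
def Query.Hit (s : Secret P l) : Query n P.m l → Prop
  | .node k x a => a = (s k x).1
  | .leaf _ => True

open Classical in
/-- The nodes at which the oracle gave its answer away. -/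
noncomputable def hitSet (s : Secret P l) (b : Bool) :
    DecisionTree (Query n P.m l) (Option Bool) → Finset (List (Fin n → Bool))
  | .answer _ => ∅
  | .query i next => (if i.Hit s then {i.id} else ∅) ∪ hitSet s b (next (oracle P s b i))

/-- The nodes that are queried, and their parents. -/
def touchSet (s : Secret P l) (b : Bool) :
    DecisionTree (Query n P.m l) (Option Bool) → Finset (List (Fin n → Bool))
  | .answer _ => ∅
  | .query i next => {i.id, i.id.tail} ∪ touchSet s b (next (oracle P s b i))

open Classical in
/-- The secret of the node `z` is queried when less than `t` children of `z` have been hit. -/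
noncomputable def LuckyAt (s : Secret P l) (b : Bool) (t : ℕ) (z : List (Fin n → Bool)) :
    DecisionTree (Query n P.m l) (Option Bool) → Finset (List (Fin n → Bool)) → Prop
  | .answer _, _ => False
  | .query i next, H => (i.Hit s ∧ i.id = z ∧ (Finset.univ.filter fun y => y :: z ∈ H).card < t) ∨
      LuckyAt s b t z (next (oracle P s b i)) (H ∪ if i.Hit s then {i.id} else ∅)

theorem card_hitSet_le (s : Secret P l) (b : Bool)
    (T : DecisionTree (Query n P.m l) (Option Bool)) :
    (hitSet s b T).card ≤ T.queries (oracle P s b) := by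
  induction T with
  | answer b => simp [hitSet]
  | query i next ih =>
    refine (Finset.card_union_le _ _).trans ?_
    rw [DecisionTree.queries, add_comm]
    refine Nat.add_le_add (ih _) ?_
    split <;> simp

theorem card_touchSet_le (s : Secret P l) (b : Bool)
    (T : DecisionTree (Query n P.m l) (Option Bool)) :
    (touchSet s b T).card ≤ 2 * T.queries (oracle P s b) := by
  induction T with
  | answer b => simp [touchSet]
  | query i next ih =>
    refine (Finset.card_union_le _ _).trans ?_
    rw [DecisionTree.queries]
    have := ih (oracle P s b i)
    have h2 : ({i.id, i.id.tail} : Finset (List (Fin n → Bool))).card ≤ 2 := Finset.card_le_two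
    omega

-- At the moment when `z` is hit, the absence of luck says that `t` of its children are already in
-- the set, and the set only grows afterwards.
open Classical in
theorem le_card_children (s : Secret P l) (b : Bool) (t : ℕ)
    (T : DecisionTree (Query n P.m l) (Option Bool)) (H : Finset (List (Fin n → Bool)))
    (hH : ∀ z ∈ H, z.length < l → t ≤ (Finset.univ.filter fun y => y :: z ∈ H).card)
    (hT : ∀ z, z.length < l → ¬ LuckyAt s b t z T H) :
    ∀ z ∈ H ∪ hitSet s b T, z.length < l →
      t ≤ (Finset.univ.filter fun y => y :: z ∈ H ∪ hitSet s b T).card := by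
  induction T generalizing H with
  | answer b => simpa [hitSet] using hH
  | query i next ih =>
    rw [hitSet, ← Finset.union_assoc]
    refine ih _ _ ?_ (fun z hz h => hT z hz (Or.inr h))
    intro z hz hl
    have hmono : (Finset.univ.filter fun y => y :: z ∈ H).card ≤
        (Finset.univ.filter fun y => y :: z ∈ H ∪ if i.Hit s then {i.id} else ∅).card :=
      Finset.card_le_card (Finset.monotone_filter_right _ fun y _ hy => Finset.mem_union_left _ hy)
    refine le_trans ?_ hmono
    rcases Finset.mem_union.1 hz with hz | hz
    · exact hH z hz hl
    · split at hz
      · rename_i hi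
        rw [Finset.mem_singleton] at hz
        by_contra hlt
        exact hT z hl (Or.inl ⟨hi, hz.symm, not_le.1 hlt⟩)
      · simp at hz

/-- Each level is at least `t` times as large as the one above it, because a list determines its
parent and so children of different nodes are different. -/
theorem pow_le_card_of_children {X : Type} [Fintype X] [DecidableEq X] (l t : ℕ)
    (H : Finset (List X)) (h0 : [] ∈ H)
    (hH : ∀ z ∈ H, z.length < l → t ≤ (Finset.univ.filter fun y => y :: z ∈ H).card) :
    t ^ l ≤ H.card := by
  suffices h : ∀ k ≤ l, t ^ k ≤ (H.filter fun z => z.length = k).card from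
    (h l le_rfl).trans (Finset.card_filter_le _ _)
  intro k
  induction k with
  | zero =>
    intro _
    rw [pow_zero, Nat.one_le_iff_ne_zero, Finset.card_ne_zero]
    exact ⟨[], by simp [h0]⟩
  | succ k ih =>
    intro hk
    have hsub : ((H.filter fun z => z.length = k).sigma fun z =>
        Finset.univ.filter fun y => y :: z ∈ H).card ≤
          (H.filter fun z => z.length = k + 1).card := by
      refine Finset.card_le_card_of_injOn (fun p => p.2 :: p.1) ?_ ?_
      · rintro ⟨z, y⟩ h
        simp only [Finset.coe_sigma, Set.mem_sigma_iff, Finset.mem_coe, Finset.mem_filter,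
          Finset.mem_univ, true_and] at h ⊢
        exact ⟨h.2, by simp [h.1.2]⟩
      · rintro ⟨z, y⟩ _ ⟨z', y'⟩ _ h
        simp only [List.cons.injEq] at h
        obtain ⟨rfl, rfl⟩ := h
        rfl
    refine le_trans ?_ hsub
    rw [Finset.card_sigma, pow_succ]
    refine (Nat.mul_le_mul_right t (ih (by omega))).trans ?_
    rw [← smul_eq_mul]
    refine Finset.card_nsmul_le_sum _ _ _ fun z hz => ?_
    rw [Finset.mem_filter] at hz
    exact hH z hz.1 (by omega)

/-- The hit set does not depend on the bit at the root as long as the root is not hit. -/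
theorem run_eq_of_root_notMem (s : Secret P l) (hl : 0 < l) (b b' : Bool)
    (T : DecisionTree (Query n P.m l) (Option Bool)) (h : [] ∉ hitSet s b T) :
    T.run (oracle P s b') = T.run (oracle P s b) := by
  induction T with
  | answer b => rfl
  | query i next ih =>
    simp only [hitSet, Finset.mem_union, not_or] at h
    have hO : oracle P s b' i = oracle P s b i := by
      have h1 := h.1
      rcases i with ⟨⟨k, hk⟩, x, a⟩ | x
      · by_cases ha : a = (s ⟨k, hk⟩ x).1
        · rcases k with _ | k
          · simp [Query.Hit, ha, Query.id, nodeId] at h1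
          · simp [oracle, ha, nodeBit]
        · simp [oracle, ha]
      · rcases l with _ | l
        · omega
        · simp [oracle, nodeBit]
    simp only [DecisionTree.run]
    rw [hO]
    exact ih _ h.2

end Runs

/-! ### Resampling the secret of one node -/

section Resample

variable {n : ℕ} {P : SingleLevel n} {l : ℕ}

/-- Change the secret of the node `z` to `a`. -/
def resample (s : Secret P l) (z : List (Fin n → Bool)) (a : P.A) : Secret P l :=
  fun k x => if nodeId k x = z then a else s k x

-- Exchanging the secret at the node with `a` is an involution on pairs `(s, a)`, so resampling
-- preserves the uniform distribution.
open Classical in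
theorem sum_resample (k : Fin l) (x : Fin k → Fin n → Bool) (G : Secret P l → ℕ) :
    ∑ s, ∑ a : P.A, G (resample s (nodeId k x) a) = P.A.card * ∑ s, G s := by
  have hinv : Function.Involutive fun p : Secret P l × P.A =>
      ((resample p.1 (nodeId k x) p.2, p.1 k x) : Secret P l × P.A) := by
    rintro ⟨s, a⟩
    refine Prod.ext ?_ ?_
    · funext k' x'
      by_cases h : nodeId k' x' = nodeId k x
      · have := nodeId_inj h
        cases this
        simp [resample]
      · simp [resample, h]
    · simp [resample]
  have h1 := (Equiv.sum_comp hinv.toPerm (fun p : Secret P l × P.A => G p.1))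
  rw [Fintype.sum_prod_type, Fintype.sum_prod_type] at h1
  simp only [Function.Involutive.coe_toPerm, Finset.sum_const, Finset.card_univ] at h1
  rw [h1, Finset.mul_sum]
  simp

theorem nodeBit_resample (s : Secret P l) (b : Bool) (z : List (Fin n → Bool)) (a : P.A) (k : ℕ)
    (hk : k ≤ l) (x : Fin k → Fin n → Bool) (hx : ∀ y, nodeId k x ≠ y :: z) :
    nodeBit P (resample s z a) b k hk x = nodeBit P s b k hk x := by
  rcases k with _ | k
  · rfl
  · have : nodeId k (fun i => x i.castSucc) ≠ z := fun h => hx (x (Fin.last k)) (by rw [nodeId, h])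
    simp [nodeBit, resample, this]

theorem nodeBit_resample_child (s : Secret P l) (b : Bool) (z : List (Fin n → Bool)) (a : P.A)
    (k : ℕ) (hk : k ≤ l) (x : Fin k → Fin n → Bool) (y : Fin n → Bool) (hx : nodeId k x = y :: z) :
    nodeBit P (resample s z a) b k hk x = P.f a y := by
  rcases k with _ | k
  · simp [nodeId] at hx
  · simp only [nodeId, List.cons.injEq] at hx
    simp [nodeBit, resample, hx.1, hx.2]

/-- The label guessed by a query of the node `z`. -/
def guessAt (P : SingleLevel n) (l : ℕ) (z : List (Fin n → Bool)) : Query n P.m l → Option P.A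
  | .node k x a => if nodeId k x = z then (if h : a ∈ P.A then some ⟨a, h⟩ else none) else none
  | .leaf _ => none

open Classical in
/-- The child of the node `z` that the query hits. -/
noncomputable def childAt (s : Secret P l) (z : List (Fin n → Bool)) (i : Query n P.m l) :
    Option (Fin n → Bool) :=
  if h : i.Hit s ∧ ∃ y, i.id = y :: z then some h.2.choose else none

theorem childAt_eq_some {s : Secret P l} {z : List (Fin n → Bool)} {i : Query n P.m l}
    {y : Fin n → Bool} : childAt s z i = some y ↔ i.Hit s ∧ i.id = y :: z := by
  unfold childAt
  split
  · rename_i h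
    have h2 := h.2.choose_spec
    constructor
    · intro h3
      rw [Option.some.injEq] at h3
      exact ⟨h.1, h3 ▸ h2⟩
    · rintro ⟨_, h3⟩
      rw [h2] at h3
      simpa using h3
  · rename_i h
    simp only [reduceCtorEq, false_iff]
    exact fun h3 => h ⟨h3.1, y, h3.2⟩

theorem childAt_eq_none {s : Secret P l} {z : List (Fin n → Bool)} {i : Query n P.m l} :
    childAt s z i = none ↔ ∀ y, i.Hit s → i.id ≠ y :: z := by
  rw [Option.eq_none_iff_forall_ne_some]
  exact forall_congr' fun y => by rw [Ne, childAt_eq_some]; tauto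

/-- For this reason `childAt` may be computed from `s`: hitting a child of `z` depends on the secret
of the child and not on that of `z`. -/
theorem hit_resample {s : Secret P l} {z : List (Fin n → Bool)} {a : P.A} {i : Query n P.m l}
    (h : i.id ≠ z) : i.Hit (resample s z a) ↔ i.Hit s := by
  rcases i with ⟨k, x, c⟩ | x
  · have : nodeId k x ≠ z := h
    simp [Query.Hit, resample, this]
  · rfl

theorem guessAt_ne_none {z : List (Fin n → Bool)} {i : Query n P.m l} (h : guessAt P l z i ≠ none) :
    i.id = z := by
  rcases i with ⟨k, x, c⟩ | x
  · simp only [guessAt] at h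
    by_contra h2
    exact h (if_neg h2)
  · exact (h rfl).elim

theorem guessAt_of_hit {s : Secret P l} {z : List (Fin n → Bool)} {a : P.A} {i : Query n P.m l}
    (hz : z.length < l) (h : i.Hit (resample s z a)) (hi : i.id = z) :
    guessAt P l z i = some a := by
  rcases i with ⟨k, x, c⟩ | x
  · have hi' : nodeId k x = z := hi
    have h' : c = a.1 := by simpa [Query.Hit, resample, hi'] using h
    subst h'
    simp [guessAt, hi']
  · have hi' : nodeId l x = z := hi
    rw [← hi', length_nodeId] at hz
    omega

/-- The secret of `z` enters the oracle only through the label check at `z` and through the bits of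
the children of `z`, and such a bit is visible only when the child is hit. This lemma and the next
two are the hypotheses `h₁`, `h₂`, `h₃` of `card_lucky_le`. A label outside `P.A` fails for every
secret, so it does not count as a guess. -/
theorem oracle_resample_of_none {s : Secret P l} {b : Bool} {z : List (Fin n → Bool)}
    {i : Query n P.m l} (hg : guessAt P l z i = none) (hc : childAt s z i = none) (a a' : P.A) :
    oracle P (resample s z a) b i = oracle P (resample s z a') b i := by
  rw [childAt_eq_none] at hc
  rcases i with ⟨k, x, c⟩ | x
  · by_cases hz : nodeId k x = z
    · have hA : c ∉ P.A := by
        intro hA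
        simp [guessAt, hz, hA] at hg
      have h1 : ∀ a : P.A, c ≠ a.1 := fun a h => hA (h ▸ a.2)
      simp [oracle, resample, hz, h1]
    · by_cases hh : c = (s k x).1
      · have h2 : ∀ y, nodeId k x ≠ y :: z := fun y => hc y hh
        simp [oracle, resample, hz, hh, nodeBit_resample _ _ _ _ _ _ _ h2]
      · simp [oracle, resample, hz, hh]
  · have h2 : ∀ y, nodeId l x ≠ y :: z := fun y => hc y trivial
    simp [oracle, nodeBit_resample _ _ _ _ _ _ _ h2]

theorem oracle_resample_of_guess {s : Secret P l} {b : Bool} {z : List (Fin n → Bool)}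
    {i : Query n P.m l} {a₀ : P.A} (hg : guessAt P l z i = some a₀) : childAt s z i = none ∧
      ∀ a a', a ≠ a₀ → a' ≠ a₀ →
        oracle P (resample s z a) b i = oracle P (resample s z a') b i := by
  have hi : i.id = z := guessAt_ne_none (by rw [hg]; simp)
  refine ⟨childAt_eq_none.2 fun y _ h => ?_, fun a a' ha ha' => ?_⟩
  · rw [hi] at h
    simpa using congrArg List.length h
  · rcases i with ⟨k, x, c⟩ | x
    · have hi' : nodeId k x = z := hi
      by_cases hA : c ∈ P.A
      · have h0 : (⟨c, hA⟩ : P.A) = a₀ := by simpa [guessAt, hi', hA] using hg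
        have h1 : ∀ a : P.A, a ≠ a₀ → c ≠ a.1 := fun a ha h => ha (h0 ▸ Subtype.ext h.symm)
        simp [oracle, resample, hi', h1 a ha, h1 a' ha']
      · simp [guessAt, hA] at hg
    · simp [guessAt] at hg

theorem oracle_resample_of_child {s : Secret P l} {b : Bool} {z : List (Fin n → Bool)}
    {i : Query n P.m l} {y : Fin n → Bool} (hc : childAt s z i = some y) : guessAt P l z i = none ∧
      ∀ a a', P.f a y = P.f a' y →
        oracle P (resample s z a) b i = oracle P (resample s z a') b i := by
  rw [childAt_eq_some] at hc
  have hne : i.id ≠ z := fun h => by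
    have := hc.2
    rw [h] at this
    simpa using congrArg List.length this
  refine ⟨?_, fun a a' h => ?_⟩
  · by_contra hg
    exact hne (guessAt_ne_none hg)
  · rcases i with ⟨k, x, c⟩ | x
    · have hne' : nodeId k x ≠ z := hne
      have hc2 : nodeId k x = y :: z := hc.2
      simp [oracle, resample, hne', nodeBit_resample_child _ _ _ _ _ _ _ _ hc2, h]
    · have hc2 : nodeId l x = y :: z := hc.2
      simp [oracle, nodeBit_resample_child _ _ _ _ _ _ _ _ hc2, h]

-- The bound on the length of `z` excludes leaves, which are always hit and have no secret to guess.
open Classical in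
theorem LuckyAt.lucky {s : Secret P l} {b : Bool} {t : ℕ} {z : List (Fin n → Bool)}
    (hz : z.length < l) {a : P.A} {T : DecisionTree (Query n P.m l) (Option Bool)}
    {H : Finset (List (Fin n → Bool))} (h : LuckyAt (resample s z a) b t z T H) :
    T.Lucky (oracle P (resample s z a) b) (guessAt P l z) (childAt s z) t a
      (Finset.univ.filter fun y => y :: z ∈ H) := by
  induction T generalizing H with
  | answer b => exact h
  | query i next ih =>
    rcases h with h | h
    · exact Or.inl ⟨guessAt_of_hit hz h.1 h.2.1, h.2.2⟩
    · refine Or.inr ?_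
      convert ih _ h using 1
      ext y
      simp only [Finset.mem_union, Finset.mem_filter, Finset.mem_univ, true_and,
        Option.mem_toFinset, Option.mem_def, childAt_eq_some]
      refine or_congr Iff.rfl ?_
      constructor
      · rintro ⟨h1, h2⟩
        have hne : i.id ≠ z := fun h => by
          rw [h] at h2
          simpa using congrArg List.length h2
        rw [if_pos ((hit_resample hne).2 h1), h2]
        simp
      · intro h2
        split at h2
        · rename_i h1
          rw [Finset.mem_singleton] at h2
          have hne : i.id ≠ z := fun h => by
            rw [h] at h2
            simpa using congrArg List.length h2
          exact ⟨(hit_resample hne).1 h1, h2.symm⟩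
        · simp at h2

theorem mem_touchSet_of_touches {s s' : Secret P l} {b : Bool} {z : List (Fin n → Bool)}
    {T : DecisionTree (Query n P.m l) (Option Bool)}
    (h : T.Touches (oracle P s' b) (guessAt P l z) (childAt s z)) : z ∈ touchSet s' b T := by
  induction T with
  | answer b => exact h.elim
  | query i next ih =>
    rw [touchSet, Finset.mem_union]
    rcases h with h | h | h
    · exact Or.inl (by simp [guessAt_ne_none h])
    · obtain ⟨y, hy⟩ := Option.ne_none_iff_exists'.1 h
      rw [childAt_eq_some] at hy
      exact Or.inl (by simp [hy.2])
    · exact Or.inr (ih _ h)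

-- All secrets other than that of the node are fixed and its secret is averaged over `P.A`. If the
-- run touches the node, `card_lucky_le` bounds the number of lucky choices. If not, no choice is
-- lucky, since touching does not depend on the choice. Keeping the touch indicator on the right
-- prevents a loss of the number of all nodes when nodes are summed.
open Classical in
theorem card_mul_sum_lucky_le (b : Bool) (t q : ℕ)
    (T : DecisionTree (Query n P.m l) (Option Bool)) (hq : ∀ s, T.queries (oracle P s b) ≤ q)
    (k : Fin l) (x : Fin k → Fin n → Bool) :
    P.A.card * ∑ s : Secret P l, (if LuckyAt s b t (nodeId k x) T ∅ then 1 else 0) ≤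
      2 ^ t * q * ∑ s : Secret P l, (if nodeId k x ∈ touchSet s b T then 1 else 0) := by
  rw [← sum_resample k x, Finset.mul_sum]
  refine Finset.sum_le_sum fun s _ => ?_
  set z := nodeId k x with hz
  have hlen : z.length < l := by rw [hz, length_nodeId]; exact k.2
  have hs : resample s z (s k x) = s := by
    funext k' x'
    by_cases h : nodeId k' x' = nodeId k x
    · have := nodeId_inj h
      cases this
      simp [resample, hz]
    · simp [resample, hz, h]
  split
  · rw [mul_one]
    refine le_trans ?_ ((DecisionTree.card_lucky_le (v := fun y a => P.f a y) (t := t)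
      (O := fun a => oracle P (resample s z a) b) (guess := guessAt P l z) (child := childAt s z)
      (fun i hg hc => oracle_resample_of_none hg hc)
      (fun i a₀ hg => oracle_resample_of_guess hg)
      (fun i y hc => oracle_resample_of_child hc) T ∅ Finset.univ q (by simp)
      (fun a _ => hq _)).trans (by simp))
    rw [Finset.card_filter]
    refine Finset.sum_le_sum fun a _ => ?_
    split
    · rename_i h
      have := h.lucky hlen
      simp only [Finset.notMem_empty, Finset.filter_false] at this
      rw [if_pos this]
    · exact Nat.zero_le _
  · rename_i hn
    rw [mul_zero, Nat.le_zero]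
    refine Finset.sum_eq_zero fun a _ => if_neg fun h => hn ?_
    -- Luck for some resampled secret implies a touch, which carries over to the original secret.
    have h2 := (h.lucky hlen).touches
    have h3 := DecisionTree.Touches.of_touches (O := fun a => oracle P (resample s z a) b)
      (fun i hg hc => oracle_resample_of_none hg hc) (a' := s k x) h2
    simp only [hs] at h3
    exact mem_touchSet_of_touches h3

-- A union bound over all nodes, in which the sum of the touch indicators is bounded by `2 * q` for
-- every `s` and not by the number of nodes.
open Classical in
theorem card_mul_card_root_hit_le (b : Bool) (t q : ℕ)
    (T : DecisionTree (Query n P.m l) (Option Bool)) (hq : ∀ s, T.queries (oracle P s b) ≤ q)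
    (htq : q < t ^ l) :
    P.A.card * (Finset.univ.filter fun s : Secret P l => [] ∈ hitSet s b T).card ≤
      2 ^ t * q * (2 * q * Fintype.card (Secret P l)) := by
  let J := (k : Fin l) × (Fin k → Fin n → Bool)
  have h1 : (Finset.univ.filter fun s : Secret P l => [] ∈ hitSet s b T).card ≤
      ∑ j : J, ∑ s : Secret P l, (if LuckyAt s b t (nodeId j.1 j.2) T ∅ then 1 else 0) := by
    rw [Finset.sum_comm, Finset.card_filter]
    refine Finset.sum_le_sum fun s _ => ?_
    split
    · rename_i h0
      by_contra hlt
      -- If no node is lucky, the hit set has at least `t ^ l` elements, more than the number of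
      -- queries.
      have hno : ∀ j : J, ¬ LuckyAt s b t (nodeId j.1 j.2) T ∅ := by
        intro j hj
        refine hlt ?_
        refine le_trans ?_ (Finset.single_le_sum (fun _ _ => Nat.zero_le _) (Finset.mem_univ j))
        rw [if_pos hj]
      have hsurj : ∀ z : List (Fin n → Bool), z.length < l → ∃ j : J, nodeId j.1 j.2 = z := by
        intro z hz
        suffices h : ∃ x : Fin z.length → Fin n → Bool, nodeId z.length x = z from
          ⟨⟨⟨z.length, hz⟩, h.choose⟩, h.choose_spec⟩
        clear hz
        induction z with
        | nil => exact ⟨Fin.elim0, rfl⟩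
        | cons y z ih =>
          obtain ⟨x, hx⟩ := ih
          refine ⟨Fin.snoc (α := fun _ => Fin n → Bool) x y, ?_⟩
          simp only [List.length_cons, nodeId, Fin.snoc_last, Fin.snoc_castSucc, hx]
      have h2 := le_card_children s b t T ∅ (by simp) (fun z hz h => by
        obtain ⟨j, rfl⟩ := hsurj z hz
        exact hno j h)
      simp only [Finset.empty_union] at h2
      have h3 := pow_le_card_of_children l t (hitSet s b T) h0
        (fun z hz hl => by convert h2 z hz hl)
      have := card_hitSet_le s b T
      have := hq s
      omega
    · exact Nat.zero_le _
  refine (Nat.mul_le_mul_left _ h1).trans ?_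
  rw [Finset.mul_sum]
  refine (Finset.sum_le_sum fun j _ => card_mul_sum_lucky_le b t q T hq j.1 j.2).trans ?_
  rw [← Finset.mul_sum, Finset.sum_comm]
  refine Nat.mul_le_mul_left _ ?_
  rw [mul_comm, ← smul_eq_mul (Fintype.card _)]
  refine Finset.sum_le_card_nsmul _ _ _ fun s _ => ?_
  rw [← Finset.card_filter]
  -- Distinct internal nodes have distinct paths, so the indicators count elements of `touchSet`.
  refine le_trans ?_ ((card_touchSet_le s b T).trans (Nat.mul_le_mul_left 2 (hq s)))
  refine Finset.card_le_card_of_injOn (fun j : J => nodeId j.1 j.2) ?_ ?_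
  · intro j hj
    simpa using hj
  · rintro ⟨k, x⟩ _ ⟨k', x'⟩ _ h
    exact nodeId_inj h

end Resample

/-! ### From hitting the root to the success probability -/

section Advantage

variable {n : ℕ} {P : SingleLevel n} {l : ℕ}

-- If the root is not hit when its bit is `false`, the run is the same for both bits and the output
-- is right for exactly one of them. Otherwise it may be right for both, which costs one more.
open Classical in
theorem card_mul_sum_success_le (hl : 0 < l) (t q : ℕ)
    (T : DecisionTree (Query n P.m l) (Option Bool))
    (hq : ∀ s b, T.queries (oracle P s b) ≤ q) (htq : q < t ^ l) :
    P.A.card * ∑ s : Secret P l, ∑ b : Bool, (if b = T.run (oracle P s b) then 1 else 0) ≤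
      (P.A.card + 2 ^ t * q * (2 * q)) * Fintype.card (Secret P l) := by
  have h1 : ∑ s : Secret P l, ∑ b : Bool, (if b = T.run (oracle P s b) then 1 else 0) ≤
      Fintype.card (Secret P l) +
        (Finset.univ.filter fun s : Secret P l => [] ∈ hitSet s false T).card := by
    rw [Finset.card_filter, ← Finset.card_univ, Finset.card_eq_sum_ones,
      ← Finset.sum_add_distrib]
    refine Finset.sum_le_sum fun s _ => ?_
    rw [Fintype.sum_bool]
    by_cases h : [] ∈ hitSet s false T
    · rw [if_pos h]
      split <;> split <;> omega
    · rw [run_eq_of_root_notMem s hl false true T h]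
      cases T.run (oracle P s false) <;> simp
  calc _ ≤ P.A.card * (Fintype.card (Secret P l) +
        (Finset.univ.filter fun s : Secret P l => [] ∈ hitSet s false T).card) :=
        Nat.mul_le_mul_left _ h1
    _ ≤ P.A.card * Fintype.card (Secret P l) + 2 ^ t * q * (2 * q * Fintype.card (Secret P l)) := by
        rw [mul_add]
        exact Nat.add_le_add_left
          (card_mul_card_root_hit_le false t q T (fun s => hq s false) htq) _
    _ = _ := by ring

-- Averaging over the instances reduces a randomized algorithm to the deterministic trees in its
-- support. Summed over the two root bits, the success probability is at least `1 + 2 * η` for every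
-- `s`, against an average of at most `1 + 2 ^ t * q * (2 * q) / |A|`.
open Classical in
theorem advantage_le (hl : 0 < l) (hA : 0 < P.A.card) (t q : ℕ) (D : ClassicalAlg P l)
    (hq : MakesAtMost D q) (htq : q < t ^ l) (η : ℝ) (hD : SucceedsWithProb D (1 / 2 + η)) :
    (P.A.card : ℝ) * η ≤ 2 ^ t * (q : ℝ) ^ 2 := by
  have hup : (P.A.card : ENNReal) * ∑ s : Secret P l, ∑ b : Bool,
      (D.map fun T => T.run (oracle P s b)) b ≤
      (((P.A.card + 2 ^ t * q * (2 * q)) * Fintype.card (Secret P l) : ℕ) : ENNReal) := by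
    have h1 : ∀ s : Secret P l, ∑ b : Bool, (D.map fun T => T.run (oracle P s b)) b =
        ∑' T, D T * ((∑ b : Bool, if b = T.run (oracle P s b) then 1 else 0 : ℕ) : ENNReal) := by
      intro s
      simp only [PMF.map_apply]
      rw [← Summable.tsum_finsetSum (fun _ _ => ENNReal.summable)]
      refine tsum_congr fun T => ?_
      rw [Nat.cast_sum, Finset.mul_sum]
      refine Finset.sum_congr rfl fun b _ => ?_
      split <;> simp
    simp only [h1]
    rw [← Summable.tsum_finsetSum (fun _ _ => ENNReal.summable), ← ENNReal.tsum_mul_left]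
    calc _ ≤ ∑' T, D T * (((P.A.card + 2 ^ t * q * (2 * q)) *
          Fintype.card (Secret P l) : ℕ) : ENNReal) := by
          refine ENNReal.tsum_le_tsum fun T => ?_
          by_cases hT : D T = 0
          · simp [hT]
          · rw [← Finset.mul_sum, mul_left_comm]
            refine mul_le_mul_right ?_ _
            rw [← Nat.cast_sum, ← Nat.cast_mul, Nat.cast_le]
            exact card_mul_sum_success_le hl t q T
              (fun s b => hq T ((PMF.mem_support_iff _ _).2 hT) s b) htq
      _ = _ := by rw [ENNReal.tsum_mul_right, PMF.tsum_coe, one_mul]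
  have hreal := ENNReal.toReal_mono (ENNReal.natCast_ne_top _) hup
  rw [ENNReal.toReal_mul, ENNReal.toReal_natCast, ENNReal.toReal_natCast, ENNReal.toReal_sum
    (fun s _ => ENNReal.sum_ne_top.2 fun b _ => PMF.apply_ne_top _ _)] at hreal
  have hlow : (Fintype.card (Secret P l) : ℝ) * (1 + 2 * η) ≤ ∑ s : Secret P l,
      (∑ b : Bool, (D.map fun T => T.run (oracle P s b)) b).toReal := by
    rw [← nsmul_eq_mul, ← Finset.card_univ]
    refine Finset.card_nsmul_le_sum _ _ _ fun s _ => ?_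
    rw [ENNReal.toReal_sum (fun b _ => PMF.apply_ne_top _ _), Fintype.sum_bool]
    have h1 := hD s true
    have h2 := hD s false
    linarith
  have hS : (0 : ℝ) < Fintype.card (Secret P l) := by
    obtain ⟨a, ha⟩ := Finset.card_pos.1 hA
    have : Nonempty (Secret P l) := ⟨fun _ _ => ⟨a, ha⟩⟩
    exact_mod_cast Fintype.card_pos
  have h3 := (mul_le_mul_of_nonneg_left hlow (Nat.cast_nonneg P.A.card)).trans hreal
  push_cast at h3
  have h4 : (Fintype.card (Secret P l) : ℝ) * ((P.A.card : ℝ) * (1 + 2 * η)) ≤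
      Fintype.card (Secret P l) * ((P.A.card : ℝ) + 2 ^ t * q * (2 * q)) := by linarith
  have h5 := le_of_mul_le_mul_left h4 hS
  nlinarith

end Advantage

open Real in
/-- The classical lower bound. -/
theorem classical_lower_bound (P : (n : ℕ) → SingleLevel n) (α : ℝ) (hα : 0 < α)
    (hA : ∀ᶠ n : ℕ in atTop, (2 : ℝ) ^ (α * (n : ℝ)) ≤ ((P n).A.card : ℝ))
    (g : ℕ → ℝ) (hg : g =o[atTop] (fun n : ℕ => Real.log n)) :
    ∀ᶠ n : ℕ in atTop, ∀ (D : ClassicalAlg (P n) (Nat.log 2 n)) (q : ℕ),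
      MakesAtMost D q → SucceedsWithProb D (1 / 2 + (n : ℝ) ^ (-g n)) →
      (n : ℝ) ^ ((1 / 4 : ℝ) * Real.log n) ≤ (q : ℝ) := by
  have hlog : Tendsto (fun n : ℕ => Real.log n) atTop atTop :=
    Real.tendsto_log_atTop.comp tendsto_natCast_atTop_atTop
  have hg1 : ∀ᶠ n : ℕ in atTop, ‖g n‖ ≤ 1 * ‖Real.log n‖ := hg.bound one_pos
  have hlogn : ∀ᶠ n : ℕ in atTop, 10 ≤ Real.log n := hlog.eventually_ge_atTop 10
  have hsq : ∀ᶠ n : ℕ in atTop, Real.log n ^ 2 ≤ (α * Real.log 2 / 8) * n := by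
    have h := (isLittleO_pow_log_id_atTop (n := 2)).comp_tendsto tendsto_natCast_atTop_atTop
    have h8 : 0 < α * Real.log 2 / 8 := by positivity
    filter_upwards [h.bound h8] with n hn
    simpa [abs_of_nonneg] using hn
  have hroot : ∀ᶠ n : ℕ in atTop, Real.exp (Real.log n / 2) ≤ α * n / 2 - 1 := by
    have ht : Tendsto (fun n : ℕ => Real.exp (Real.log n / 2)) atTop atTop :=
      Real.tendsto_exp_atTop.comp (hlog.atTop_div_const two_pos)
    filter_upwards [ht.eventually_ge_atTop (2 / α + 2), eventually_gt_atTop 0] with n hn h0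
    have h1 : Real.exp (Real.log n / 2) * Real.exp (Real.log n / 2) = n := by
      rw [← Real.exp_add, add_halves, Real.exp_log (by exact_mod_cast h0)]
    set y := Real.exp (Real.log n / 2)
    have h2 : α * (2 / α + 2) ≤ α * y := mul_le_mul_of_nonneg_left hn hα.le
    have h3 : α * (2 / α + 2) = 2 + 2 * α := by field_simp
    have h4 : 0 ≤ 2 / α := by positivity
    rw [← h1]
    nlinarith
  filter_upwards [hA, hg1, hlogn, hsq, hroot, eventually_gt_atTop 1] with n hA hg1 hlogn hsq hroot
    hn1
  have hn0 : (0 : ℝ) < n := by exact_mod_cast (zero_lt_one.trans hn1)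
  generalize hl : Nat.log 2 n = l
  intro D q hq hD
  by_contra hlt
  rw [not_le] at hlt
  set L := Real.log n with hL
  have hpow : ∀ y : ℝ, (n : ℝ) ^ y = Real.exp (L * y) := fun y => Real.rpow_def_of_pos hn0 y
  -- Half of the exponent of `|A|` is spent on `2 ^ t`. The value `t` is still at least `√n`, so `t
  -- ^ l` exceeds the assumed bound on `q`.
  set t := ⌊α * n / 2⌋₊ with ht
  -- Rounding the binary logarithm down still leaves at least the natural logarithm, because `log 2
  -- < 1` and `L ≥ 10`.
  have hl_real : L ≤ l := by
    have h1 : (n : ℝ) < 2 ^ (l + 1) := by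
      rw [← hl]
      exact_mod_cast Nat.lt_pow_succ_log_self one_lt_two n
    have h2 := Real.log_lt_log hn0 h1
    rw [Real.log_pow] at h2
    push_cast at h2
    have h3 : Real.log 2 < 0.6931471808 := Real.log_two_lt_d9
    have h5 : (0 : ℝ) ≤ l := Nat.cast_nonneg _
    nlinarith
  have hA0 : 0 < (P n).A.card := by
    have : (0 : ℝ) < ((P n).A.card : ℝ) := lt_of_lt_of_le (by positivity) hA
    exact_mod_cast this
  have hl0 : 0 < l := hl ▸ Nat.log_pos one_lt_two hn1
  have hexp_t : Real.exp (L / 2) ≤ t := by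
    have := Nat.lt_floor_add_one (α * n / 2)
    rw [← ht] at this
    linarith
  have hqt : q < t ^ l := by
    have h1 : Real.exp (L / 2 * l) ≤ (t : ℝ) ^ l := by
      rw [mul_comm, Real.exp_nat_mul]
      exact pow_le_pow_left₀ (Real.exp_pos _).le hexp_t _
    have h2 : (q : ℝ) < (t : ℝ) ^ l := by
      refine lt_of_lt_of_le hlt (le_trans ?_ h1)
      rw [hpow, Real.exp_le_exp]
      nlinarith
    exact_mod_cast h2
  have hadv := advantage_le hl0 hA0 t q D hq hqt _ hD
  have h2t : (2 : ℝ) ^ t ≤ Real.exp (α * Real.log 2 * n / 2) := by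
    rw [← Real.rpow_natCast, Real.rpow_def_of_pos two_pos, Real.exp_le_exp]
    have h1 : (t : ℝ) ≤ α * n / 2 := Nat.floor_le (by positivity)
    have h2 : 0 < Real.log 2 := Real.log_pos one_lt_two
    nlinarith
  have hq2 : (q : ℝ) ^ 2 ≤ Real.exp (L ^ 2 / 2) := by
    have h1 : (q : ℝ) ≤ Real.exp (L * (1 / 4 * L)) := by rw [← hpow]; exact hlt.le
    calc (q : ℝ) ^ 2 ≤ Real.exp (L * (1 / 4 * L)) ^ 2 :=
          pow_le_pow_left₀ (Nat.cast_nonneg _) h1 2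
      _ = _ := by rw [← Real.exp_nat_mul]; congr 1; push_cast; ring
  -- Of `g = o(log n)` only the eventual bound `|g n| ≤ log n` is needed.
  have hgn : Real.exp (-L ^ 2) ≤ (n : ℝ) ^ (-g n) := by
    rw [hpow, Real.exp_le_exp]
    have h1 : ‖L‖ = L := Real.norm_of_nonneg (by linarith)
    rw [h1, one_mul] at hg1
    have h2 := le_of_abs_le hg1
    nlinarith
  have hA' : Real.exp (α * Real.log 2 * n) ≤ ((P n).A.card : ℝ) := by
    refine le_trans (le_of_eq ?_) hA
    rw [Real.rpow_def_of_pos two_pos]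
    congr 1
    ring
  -- Comparing exponents would give `α * log 2 * n / 2 ≤ 3 / 2 * L ^ 2`, whereas `hsq` gives `8 * L
  -- ^ 2 ≤ α * log 2 * n`.
  have hfin : Real.exp (α * Real.log 2 * n) * Real.exp (-L ^ 2) ≤
      Real.exp (α * Real.log 2 * n / 2) * Real.exp (L ^ 2 / 2) := by
    calc _ ≤ ((P n).A.card : ℝ) * (n : ℝ) ^ (-g n) := by gcongr
      _ ≤ _ := hadv
      _ ≤ _ := by gcongr
  rw [← Real.exp_add, ← Real.exp_add, Real.exp_le_exp] at hfin
  nlinarith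

/-! ### The quantum algorithm: states, gates and locality -/

/-! ### Overwriting some of the wires -/

section Overwrite

variable {ι κ : Type} {e : ι → κ}

theorem extend_comp_self (he : Function.Injective e) (c : ι → Bool) (b : κ → Bool) :
    (fun i => Function.extend e c b (e i)) = c :=
  funext fun i => he.extend_apply c b i

theorem extend_extend (he : Function.Injective e) (c c' : ι → Bool) (b : κ → Bool) :
    Function.extend e c (Function.extend e c' b) = Function.extend e c b := by
  classical
  funext w
  by_cases h : ∃ i, e i = w
  · obtain ⟨i, rfl⟩ := h
    rw [he.extend_apply, he.extend_apply]
  · rw [Function.extend_apply' _ _ _ h, Function.extend_apply' _ _ _ h,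
      Function.extend_apply' _ _ _ h]

theorem extend_self (he : Function.Injective e) (b : κ → Bool) :
    Function.extend e (fun i => b (e i)) b = b := by
  funext w
  by_cases h : ∃ i, e i = w
  · obtain ⟨i, rfl⟩ := h
    rw [he.extend_apply]
  · rw [Function.extend_apply' _ _ _ h]

/-- Exchanging `c` with the overwritten values is an involution on pairs `(b, c)`. The identity
permits norm estimates fibre by fibre, where a fibre fixes the wires outside the range of `e`. -/
theorem sum_sum_extend [Fintype ι] [DecidableEq ι] [Fintype κ] [DecidableEq κ]
    (he : Function.Injective e) (h : (κ → Bool) → ℝ) :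
    ∑ b, ∑ c : ι → Bool, h (Function.extend e c b) = Fintype.card (ι → Bool) * ∑ b, h b := by
  have hinv : Function.Involutive fun p : (κ → Bool) × (ι → Bool) =>
      ((Function.extend e p.2 p.1, fun i => p.1 (e i)) : (κ → Bool) × (ι → Bool)) := by
    rintro ⟨b, c⟩
    simp only
    rw [extend_comp_self he, extend_extend he, extend_self he]
  have h1 := Equiv.sum_comp hinv.toPerm (fun p : (κ → Bool) × (ι → Bool) => h p.1)
  rw [Fintype.sum_prod_type, Fintype.sum_prod_type] at h1
  simp only [Function.Involutive.coe_toPerm, Finset.sum_const, Finset.card_univ] at h1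
  rw [h1, Finset.mul_sum]
  simp only [nsmul_eq_mul]

end Overwrite

/-! ### The norm of a state -/

section Norm

variable {W : ℕ}

/-- The norm of a state. -/
noncomputable def nm (Ψ : State W) : ℝ := ‖(WithLp.toLp 2 Ψ : EuclideanSpace ℂ (Fin W → Bool))‖

theorem nm_sq (Ψ : State W) : nm Ψ ^ 2 = ∑ b, ‖Ψ b‖ ^ 2 := by
  rw [nm, EuclideanSpace.norm_eq, Real.sq_sqrt (Finset.sum_nonneg fun _ _ => by positivity)]

theorem nm_nonneg (Ψ : State W) : 0 ≤ nm Ψ := norm_nonneg _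

theorem nm_add_le (Ψ Φ : State W) : nm (Ψ + Φ) ≤ nm Ψ + nm Φ := by
  unfold nm
  rw [WithLp.toLp_add]
  exact norm_add_le _ _

theorem nm_le_of_sq_le {Ψ : State W} {r : ℝ} (hr : 0 ≤ r) (h : ∑ b, ‖Ψ b‖ ^ 2 ≤ r ^ 2) :
    nm Ψ ≤ r := by
  rw [← nm_sq] at h
  exact (pow_le_pow_iff_left₀ (nm_nonneg _) hr two_ne_zero).1 h

theorem nm_congr {Ψ Φ : State W} (h : ∑ b, ‖Ψ b‖ ^ 2 = ∑ b, ‖Φ b‖ ^ 2) : nm Ψ = nm Φ := by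
  rw [← nm_sq, ← nm_sq] at h
  exact (pow_left_inj₀ (nm_nonneg _) (nm_nonneg _) two_ne_zero).1 h

theorem nm_le_mul_of_forall_le {Ψ Φ : State W} {r : ℝ} (hr : 0 ≤ r)
    (h : ∀ b, ‖Ψ b‖ ≤ r * ‖Φ b‖) : nm Ψ ≤ r * nm Φ := by
  refine nm_le_of_sq_le (mul_nonneg hr (nm_nonneg _)) ?_
  rw [mul_pow, nm_sq, Finset.mul_sum]
  refine Finset.sum_le_sum fun b _ => ?_
  rw [← mul_pow]
  exact pow_le_pow_left₀ (norm_nonneg _) (h b) 2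

end Norm

/-! ### Unitary operators that act on few wires -/

section Operators

variable {W : ℕ}

/-- `A` is a linear isometry with inverse `B`. -/
structure UnitaryPair (A B : State W → State W) : Prop where
  sub : ∀ Ψ Φ, A (Ψ - Φ) = A Ψ - A Φ
  nm : ∀ Ψ, nm (A Ψ) = nm Ψ
  inv : ∀ Ψ, B (A Ψ) = Ψ

theorem UnitaryPair.id : UnitaryPair (fun Ψ : State W => Ψ) fun Ψ => Ψ :=
  ⟨fun _ _ => rfl, fun _ => rfl, fun _ => rfl⟩

theorem UnitaryPair.comp {A B A' B' : State W → State W} (h : UnitaryPair A B)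
    (h' : UnitaryPair A' B') : UnitaryPair (fun Ψ => A' (A Ψ)) fun Ψ => B (B' Ψ) :=
  ⟨fun Ψ Φ => by rw [h.sub, h'.sub], fun Ψ => by rw [h'.nm, h.nm], fun Ψ => by rw [h'.inv, h.inv]⟩

/-- The value of `g` does not depend on the wires in `S`. -/
def IndepOf {γ : Type} (S : Set ℕ) (g : (Fin W → Bool) → γ) : Prop :=
  ∀ b b' : Fin W → Bool, (∀ w : Fin W, (w : ℕ) ∉ S → b w = b' w) → g b = g b'

theorem IndepOf.mono {γ : Type} {S S' : Set ℕ} {g : (Fin W → Bool) → γ} (h : IndepOf S g)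
    (hS : S' ⊆ S) : IndepOf S' g :=
  fun b b' hb => h b b' fun w hw => hb w fun hw' => hw (hS hw')

/-- `A` is block diagonal with respect to the values of the wires outside of `S`. -/
def Loc (S : Set ℕ) (A : State W → State W) : Prop :=
  ∀ g : (Fin W → Bool) → ℂ, IndepOf S g → ∀ Ψ, A (g * Ψ) = g * A Ψ

theorem Loc.mono {S S' : Set ℕ} {A : State W → State W} (h : Loc S A) (hS : S ⊆ S') : Loc S' A :=
  fun g hg => h g (hg.mono hS)

theorem Loc.id (S : Set ℕ) : Loc S (fun Ψ : State W => Ψ) := fun _ _ _ => rfl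

theorem Loc.comp {S : Set ℕ} {A A' : State W → State W} (h : Loc S A) (h' : Loc S A') :
    Loc S fun Ψ => A' (A Ψ) :=
  fun g hg Ψ => by simp only [h g hg, h' g hg]

/-- The state vanishes unless all wires in `S` are in `|0⟩`. -/
def ZeroOn (S : Set ℕ) (Ψ : State W) : Prop :=
  ∀ b, (∃ w : Fin W, (w : ℕ) ∈ S ∧ b w = true) → Ψ b = 0

theorem ZeroOn.mono {S S' : Set ℕ} {Ψ : State W} (h : ZeroOn S Ψ) (hS : S' ⊆ S) : ZeroOn S' Ψ :=
  fun b ⟨w, hw, hb⟩ => h b ⟨w, hS hw, hb⟩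

theorem ZeroOn.mul {S : Set ℕ} {Ψ : State W} (h : ZeroOn S Ψ) (g : State W) : ZeroOn S (g * Ψ) :=
  fun b hb => by rw [Pi.mul_apply, h b hb, mul_zero]

-- The state equals its product with the indicator that all wires in `S` are zero. This indicator
-- does not depend on `S'`, so it passes through `A`.
open Classical in
theorem ZeroOn.of_loc {S S' : Set ℕ} {Ψ : State W} (h : ZeroOn S Ψ) {A : State W → State W}
    (hA : Loc S' A) (hS : Disjoint S S') : ZeroOn S (A Ψ) := by
  have h1 := hA (fun b => if ∃ w : Fin W, (w : ℕ) ∈ S ∧ b w = true then 0 else 1)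
    (fun b b' hb => by
      have : (∃ w : Fin W, (w : ℕ) ∈ S ∧ b w = true) ↔ ∃ w : Fin W, (w : ℕ) ∈ S ∧ b' w = true :=
        exists_congr fun w => and_congr_right fun hw => by
          rw [hb w (Set.disjoint_left.1 hS hw)]
      simp only [this]) Ψ
  have h2 : (fun b => if ∃ w : Fin W, (w : ℕ) ∈ S ∧ b w = true then (0 : ℂ) else 1) * Ψ = Ψ := by
    funext b
    rw [Pi.mul_apply]
    split
    · rename_i hb
      rw [h b hb, mul_zero]
    · rw [one_mul]
  rw [h2] at h1
  intro b hb
  rw [h1, Pi.mul_apply, if_pos hb, zero_mul]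

end Operators

/-! ### Gates -/

section Gates

variable {W : ℕ} {ι : Type} [Fintype ι] [DecidableEq ι] {ws : ι → ℕ}

theorem applyOn_eq (hi : Function.Injective ws) (hw : ∀ i, ws i < W)
    (G : Matrix (ι → Bool) (ι → Bool) ℂ) (Ψ : State W) :
    applyOn ws G Ψ = fun b => ∑ c : ι → Bool, G (fun i => b ⟨ws i, hw i⟩) c *
      Ψ (Function.extend (fun i => (⟨ws i, hw i⟩ : Fin W)) c b) := by
  rw [applyOn, dif_pos ⟨hi, hw⟩]

theorem applyOn_sub (G : Matrix (ι → Bool) (ι → Bool) ℂ) (Ψ Φ : State W) :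
    applyOn ws G (Ψ - Φ) = applyOn ws G Ψ - applyOn ws G Φ := by
  unfold applyOn
  split
  · funext b
    simp [mul_sub]
  · rfl

omit [Fintype ι] [DecidableEq ι] in
theorem injective_wire (hi : Function.Injective ws) (hw : ∀ i, ws i < W) :
    Function.Injective fun i => (⟨ws i, hw i⟩ : Fin W) :=
  fun _ _ h => hi (Fin.mk.inj_iff.1 h)

theorem applyOn_applyOn (G G' : Matrix (ι → Bool) (ι → Bool) ℂ) (Ψ : State W)
    (h : Function.Injective ws ∧ ∀ i, ws i < W) :
    applyOn ws G' (applyOn ws G Ψ) = applyOn ws (G' * G) Ψ := by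
  have he := injective_wire h.1 h.2
  simp only [applyOn_eq h.1 h.2]
  funext b
  simp only [he.extend_apply, extend_extend he, Matrix.mul_apply, Finset.mul_sum, Finset.sum_mul]
  rw [Finset.sum_comm]
  simp only [mul_assoc]

theorem applyOn_diagonal (hi : Function.Injective ws) (hw : ∀ i, ws i < W) (d : (ι → Bool) → ℂ)
    (Ψ : State W) :
    applyOn ws (Matrix.diagonal d) Ψ = (fun b => d fun i => b ⟨ws i, hw i⟩) * Ψ := by
  rw [applyOn_eq hi hw]
  funext b
  rw [Finset.sum_eq_single (fun i => b ⟨ws i, hw i⟩)]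
  · simp only [Matrix.diagonal_apply_eq, Pi.mul_apply]
    rw [extend_self (injective_wire hi hw)]
  · intro c _ hc
    rw [Matrix.diagonal_apply_ne _ (Ne.symm hc), zero_mul]
  · simp

theorem sum_norm_sq_mulVec {κ : Type} [Fintype κ] [DecidableEq κ] {G : Matrix κ κ ℂ}
    (hG : G ∈ Matrix.unitaryGroup κ ℂ) (v : κ → ℂ) :
    ∑ c, ‖G.mulVec v c‖ ^ 2 = ∑ c, ‖v c‖ ^ 2 := by
  have h (u : κ → ℂ) : ((∑ c, ‖u c‖ ^ 2 : ℝ) : ℂ) = dotProduct (star u) u := by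
    simp only [dotProduct, Pi.star_apply, RCLike.star_def, Complex.conj_mul']
    push_cast
    rfl
  have h2 : ((∑ c, ‖G.mulVec v c‖ ^ 2 : ℝ) : ℂ) = ((∑ c, ‖v c‖ ^ 2 : ℝ) : ℂ) := by
    rw [h, h, Matrix.star_mulVec, Matrix.dotProduct_mulVec, Matrix.vecMul_vecMul,
      ← Matrix.star_eq_conjTranspose, Matrix.mem_unitaryGroup_iff'.1 hG, Matrix.vecMul_one]
  exact_mod_cast h2

/-- On each fibre the gate is multiplication of a vector by the unitary matrix `G`, which preserves
the sum of squares. -/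
theorem nm_applyOn {G : Matrix (ι → Bool) (ι → Bool) ℂ}
    (hG : G ∈ Matrix.unitaryGroup (ι → Bool) ℂ) (Ψ : State W) : nm (applyOn ws G Ψ) = nm Ψ := by
  by_cases h : Function.Injective ws ∧ ∀ i, ws i < W
  · have he := injective_wire h.1 h.2
    refine nm_congr ?_
    have h0 : (Fintype.card (ι → Bool) : ℝ) ≠ 0 := Nat.cast_ne_zero.2 Fintype.card_ne_zero
    refine mul_left_cancel₀ h0 ?_
    rw [← sum_sum_extend he, ← sum_sum_extend he]
    refine Finset.sum_congr rfl fun b _ => ?_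
    rw [← sum_norm_sq_mulVec hG fun c => Ψ (Function.extend _ c b), applyOn_eq h.1 h.2]
    simp only [he.extend_apply, extend_extend he]
    rfl
  · rw [applyOn, dif_neg h]

theorem unitaryPair_applyOn {G : Matrix (ι → Bool) (ι → Bool) ℂ}
    (hG : G ∈ Matrix.unitaryGroup (ι → Bool) ℂ) :
    UnitaryPair (W := W) (applyOn ws G) (applyOn ws (star G)) := by
  refine ⟨applyOn_sub G, nm_applyOn hG, fun Ψ => ?_⟩
  by_cases h : Function.Injective ws ∧ ∀ i, ws i < W
  · rw [applyOn_applyOn _ _ _ h, Matrix.mem_unitaryGroup_iff'.1 hG, ← Matrix.diagonal_one,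
      applyOn_diagonal h.1 h.2]
    funext b
    simp
  · rw [applyOn, dif_neg h, applyOn, dif_neg h]

theorem loc_applyOn {S : Set ℕ} (hS : ∀ i, ws i ∈ S) (G : Matrix (ι → Bool) (ι → Bool) ℂ) :
    Loc (W := W) S (applyOn ws G) := by
  intro g hg Ψ
  by_cases h : Function.Injective ws ∧ ∀ i, ws i < W
  · have he := injective_wire h.1 h.2
    simp only [applyOn_eq h.1 h.2]
    funext b
    simp only [Pi.mul_apply, Finset.mul_sum]
    refine Finset.sum_congr rfl fun c _ => ?_
    rw [hg (Function.extend _ c b) b]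
    · ring
    · intro w hw
      rw [Function.extend_apply']
      rintro ⟨i, rfl⟩
      exact hw (hS i)
  · rw [applyOn, dif_neg h, applyOn, dif_neg h]

omit [Fintype ι] [DecidableEq ι] in
theorem star_basisMap {π : (ι → Bool) → ι → Bool} (hπ : Function.Involutive π) :
    star (basisMap π) = basisMap π := by
  ext b c
  by_cases h : b = π c
  · have h' : c = π b := by rw [h, hπ]
    rw [Matrix.star_apply, basisMap, basisMap, if_pos h, if_pos h', star_one]
  · have h' : c ≠ π b := fun h' => h (by rw [h', hπ])
    rw [Matrix.star_apply, basisMap, basisMap, if_neg h, if_neg h', star_zero]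

theorem basisMap_mem_unitaryGroup {π : (ι → Bool) → ι → Bool} (hπ : Function.Involutive π) :
    basisMap π ∈ Matrix.unitaryGroup (ι → Bool) ℂ := by
  rw [Matrix.mem_unitaryGroup_iff, star_basisMap hπ]
  ext b c
  rw [Matrix.mul_apply, Finset.sum_eq_single (π b)]
  · simp only [basisMap, hπ b, if_true, one_mul, Matrix.one_apply]
    have : π b = π c ↔ b = c := hπ.injective.eq_iff
    simp only [this]
  · intro d _ hd
    have : b ≠ π d := fun h => hd (by rw [h, hπ])
    simp [basisMap, this]
  · simp

/-- The amplitude at a basis state is the old amplitude at its preimage under `π`; as `π` is an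
involution, the preimage is the image. -/
theorem applyOn_basisMap (hi : Function.Injective ws) (hw : ∀ i, ws i < W)
    {π : (ι → Bool) → ι → Bool} (hπ : Function.Involutive π) (Ψ : State W) :
    applyOn ws (basisMap π) Ψ = fun b =>
      Ψ (Function.extend (fun i => (⟨ws i, hw i⟩ : Fin W)) (π fun i => b ⟨ws i, hw i⟩) b) := by
  rw [applyOn_eq hi hw]
  funext b
  rw [Finset.sum_eq_single (π fun i => b ⟨ws i, hw i⟩)]
  · simp [basisMap, hπ _]
  · intro d _ hd
    have : (fun i => b ⟨ws i, hw i⟩) ≠ π d := fun h => hd (by rw [h, hπ])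
    simp [basisMap, this]
  · simp

theorem star_hadamard : star hadamard = hadamard := by
  ext b c
  simp only [Matrix.star_apply, hadamard, Bool.and_comm (c 0)]
  split <;> simp

theorem hadamard_mul_hadamard : hadamard * hadamard = 1 := by
  have h2 : (Real.sqrt 2 : ℂ) * Real.sqrt 2 = 2 := by
    rw [← Complex.ofReal_mul, Real.mul_self_sqrt two_pos.le]
    norm_num
  have h0 : (Real.sqrt 2 : ℂ) ≠ 0 := fun h => by rw [h] at h2; norm_num at h2
  ext b c
  rw [Matrix.mul_apply, ← (Equiv.funUnique (Fin 1) Bool).symm.sum_comp, Fintype.sum_bool]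
  have hbc : b = c ↔ b 0 = c 0 :=
    ⟨fun h => by rw [h], fun h => funext fun i => by rw [Subsingleton.elim i 0, h]⟩
  simp only [hadamard, Matrix.one_apply, hbc, Equiv.funUnique_symm_apply, uniqueElim_const]
  cases b 0 <;> cases c 0 <;> simp <;> field_simp <;> first | ring1 | linear_combination -h2

theorem hadamard_mem_unitaryGroup : hadamard ∈ Matrix.unitaryGroup (Fin 1 → Bool) ℂ := by
  rw [Matrix.mem_unitaryGroup_iff, star_hadamard, hadamard_mul_hadamard]

end Gates

/-! ### Reading and flipping wires -/

section Wires

variable {W : ℕ}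

/-- The value of the wire `w`. -/
def rd (b : Fin W → Bool) (w : ℕ) : Bool := if h : w < W then b ⟨w, h⟩ else false

/-- Add `v` to the wire `j`. -/
def xorAt (b : Fin W → Bool) (j : ℕ) (v : Bool) : Fin W → Bool :=
  fun w => if (w : ℕ) = j then xor (b w) v else b w

theorem rd_of_lt (b : Fin W → Bool) {w : ℕ} (h : w < W) : rd b w = b ⟨w, h⟩ := dif_pos h

theorem rd_xorAt_of_ne (b : Fin W → Bool) {j w : ℕ} (v : Bool) (h : w ≠ j) :
    rd (xorAt b j v) w = rd b w := by
  unfold rd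
  split
  · simp [xorAt, h]
  · rfl

theorem rd_xorAt_self (b : Fin W → Bool) {j : ℕ} (v : Bool) (h : j < W) :
    rd (xorAt b j v) j = xor (rd b j) v := by
  simp [rd, h, xorAt]

theorem IndepOf.rd {S : Set ℕ} {w : ℕ} (h : w ∉ S) :
    IndepOf S fun b : Fin W → Bool => RecOracle.rd b w := by
  intro b b' hb
  unfold RecOracle.rd
  split
  · exact hb _ h
  · rfl

theorem rd_congr {S : Set ℕ} {b b' : Fin W → Bool} (hb : ∀ w : Fin W, (w : ℕ) ∉ S → b w = b' w)
    {w : ℕ} (h : w ∉ S) : rd b w = rd b' w :=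
  IndepOf.rd h b b' hb

theorem ZeroOn.rd_eq_false {S : Set ℕ} {Ψ : State W} (h : ZeroOn S Ψ) {b : Fin W → Bool}
    (hb : Ψ b ≠ 0) {w : ℕ} (hw : w ∈ S) : rd b w = false := by
  unfold RecOracle.rd
  split
  · rename_i hW
    by_contra h1
    exact hb (h b ⟨⟨w, hW⟩, hw, by simpa using h1⟩)
  · rfl

theorem extend_eq_of {ι κ : Type} {e : ι → κ} (he : Function.Injective e) {c : ι → Bool}
    {b b' : κ → Bool} (h1 : ∀ i, b' (e i) = c i) (h2 : ∀ w, (∀ i, e i ≠ w) → b' w = b w) :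
    Function.extend e c b = b' := by
  funext w
  by_cases h : ∃ i, e i = w
  · obtain ⟨i, rfl⟩ := h
    rw [he.extend_apply, h1]
  · rw [Function.extend_apply' _ _ _ h, h2 w (not_exists.1 h)]

end Wires

/-! ### Operations and their inverses -/

/-- The inverse operation. -/
def Op.inv : Op → Op
  | .sub i q => .sub (!i) q
  | o => o

/-- The inverse of a sequence of operations. -/
def invOps (L : List Op) : List Op := (L.map Op.inv).reverse

theorem Op.inv_inv (o : Op) : o.inv.inv = o := by
  cases o <;> simp [Op.inv]

theorem invOps_append (L L' : List Op) : invOps (L ++ L') = invOps L' ++ invOps L := by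
  simp [invOps]

theorem invOps_invOps (L : List Op) : invOps (invOps L) = L := by
  simp [invOps, List.map_reverse, Function.comp_def, Op.inv_inv]

theorem UnitaryPair.foldl {W : ℕ} {α : Type} {f : α → State W → State W} {j : α → α}
    (h : ∀ a, UnitaryPair (f a) (f (j a))) (L : List α) :
    UnitaryPair (fun Ψ => L.foldl (fun Φ a => f a Φ) Ψ)
      fun Ψ => (L.map j).reverse.foldl (fun Φ a => f a Φ) Ψ := by
  induction L with
  | nil => exact UnitaryPair.id
  | cons a L ih =>
    simp only [List.foldl_cons, List.map_cons, List.reverse_cons, List.foldl_append, List.foldl_nil]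
    exact (h a).comp ih

theorem adjCircuit_adjCircuit {N : ℕ} (C : List (TwoQubitGate N)) :
    adjCircuit (adjCircuit C) = C := by
  have : (TwoQubitGate.adj ∘ TwoQubitGate.adj : TwoQubitGate N → _) = id := by
    funext g
    cases g
    simp [TwoQubitGate.adj]
  rw [adjCircuit, adjCircuit, List.map_reverse, List.reverse_reverse, List.map_map, this,
    List.map_id]

theorem unitaryPair_runCircuit {N W : ℕ} (base : ℕ) (C : List (TwoQubitGate N)) :
    UnitaryPair (W := W) (runCircuit base C) (runCircuit base (adjCircuit C)) :=
  UnitaryPair.foldl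
    (f := fun (g : TwoQubitGate N) Φ =>
      applyOn (W := W) (ι := Fin 2) ![base + g.fst, base + g.snd] g.mat.1 Φ)
    (j := TwoQubitGate.adj) (fun g => unitaryPair_applyOn g.mat.2) C

theorem queryMap_involutive {ι : Type} (ans : (ι → Bool) → Option Bool) :
    Function.Involutive fun c : ι ⊕ Fin 2 → Bool => (Sum.elim (fun i => c (.inl i))
      (fun t => xor (c (.inr t)) (encAnswer (ans fun i => c (.inl i)) t)) : ι ⊕ Fin 2 → Bool) := by
  intro c
  funext i
  rcases i with i | t <;> simp

theorem notMap_involutive : Function.Involutive fun c : Fin 1 → Bool => ![!(c 0)] := by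
  intro c
  funext i
  fin_cases i
  simp

theorem cnotMap_involutive :
    Function.Involutive fun c : Fin 2 → Bool => ![c 0, xor (c 1) (c 0)] := by
  intro c
  funext i
  fin_cases i <;> simp

theorem toffoliMap_involutive :
    Function.Involutive fun c : Fin 3 → Bool => ![c 0, c 1, xor (c 2) (c 0 && c 1)] := by
  intro c
  funext i
  fin_cases i <;> simp

/-! ### The action of each operation and of sequences -/

section Ops

variable {n m l N W : ℕ} (O : Query n m l → Option Bool) (C : List (TwoQubitGate N))

theorem unitaryPair_apply (o : Op) :
    UnitaryPair (W := W) (fun Ψ => o.apply O C Ψ) fun Ψ => o.inv.apply O C Ψ := by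
  have hperm {ι : Type} [Fintype ι] [DecidableEq ι] (ws : ι → ℕ) {π : (ι → Bool) → ι → Bool}
      (hπ : Function.Involutive π) :
      UnitaryPair (W := W) (applyOn ws (basisMap π)) (applyOn ws (basisMap π)) := by
    have := unitaryPair_applyOn (W := W) (ws := ws) (basisMap_mem_unitaryGroup hπ)
    rwa [star_basisMap hπ] at this
  cases o with
  | had i =>
    have := unitaryPair_applyOn (W := W) (ws := ![i]) hadamard_mem_unitaryGroup
    rwa [star_hadamard] at this
  | not i => exact hperm _ notMap_involutive
  | cnot i j => exact hperm _ cnotMap_involutive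
  | toffoli i j k => exact hperm _ toffoliMap_involutive
  | node k px pa r =>
    by_cases hk : k < l
    · simp only [Op.apply, Op.inv, dif_pos hk]
      exact hperm _ (queryMap_involutive fun c : Fin k × Fin n ⊕ Fin m → Bool =>
          O (.node ⟨k, hk⟩ (fun i j => c (.inl (i, j))) (fun j => c (.inr j))))
    · simp only [Op.apply, Op.inv, dif_neg hk]
      exact UnitaryPair.id
  | leaf px r => exact hperm _ (queryMap_involutive fun c : Fin l × Fin n → Bool =>
          O (.leaf fun i j => c (i, j)))
  | sub i q =>
    cases i
    · exact unitaryPair_runCircuit q C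
    · have := unitaryPair_runCircuit (W := W) q (adjCircuit C)
      rwa [adjCircuit_adjCircuit] at this

/-- Run a sequence of operations. -/
noncomputable def runL (L : List Op) (Ψ : State W) : State W :=
  L.foldl (fun Ψ o => o.apply O C Ψ) Ψ

theorem runL_append (L L' : List Op) (Ψ : State W) :
    runL O C (L ++ L') Ψ = runL O C L' (runL O C L Ψ) :=
  List.foldl_append

theorem runL_cons (o : Op) (L : List Op) (Ψ : State W) :
    runL O C (o :: L) Ψ = runL O C L (o.apply O C Ψ) := rfl

theorem runL_nil (Ψ : State W) : runL O C [] Ψ = Ψ := rfl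

theorem unitaryPair_runL (L : List Op) :
    UnitaryPair (W := W) (runL O C L) (runL O C (invOps L)) :=
  UnitaryPair.foldl (unitaryPair_apply O C) L

theorem unitaryPair_runL_inv (L : List Op) :
    UnitaryPair (W := W) (runL O C (invOps L)) (runL O C L) := by
  have := unitaryPair_runL (W := W) O C (invOps L)
  rwa [invOps_invOps] at this

theorem runL_sub (L : List Op) (Ψ Φ : State W) :
    runL O C L (Ψ - Φ) = runL O C L Ψ - runL O C L Φ :=
  (unitaryPair_runL O C L).sub Ψ Φ

theorem nm_runL (L : List Op) (Ψ : State W) : nm (runL O C L Ψ) = nm Ψ :=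
  (unitaryPair_runL O C L).nm Ψ

theorem loc_runL {S : Set ℕ} {L : List Op}
    (h : ∀ o ∈ L, Loc (W := W) S fun Ψ => o.apply O C Ψ) : Loc (W := W) S (runL O C L) := by
  induction L with
  | nil => exact Loc.id S
  | cons o L ih =>
    exact (h o List.mem_cons_self).comp (ih fun o' ho' => h o' (List.mem_cons_of_mem _ ho'))

/-- The inverse of a block diagonal operator is block diagonal. -/
theorem Loc.of_unitaryPair {S : Set ℕ} {A B : State W → State W} (hA : Loc S A)
    (h : UnitaryPair A B) (h' : UnitaryPair B A) : Loc S B := by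
  intro g hg Ψ
  have h1 := hA g hg (B Ψ)
  rw [h'.inv] at h1
  rw [← h1, h.inv]

theorem loc_runL_invOps {S : Set ℕ} {L : List Op} (h : Loc (W := W) S (runL O C L)) :
    Loc (W := W) S (runL O C (invOps L)) :=
  h.of_unitaryPair (unitaryPair_runL O C L) (unitaryPair_runL_inv O C L)

theorem loc_had {S : Set ℕ} {i : ℕ} (hi : i ∈ S) :
    Loc (W := W) S fun Ψ => (Op.had i).apply O C Ψ :=
  loc_applyOn (by simpa [Fin.forall_fin_one] using hi) _

theorem loc_runCircuit {S : Set ℕ} {q : ℕ} (hS : ∀ j < N, q + j ∈ S) (C : List (TwoQubitGate N)) :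
    Loc (W := W) S (runCircuit q C) := by
  induction C with
  | nil => exact Loc.id S
  | cons g C ih =>
    exact (loc_applyOn (ws := ![q + g.fst, q + g.snd]) (by
      rw [Fin.forall_fin_two]
      exact ⟨hS _ g.fst.2, hS _ g.snd.2⟩) _).comp ih

theorem loc_sub {S : Set ℕ} {q : ℕ} (hS : ∀ j < N, q + j ∈ S) (i : Bool) :
    Loc (W := W) S fun Ψ => (Op.sub i q).apply O C Ψ :=
  loc_runCircuit hS _

/-- A reindexing of the basis states that only changes wires in `S`. -/
theorem loc_comp {S : Set ℕ} {τ : (Fin W → Bool) → Fin W → Bool}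
    (h : ∀ b, ∀ w : Fin W, (w : ℕ) ∉ S → τ b w = b w) :
    Loc S fun Ψ : State W => fun b => Ψ (τ b) := by
  intro g hg Ψ
  funext b
  simp only [Pi.mul_apply]
  rw [hg (τ b) b fun w hw => h b w hw]

theorem apply_not {i : ℕ} (hi : i < W) (Ψ : State W) :
    (Op.not i).apply O C Ψ = fun b => Ψ (xorAt b i true) := by
  have h1 : Function.Injective ![i] := Function.injective_of_subsingleton _
  have h2 : ∀ t, ![i] t < W := by simpa [Fin.forall_fin_one] using hi
  rw [Op.apply, applyOn_basisMap h1 h2 notMap_involutive]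
  funext b
  congr 1
  refine extend_eq_of (injective_wire h1 h2) ?_ ?_
  · rw [Fin.forall_fin_one]
    simp [xorAt]
  · intro w hw
    rw [Fin.forall_fin_one] at hw
    have : (w : ℕ) ≠ i := fun h => hw (Fin.ext h.symm)
    simp [xorAt, this]

theorem apply_cnot {i j : ℕ} (hi : i < W) (hj : j < W) (hij : i ≠ j) (Ψ : State W) :
    (Op.cnot i j).apply O C Ψ = fun b => Ψ (xorAt b j (rd b i)) := by
  have h1 : Function.Injective ![i, j] := by
    intro a b
    fin_cases a <;> fin_cases b <;> simp [hij, hij.symm]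
  have h2 : ∀ t, ![i, j] t < W := by
    rw [Fin.forall_fin_two]
    exact ⟨hi, hj⟩
  rw [Op.apply, applyOn_basisMap h1 h2 cnotMap_involutive]
  funext b
  congr 1
  refine extend_eq_of (injective_wire h1 h2) ?_ ?_
  · rw [Fin.forall_fin_two]
    simp [xorAt, hij, rd, hi]
  · intro w hw
    rw [Fin.forall_fin_two] at hw
    have : (w : ℕ) ≠ j := fun h => hw.2 (Fin.ext h.symm)
    simp [xorAt, this]

theorem apply_toffoli {i j k : ℕ} (hi : i < W) (hj : j < W) (hk : k < W) (hij : i ≠ j)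
    (hik : i ≠ k) (hjk : j ≠ k) (Ψ : State W) :
    (Op.toffoli i j k).apply O C Ψ = fun b => Ψ (xorAt b k (rd b i && rd b j)) := by
  have h1 : Function.Injective ![i, j, k] := by
    intro a b
    fin_cases a <;> fin_cases b <;> simp [hij, hij.symm, hik, hik.symm, hjk, hjk.symm]
  have h2 : ∀ t, ![i, j, k] t < W := by
    simp [Fin.forall_fin_succ, hi, hj, hk]
  rw [Op.apply, applyOn_basisMap h1 h2 toffoliMap_involutive]
  funext b
  congr 1
  refine extend_eq_of (injective_wire h1 h2) ?_ ?_
  · simp [Fin.forall_fin_succ, xorAt, hik, hjk, rd, hi, hj]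
  · intro w hw
    have : (w : ℕ) ≠ k := fun h => hw 2 (Fin.ext h.symm)
    simp [xorAt, this]

theorem lt_mul_of_fin {k n : ℕ} (i : Fin k) (j : Fin n) : (i : ℕ) * n + j < k * n := by
  have h1 : ((i : ℕ) + 1) * n ≤ k * n := Nat.mul_le_mul_right n i.2
  have := j.2
  rw [add_mul, one_mul] at h1
  omega

theorem fin_mul_add_inj {k n : ℕ} {i i' : Fin k} {j j' : Fin n}
    (h : (i : ℕ) * n + j = i' * n + j') : i = i' ∧ j = j' := by
  have hn : 0 < n := j.pos
  have h1 := congrArg (· / n) h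
  have h2 := congrArg (· % n) h
  simp only [j.2, j'.2, mul_comm _ n, Nat.mul_add_mod, Nat.mod_eq_of_lt, Nat.mul_add_div hn,
    Nat.div_eq_of_lt,
    add_zero] at h1 h2
  exact ⟨Fin.ext h1, Fin.ext h2⟩

theorem apply_node {k px pa r : ℕ} (hk : k < l) (h1 : px + k * n ≤ pa) (h2 : pa + m ≤ r)
    (h3 : r + 1 < W) (Ψ : State W) :
    (Op.node k px pa r).apply O C Ψ = fun b => Ψ
      (xorAt (xorAt b r (encAnswer (O (.node ⟨k, hk⟩ (fun i j => rd b (px + i * n + j))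
        (fun j => rd b (pa + j)))) 0)) (r + 1)
        (encAnswer (O (.node ⟨k, hk⟩ (fun i j => rd b (px + i * n + j))
        (fun j => rd b (pa + j)))) 1)) := by
  rw [Op.apply, dif_pos hk]
  set ws : (Fin k × Fin n ⊕ Fin m) ⊕ Fin 2 → ℕ :=
    Sum.elim (Sum.elim (fun p => px + p.1 * n + p.2) (fun j => pa + j)) (fun t => r + t) with hws
  have hb1 (p : Fin k × Fin n) := lt_mul_of_fin p.1 p.2
  have hw : ∀ i, ws i < W := by
    rintro ((p | j) | t)
    · have := hb1 p
      simp only [hws, Sum.elim_inl]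
      omega
    · have := j.2
      simp only [hws, Sum.elim_inl, Sum.elim_inr]
      omega
    · have := t.2
      simp only [hws, Sum.elim_inr]
      omega
  have hi : Function.Injective ws := by
    rintro ((p | j) | t) ((p' | j') | t') h <;>
      simp only [hws, Sum.elim_inl, Sum.elim_inr] at h
    · obtain ⟨h1, h2⟩ := fin_mul_add_inj (i := p.1) (i' := p'.1) (j := p.2) (j' := p'.2) (by omega)
      rw [Prod.ext h1 h2]
    · have := hb1 p
      omega
    · have := hb1 p
      omega
    · have := hb1 p'
      omega
    · rw [Fin.ext (Nat.add_left_cancel h)]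
    · have := j.2
      omega
    · have := hb1 p'
      omega
    · have := j'.2
      omega
    · rw [Fin.ext (Nat.add_left_cancel h)]
  unfold queryMatrix
  rw [applyOn_basisMap hi hw (queryMap_involutive fun c : Fin k × Fin n ⊕ Fin m → Bool =>
    O (.node ⟨k, hk⟩ (fun i j => c (.inl (i, j))) (fun j => c (.inr j))))]
  funext b
  congr 1
  have hpx (p : Fin k × Fin n) : rd b (px + p.1 * n + p.2) = b ⟨ws (.inl (.inl p)), hw _⟩ :=
    rd_of_lt _ _
  have hpa (j : Fin m) : rd b (pa + j) = b ⟨ws (.inl (.inr j)), hw _⟩ := rd_of_lt _ _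
  have e1 : (fun (i : Fin k) (j : Fin n) => rd b (px + i * n + j)) =
      fun i j => b ⟨ws (.inl (.inl (i, j))), hw _⟩ := by
    funext i j
    exact hpx (i, j)
  have e2 : (fun (j : Fin m) => rd b (pa + j)) = fun j => b ⟨ws (.inl (.inr j)), hw _⟩ := by
    funext j
    exact hpa j
  rw [e1, e2]
  refine extend_eq_of (injective_wire hi hw) ?_ ?_
  · rintro ((p | j) | t)
    · have h4 := hb1 p
      have h5 : px + p.1 * n + p.2 ≠ r := by omega
      have h6 : px + p.1 * n + p.2 ≠ r + 1 := by omega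
      simp [xorAt, hws, h5, h6]
    · have h4 := j.2
      have h5 : pa + j ≠ r := by omega
      have h6 : pa + j ≠ r + 1 := by omega
      simp [xorAt, hws, h5, h6]
    · fin_cases t <;> simp [xorAt, hws]
  · intro w hw'
    have h4 : (w : ℕ) ≠ r := fun h => hw' (.inr 0) (Fin.ext h.symm)
    have h5 : (w : ℕ) ≠ r + 1 := fun h => hw' (.inr 1) (Fin.ext h.symm)
    simp [xorAt, h4, h5]

theorem apply_leaf {px r : ℕ} (h1 : px + l * n ≤ r) (h3 : r + 1 < W) (Ψ : State W) :
    (Op.leaf px r).apply O C Ψ = fun b => Ψ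
      (xorAt (xorAt b r (encAnswer (O (.leaf fun i j => rd b (px + i * n + j))) 0)) (r + 1)
        (encAnswer (O (.leaf fun i j => rd b (px + i * n + j))) 1)) := by
  rw [Op.apply]
  set ws : (Fin l × Fin n) ⊕ Fin 2 → ℕ :=
    Sum.elim (fun p => px + p.1 * n + p.2) (fun t => r + t) with hws
  have hb1 (p : Fin l × Fin n) := lt_mul_of_fin p.1 p.2
  have hw : ∀ i, ws i < W := by
    rintro (p | t)
    · have := hb1 p
      simp only [hws, Sum.elim_inl]
      omega
    · have := t.2
      simp only [hws, Sum.elim_inr]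
      omega
  have hi : Function.Injective ws := by
    rintro (p | t) (p' | t') h <;>
      simp only [hws, Sum.elim_inl, Sum.elim_inr] at h
    · obtain ⟨h1, h2⟩ := fin_mul_add_inj (i := p.1) (i' := p'.1) (j := p.2) (j' := p'.2) (by omega)
      rw [Prod.ext h1 h2]
    · have := hb1 p
      omega
    · have := hb1 p'
      omega
    · rw [Fin.ext (Nat.add_left_cancel h)]
  unfold queryMatrix
  rw [applyOn_basisMap hi hw (queryMap_involutive fun c : Fin l × Fin n → Bool =>
    O (.leaf fun i j => c (i, j)))]
  funext b
  congr 1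
  have e1 : (fun (i : Fin l) (j : Fin n) => rd b (px + i * n + j)) =
      fun i j => b ⟨ws (.inl (i, j)), hw _⟩ := by
    funext i j
    exact rd_of_lt _ _
  rw [e1]
  refine extend_eq_of (injective_wire hi hw) ?_ ?_
  · rintro (p | t)
    · have h4 := hb1 p
      have h5 : px + p.1 * n + p.2 ≠ r := by omega
      have h6 : px + p.1 * n + p.2 ≠ r + 1 := by omega
      simp [xorAt, hws, h5, h6]
    · fin_cases t <;> simp [xorAt, hws]
  · intro w hw'
    have h4 : (w : ℕ) ≠ r := fun h => hw' (.inr 0) (Fin.ext h.symm)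
    have h5 : (w : ℕ) ≠ r + 1 := fun h => hw' (.inr 1) (Fin.ext h.symm)
    simp [xorAt, h4, h5]

/-- The sign of a bit. -/
def sgn (v : Bool) : ℂ := if v then -1 else 1

/-- The identity `H X H = Z`: it turns a bit on a wire into a sign. -/
theorem had_not_had : hadamard * (basisMap fun c : Fin 1 → Bool => ![!(c 0)]) * hadamard =
    Matrix.diagonal fun c => sgn (c 0) := by
  have h2 : (Real.sqrt 2 : ℂ) * Real.sqrt 2 = 2 := by
    rw [← Complex.ofReal_mul, Real.mul_self_sqrt two_pos.le]
    norm_num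
  have h0 : (Real.sqrt 2 : ℂ) ≠ 0 := fun h => by rw [h] at h2; norm_num at h2
  have hbc (b c : Fin 1 → Bool) : b = c ↔ b 0 = c 0 :=
    ⟨fun h => by rw [h], fun h => funext fun i => by rw [Subsingleton.elim i 0, h]⟩
  ext b c
  rw [Matrix.mul_apply, ← (Equiv.funUnique (Fin 1) Bool).symm.sum_comp, Fintype.sum_bool]
  simp only [Matrix.mul_apply, ← (Equiv.funUnique (Fin 1) Bool).symm.sum_comp, Fintype.sum_bool]
  simp only [hadamard, basisMap, Matrix.diagonal_apply, hbc, Equiv.funUnique_symm_apply,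
    uniqueElim_const, sgn]
  cases b 0 <;> cases c 0 <;> simp <;> field_simp <;>
    first | ring1 | linear_combination h2 | linear_combination -h2

theorem runL_had_not_had {i : ℕ} (hi : i < W) (Ψ : State W) :
    runL O C [.had i, .not i, .had i] Ψ = (fun b => sgn (rd b i)) * Ψ := by
  have h1 : Function.Injective ![i] := Function.injective_of_subsingleton _
  have h2 : ∀ t, ![i] t < W := by simpa [Fin.forall_fin_one] using hi
  simp only [runL_cons, runL_nil, Op.apply]
  rw [applyOn_applyOn _ _ _ ⟨h1, h2⟩, applyOn_applyOn _ _ _ ⟨h1, h2⟩, had_not_had,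
    applyOn_diagonal h1 h2]
  congr 1
  funext b
  rw [rd_of_lt b hi]
  rfl

/-- Add the wires from `β` on to the wires from `σ` on. -/
def copyMap (β σ n : ℕ) (b : Fin W → Bool) : Fin W → Bool :=
  fun w => if σ ≤ w ∧ (w : ℕ) < σ + n then xor (b w) (rd b (β + (w - σ))) else b w

/-- The gates that add the `n` wires from `β` on to the `n` wires from `σ` on. -/
def copyOps (β σ n : ℕ) : List Op := (List.range n).map fun j => .cnot (β + j) (σ + j)

/-- Hadamard gates on the `n` wires from `β` on. -/
def hadOps (β n : ℕ) : List Op := (List.range n).map fun j => .had (β + j)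

theorem runL_copyOps {β σ k : ℕ} (h1 : σ + k ≤ β) (h2 : β + k ≤ W) (Ψ : State W) :
    runL O C (copyOps β σ k) Ψ = fun b => Ψ (copyMap β σ k b) := by
  induction k with
  | zero =>
    funext b
    have : copyMap β σ 0 b = b := by
      funext w
      have : ¬(σ ≤ (w : ℕ) ∧ (w : ℕ) < σ + 0) := by omega
      simp only [copyMap, if_neg this]
    rw [this]
    rfl
  | succ k ih =>
    rw [copyOps, List.range_succ, List.map_append, runL_append, List.map_singleton, runL_cons,
      runL_nil, apply_cnot O C (by omega) (by omega) (by omega)]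
    have := ih (by omega) (by omega)
    rw [copyOps] at this
    rw [this]
    funext b
    refine congrArg Ψ (funext fun w => ?_)
    simp only [copyMap]
    by_cases hw : (w : ℕ) = σ + k
    · have h3 : ¬(σ ≤ (w : ℕ) ∧ (w : ℕ) < σ + k) := by omega
      have h4 : σ ≤ (w : ℕ) ∧ (w : ℕ) < σ + (k + 1) := by omega
      rw [if_neg h3, if_pos h4, xorAt, if_pos hw, hw, Nat.add_sub_cancel_left]
    · by_cases h3 : σ ≤ (w : ℕ) ∧ (w : ℕ) < σ + k
      · have h4 : σ ≤ (w : ℕ) ∧ (w : ℕ) < σ + (k + 1) := by omega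
        rw [if_pos h3, if_pos h4, xorAt, if_neg hw, rd_xorAt_of_ne]
        omega
      · have h4 : ¬(σ ≤ (w : ℕ) ∧ (w : ℕ) < σ + (k + 1)) := by omega
        rw [if_neg h3, if_neg h4, xorAt, if_neg hw]

/-- Reset `k` wires from `β` on. -/
def clear (β k : ℕ) (b : Fin W → Bool) : Fin W → Bool :=
  fun w => if β ≤ w ∧ (w : ℕ) < β + k then false else b w

theorem apply_had {i : ℕ} (hi : i < W) (Ψ : State W) (hΨ : ZeroOn {i} Ψ) :
    (Op.had i).apply O C Ψ = fun b => Ψ (clear i 1 b) / (Real.sqrt 2 : ℂ) := by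
  have h1 : Function.Injective ![i] := Function.injective_of_subsingleton _
  have h2 : ∀ t, ![i] t < W := by simpa [Fin.forall_fin_one] using hi
  have he := injective_wire h1 h2
  rw [Op.apply, applyOn_eq h1 h2]
  funext b
  rw [← (Equiv.funUnique (Fin 1) Bool).symm.sum_comp, Fintype.sum_bool]
  have h3 : Function.extend (fun t => (⟨![i] t, h2 t⟩ : Fin W))
      ((Equiv.funUnique (Fin 1) Bool).symm false) b = clear i 1 b := by
    refine extend_eq_of he (fun t => ?_) fun w hw => ?_
    · rw [Subsingleton.elim t 0]
      simp [clear]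
    · have : ¬(i ≤ (w : ℕ) ∧ (w : ℕ) < i + 1) := fun h => hw 0 (Fin.ext (by simp; omega))
      simp only [clear, if_neg this]
  have h4 : Ψ (Function.extend (fun t => (⟨![i] t, h2 t⟩ : Fin W))
      ((Equiv.funUnique (Fin 1) Bool).symm true) b) = 0 := by
    refine hΨ _ ⟨⟨i, hi⟩, rfl, ?_⟩
    exact he.extend_apply _ _ (0 : Fin 1)
  rw [h3, h4]
  simp [hadamard]
  ring

theorem runL_hadOps {β k : ℕ} (h2 : β + k ≤ W) (Ψ : State W)
    (hΨ : ZeroOn {w | β ≤ w ∧ w < β + k} Ψ) :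
    runL O C (hadOps β k) Ψ = fun b => Ψ (clear β k b) / (Real.sqrt (2 ^ k) : ℂ) := by
  induction k with
  | zero =>
    funext b
    have : clear β 0 b = b := by
      funext w
      have : ¬(β ≤ (w : ℕ) ∧ (w : ℕ) < β + 0) := by omega
      simp only [clear, if_neg this]
    rw [this]
    simp [hadOps, runL_nil]
  | succ k ih =>
    rw [hadOps, List.range_succ, List.map_append, runL_append, List.map_singleton, runL_cons,
      runL_nil]
    have h3 := ih (by omega) (hΨ.mono fun w hw => ⟨hw.1, by have := hw.2; omega⟩)
    rw [hadOps] at h3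
    have hloc : Loc (W := W) {w | β ≤ w ∧ w < β + k} (runL O C (hadOps β k)) := by
      refine loc_runL O C fun o ho => ?_
      simp only [hadOps, List.mem_map, List.mem_range] at ho
      obtain ⟨j, hj, rfl⟩ := ho
      exact loc_had O C ⟨by omega, by omega⟩
    rw [apply_had O C (by omega)]
    · rw [h3]
      funext b
      have h4 : clear β k (clear (β + k) 1 b) = clear β (k + 1) b := by
        funext w
        simp only [clear]
        by_cases h5 : β ≤ (w : ℕ) ∧ (w : ℕ) < β + k
        · rw [if_pos h5, if_pos ⟨h5.1, by omega⟩]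
        · rw [if_neg h5]
          by_cases h6 : β + k ≤ (w : ℕ) ∧ (w : ℕ) < β + k + 1
          · rw [if_pos h6, if_pos ⟨by omega, by omega⟩]
          · rw [if_neg h6, if_neg (by omega)]
      beta_reduce
      rw [h4, pow_succ, Real.sqrt_mul (by positivity)]
      push_cast
      rw [div_div]
    · refine ZeroOn.of_loc (hΨ.mono ?_) hloc ?_
      · rintro _ rfl
        exact ⟨by omega, by omega⟩
      · rw [Set.disjoint_singleton_left]
        exact fun h => by have := h.2; omega

end Ops

/-! ### Circuits on a block of wires -/

section Fibres

variable {W N : ℕ}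

/-- Overwrite the block of `N` wires from `q` on by `c`. -/
noncomputable def setBlock {q : ℕ} (hq : q + N ≤ W) (c : Fin N → Bool) (b : Fin W → Bool) :
    Fin W → Bool :=
  Function.extend (fun i : Fin N => (⟨q + i, by omega⟩ : Fin W)) c b

theorem block_injective {q : ℕ} (hq : q + N ≤ W) :
    Function.Injective (fun i : Fin N => (⟨q + i, by omega⟩ : Fin W)) :=
  fun i j h => by
    have := Fin.mk.inj_iff.1 h
    exact Fin.ext (by omega)

theorem setBlock_of_mem {q : ℕ} (hq : q + N ≤ W) (c : Fin N → Bool) (b : Fin W → Bool) {w : Fin W}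
    (h1 : q ≤ w) (h2 : (w : ℕ) < q + N) : setBlock hq c b w = c ⟨w - q, by omega⟩ := by
  have : w = (fun i : Fin N => (⟨q + i, by omega⟩ : Fin W)) ⟨w - q, by omega⟩ :=
    Fin.ext (by simp; omega)
  conv_lhs => rw [this]
  exact (block_injective hq).extend_apply c b _

theorem setBlock_of_notMem {q : ℕ} (hq : q + N ≤ W) (c : Fin N → Bool) (b : Fin W → Bool)
    {w : Fin W} (h : ¬(q ≤ (w : ℕ) ∧ (w : ℕ) < q + N)) : setBlock hq c b w = b w := by
  refine Function.extend_apply' _ _ _ ?_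
  rintro ⟨i, rfl⟩
  exact h ⟨by simp, by simp⟩

theorem rd_setBlock_add {q : ℕ} (hq : q + N ≤ W) (c : Fin N → Bool) (b : Fin W → Bool) {j : ℕ}
    (hj : j < N) : rd (setBlock hq c b) (q + j) = c ⟨j, hj⟩ := by
  rw [rd_of_lt _ (by omega : q + j < W), setBlock_of_mem hq c b (by simp) (by simp [hj])]
  simp

theorem rd_setBlock_of_notMem {q : ℕ} (hq : q + N ≤ W) (c : Fin N → Bool) (b : Fin W → Bool)
    {w : ℕ} (h : ¬(q ≤ w ∧ w < q + N)) : rd (setBlock hq c b) w = rd b w := by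
  unfold rd
  split
  · exact setBlock_of_notMem hq c b h
  · rfl

theorem sum_sum_setBlock {q : ℕ} (hq : q + N ≤ W) (h : (Fin W → Bool) → ℝ) :
    ∑ b, ∑ c : Fin N → Bool, h (setBlock hq c b) = Fintype.card (Fin N → Bool) * ∑ b, h b :=
  sum_sum_extend (block_injective hq) h

theorem applyOn_setBlock {ι : Type} [Fintype ι] [DecidableEq ι] {q : ℕ} (hq : q + N ≤ W)
    {ws : ι → ℕ} (hi : Function.Injective ws) (hw : ∀ i, ws i < N)
    (G : Matrix (ι → Bool) (ι → Bool) ℂ) (Ψ : State W) (b : Fin W → Bool) (c : Fin N → Bool) :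
    applyOn (fun i => q + ws i) G Ψ (setBlock hq c b) =
      applyOn ws G (fun c => Ψ (setBlock hq c b)) c := by
  have hi' : Function.Injective fun i => q + ws i := fun i j h => hi (Nat.add_left_cancel h)
  have hw' : ∀ i, q + ws i < W := fun i => by have := hw i; omega
  rw [applyOn_eq hi' hw', applyOn_eq hi hw]
  refine Finset.sum_congr rfl fun d _ => ?_
  have h1 : ∀ i, setBlock hq c b ⟨q + ws i, hw' i⟩ = c ⟨ws i, hw i⟩ := fun i => by
    rw [setBlock_of_mem hq c b (by simp) (by simp [hw])]
    simp
  simp only [h1]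
  congr 2
  refine extend_eq_of (injective_wire hi' hw') (fun i => ?_) fun w hw'' => ?_
  · rw [setBlock_of_mem hq _ b (by simp) (by simp [hw])]
    simp only [Nat.add_sub_cancel_left]
    exact (injective_wire hi hw).extend_apply d c i
  · by_cases h : q ≤ (w : ℕ) ∧ (w : ℕ) < q + N
    · rw [setBlock_of_mem hq _ b h.1 h.2, setBlock_of_mem hq _ b h.1 h.2]
      refine Function.extend_apply' _ _ _ ?_
      rintro ⟨i, hi⟩
      refine hw'' i (Fin.ext ?_)
      have := congrArg Fin.val hi
      simp only at this ⊢
      omega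
    · rw [setBlock_of_notMem hq _ b h, setBlock_of_notMem hq _ b h]

/-- With the wires outside the block fixed, a circuit on the block acts as on a register of its own.
This transfers `successProb`, which is about `N` isolated qubits, to a call inside a larger
register. -/
theorem runCircuit_setBlock {q : ℕ} (hq : q + N ≤ W) (C : List (TwoQubitGate N)) (Ψ : State W)
    (b : Fin W → Bool) (c : Fin N → Bool) :
    runCircuit q C Ψ (setBlock hq c b) = runCircuit 0 C (fun c => Ψ (setBlock hq c b)) c := by
  induction C generalizing Ψ with
  | nil => rfl
  | cons g C ih =>
    have h1 : (![q + g.fst, q + g.snd] : Fin 2 → ℕ) =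
        fun i => q + (![0 + g.fst, 0 + g.snd] : Fin 2 → ℕ) i := by
      funext i
      fin_cases i <;> simp
    have hne : (g.fst : ℕ) ≠ g.snd := fun h => g.ne (Fin.ext h)
    have hi : Function.Injective (![0 + g.fst, 0 + g.snd] : Fin 2 → ℕ) := by
      intro a b
      fin_cases a <;> fin_cases b <;> simp [hne, hne.symm]
    have hw : ∀ i, (![0 + g.fst, 0 + g.snd] : Fin 2 → ℕ) i < N := by
      rw [Fin.forall_fin_two]
      simp
    simp only [runCircuit, List.foldl_cons] at ih ⊢
    rw [ih, h1]
    simp only [applyOn_setBlock hq hi hw]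

theorem applyOn_smul {ι : Type} [Fintype ι] [DecidableEq ι] (ws : ι → ℕ)
    (G : Matrix (ι → Bool) (ι → Bool) ℂ) (z : ℂ) (Ψ : State W) :
    applyOn ws G (z • Ψ) = z • applyOn ws G Ψ := by
  unfold applyOn
  split
  · funext b
    simp only [Pi.smul_apply, smul_eq_mul, Finset.mul_sum]
    exact Finset.sum_congr rfl fun c _ => by ring
  · rfl

theorem runCircuit_smul (q : ℕ) (C : List (TwoQubitGate N)) (z : ℂ) (Ψ : State W) :
    runCircuit q C (z • Ψ) = z • runCircuit q C Ψ := by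
  induction C generalizing Ψ with
  | nil => rfl
  | cons g C ih =>
    simp only [runCircuit, List.foldl_cons] at ih ⊢
    rw [applyOn_smul, ih]

end Fibres

/-! ### One call of `U` on a superposition of nodes -/

section Trial

variable {n : ℕ} {P : SingleLevel n}

theorem nm_phi_le_one (work : ℕ) (a : P.A) : nm (P.phi work a) ≤ 1 := by
  classical
  refine nm_le_of_sq_le zero_le_one ?_
  have h1 : ∀ b : Fin (n + work) → Bool, ‖P.phi work a b‖ ^ 2 =
      if ∀ j : Fin work, b (Fin.natAdd n j) = false then ((2 : ℝ) ^ n)⁻¹ else 0 := by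
    intro b
    have hn : ‖(Real.sqrt (2 ^ n) : ℂ)‖ ^ 2 = 2 ^ n := by
      rw [Complex.norm_real, Real.norm_eq_abs, sq_abs, Real.sq_sqrt (by positivity)]
    unfold SingleLevel.phi
    split
    · rw [norm_div, div_pow, hn]
      split <;> simp
    · simp
  simp only [h1]
  rw [← Finset.sum_filter, Finset.sum_const, nsmul_eq_mul, one_pow, ← div_eq_mul_inv,
    div_le_one (by positivity)]
  have h2 : (Finset.univ.filter fun b : Fin (n + work) → Bool =>
      ∀ j : Fin work, b (Fin.natAdd n j) = false).card ≤
      (Finset.univ : Finset (Fin n → Bool)).card := by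
    refine Finset.card_le_card_of_injOn (fun b i => b (Fin.castAdd work i)) (by simp) ?_
    intro b hb b' hb' h
    simp only [Finset.coe_filter, Finset.mem_univ, true_and, Set.mem_ofPred_eq] at hb hb'
    funext i
    refine Fin.addCases (fun i => congrFun h i) (fun j => ?_) i
    rw [hb, hb']
  have h3 : (Finset.univ : Finset (Fin n → Bool)).card = 2 ^ n := by simp
  rw [h3] at h2
  exact_mod_cast h2

open Classical in
theorem sum_fail_le (U : IdCircuit n P.m) {δ : ℝ} (a : P.A) (hU : δ ≤ successProb P U a) :
    ∑ c : Fin (n + U.work) → Bool,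
      (if (fun i : Fin P.m => c (Fin.castLE U.out_le i)) = a.1 then 0
        else ‖runCircuit 0 U.gates (P.phi U.work a) c‖ ^ 2) ≤ 1 - δ := by
  have h1 : ∑ c : Fin (n + U.work) → Bool,
      (if (fun i : Fin P.m => c (Fin.castLE U.out_le i)) = a.1 then 0
        else ‖runCircuit 0 U.gates (P.phi U.work a) c‖ ^ 2) + successProb P U a =
      nm (runCircuit 0 U.gates (P.phi U.work a)) ^ 2 := by
    rw [successProb, nm_sq, ← Finset.sum_add_distrib]
    refine Finset.sum_congr rfl fun c _ => ?_
    split <;> simp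
  rw [(unitaryPair_runCircuit 0 U.gates).nm] at h1
  have h2 : nm (P.phi U.work a) ^ 2 ≤ 1 := pow_le_one₀ (nm_nonneg _) (nm_phi_le_one _ _)
  linarith

variable {l W : ℕ}

/-- The strings `x₁,…,x_k` that are stored on the wires. -/
def path (n k : ℕ) (b : Fin W → Bool) : Fin k → Fin n → Bool := fun i j => rd b (1 + i * n + j)

/-- The bit of the node whose path is stored on the wires. -/
def bitAt (s : Secret P l) (b₀ : Bool) {k : ℕ} (hk : k ≤ l) (b : Fin W → Bool) : Bool :=
  nodeBit P s b₀ k hk (path n k b)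

/-- The secret of the node whose path is stored on the wires. -/
def secretAt (s : Secret P l) {k : ℕ} (hk : k < l) (b : Fin W → Bool) : P.A :=
  s ⟨k, hk⟩ (path n k b)

theorem bitAt_succ (s : Secret P l) (b₀ : Bool) {k : ℕ} (hk : k < l) (b : Fin W → Bool) :
    bitAt s b₀ hk b = P.f (secretAt s hk b) fun j => rd b (1 + k * n + j) := rfl

theorem path_congr {k : ℕ} {b b' : Fin W → Bool}
    (h : ∀ w, 1 ≤ w → w < 1 + k * n → rd b w = rd b' w) : path n k b = path n k b' := by
  funext i j
  have := lt_mul_of_fin i j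
  exact h _ (by omega) (by omega)

theorem bitAt_congr {s : Secret P l} {b₀ : Bool} {k : ℕ} (hk : k ≤ l) {b b' : Fin W → Bool}
    (h : ∀ w, 1 ≤ w → w < 1 + k * n → rd b w = rd b' w) : bitAt s b₀ hk b = bitAt s b₀ hk b' := by
  rw [bitAt, bitAt, path_congr h]

theorem secretAt_congr {s : Secret P l} {k : ℕ} (hk : k < l) {b b' : Fin W → Bool}
    (h : ∀ w, 1 ≤ w → w < 1 + k * n → rd b w = rd b' w) : secretAt s hk b = secretAt s hk b' := by
  rw [secretAt, secretAt, path_congr h]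

open Classical in
/-- The indicator of the states in which the label stored from `β` on is wrong. -/
noncomputable def wrongLabel (s : Secret P l) {k : ℕ} (hk : k < l) (β : ℕ) : State W :=
  fun b => if (fun j : Fin P.m => rd b (β + j)) = (secretAt s hk b).1 then 0 else 1

/-- The path wires lie outside the block, so the secret is constant on each fibre, and there the
input of `U` is a scalar multiple of the state `phi` of that secret. The failure weight on the fibre
is at most `1 - δ` times the squared modulus of that scalar, and summing over fibres gives the
factor `√(1 - δ)` for the norm, even though different paths have different secrets. -/
theorem nm_wrongLabel_le (U : IdCircuit n P.m) {δ : ℝ} (hδ : δ ≤ 1)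
    (hU : ∀ a : P.A, δ ≤ successProb P U a) (s : Secret P l) {k β : ℕ} (hk : k < l)
    (hβ : 1 + l * n ≤ β) (hW : β + (n + U.work) ≤ W) (O : Query n P.m l → Option Bool) (Φ : State W)
    (hΦ : ZeroOn {w | β ≤ w ∧ w < β + (n + U.work)} Φ) :
    nm (wrongLabel s hk β * runCircuit β U.gates
      ((fun b => sgn (P.f (secretAt s hk b) fun j => rd b (β + j))) *
        runL O U.gates (hadOps β n) Φ)) ≤ Real.sqrt (1 - δ) * nm Φ := by
  classical
  set Θ : State W := (fun b => sgn (P.f (secretAt s hk b) fun j => rd b (β + j))) *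
        runL O U.gates (hadOps β n) Φ with hΘ
  have hsec : ∀ b c, secretAt s hk (setBlock hW c b) = secretAt s hk b := fun b c => by
    have h1 : k * n ≤ l * n := Nat.mul_le_mul_right n hk.le
    exact secretAt_congr hk fun w _ h2 => rd_setBlock_of_notMem hW c b (by omega)
  have hfib : ∀ b, (fun c => Θ (setBlock hW c b)) =
      Φ (setBlock hW (fun _ => false) b) • P.phi U.work (secretAt s hk b) := by
    intro b
    funext c
    rw [hΘ, runL_hadOps O U.gates (by omega) Φ (hΦ.mono fun w hw => ⟨hw.1, by have := hw.2; omega⟩)]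
    simp only [Pi.mul_apply, Pi.smul_apply, smul_eq_mul, hsec, SingleLevel.phi]
    have h1 : (fun j : Fin n => rd (setBlock hW c b) (β + j)) =
        fun i => c (Fin.castAdd U.work i) := by
      funext j
      exact rd_setBlock_add hW c b (by omega)
    rw [h1]
    by_cases hc : ∀ j : Fin U.work, c (Fin.natAdd n j) = false
    · rw [if_pos hc]
      have h2 : clear β n (setBlock hW c b) = setBlock hW (fun _ => false) b := by
        funext w
        by_cases hw : β ≤ (w : ℕ) ∧ (w : ℕ) < β + (n + U.work)
        · rw [setBlock_of_mem hW _ b hw.1 hw.2, clear]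
          split
          · rfl
          · rw [setBlock_of_mem hW _ b hw.1 hw.2]
            convert hc ⟨w - β - n, by omega⟩ using 2
            exact Fin.ext (by simp; omega)
        · rw [setBlock_of_notMem hW _ b hw, clear, if_neg (by omega),
            setBlock_of_notMem hW _ b hw]
      rw [h2, sgn]
      ring
    · rw [if_neg hc, mul_zero]
      obtain ⟨j, hj⟩ := not_forall.1 hc
      have h3 : Φ (clear β n (setBlock hW c b)) = 0 := by
        refine hΦ _ ⟨⟨β + (n + j), by omega⟩, ⟨by simp, by simp⟩, ?_⟩
        rw [clear, if_neg (by simp), setBlock_of_mem hW _ b (by simp) (by simp)]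
        simp only [Nat.add_sub_cancel_left]
        rw [Bool.not_eq_false] at hj
        exact hj
      rw [h3]
      simp
  refine nm_le_of_sq_le (mul_nonneg (Real.sqrt_nonneg _) (nm_nonneg _)) ?_
  rw [mul_pow, Real.sq_sqrt (by linarith), nm_sq]
  have h0 : (0 : ℝ) < Fintype.card (Fin (n + U.work) → Bool) := Nat.cast_pos.2 Fintype.card_pos
  refine le_of_mul_le_mul_left ?_ h0
  rw [mul_left_comm, ← sum_sum_setBlock hW, ← sum_sum_setBlock hW, Finset.mul_sum]
  refine Finset.sum_le_sum fun b _ => ?_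
  have h1 : ∑ c : Fin (n + U.work) → Bool,
      ‖(wrongLabel s hk β * runCircuit β U.gates Θ : State W) (setBlock hW c b)‖ ^ 2 =
      ‖Φ (setBlock hW (fun _ => false) b)‖ ^ 2 * ∑ c : Fin (n + U.work) → Bool,
      (if (fun i : Fin P.m => c (Fin.castLE U.out_le i)) = (secretAt s hk b).1 then 0
        else ‖runCircuit 0 U.gates (P.phi U.work (secretAt s hk b)) c‖ ^ 2) := by
    rw [Finset.mul_sum]
    refine Finset.sum_congr rfl fun c _ => ?_
    have h2 : (fun j : Fin P.m => rd (setBlock hW c b) (β + j)) =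
        fun i => c (Fin.castLE U.out_le i) := by
      funext j
      exact rd_setBlock_add hW c b (by have := U.out_le; omega)
    rw [Pi.mul_apply, wrongLabel, runCircuit_setBlock, hfib, runCircuit_smul, hsec, h2]
    split
    · simp
    · simp [mul_pow]
  rw [h1, mul_comm]
  -- The scalar is the amplitude of `Φ` at the point of the fibre whose block is zero, so its square
  -- is at most the weight of `Φ` on the fibre.
  refine mul_le_mul (sum_fail_le U _ (hU _)) ?_ (by positivity) (by linarith)
  exact Finset.single_le_sum (f := fun c => ‖Φ (setBlock hW c b)‖ ^ 2)
    (fun _ _ => by positivity) (Finset.mem_univ _)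

end Trial

/-! ### Disjoint memory areas, addressed like the nodes of a binary heap -/

/-- The wires that belong to the descendants of the heap node `i`, where node `j` owns the wires
from `j * F` to `j * F + F - 1`. -/
def area (F i : ℕ) : Set ℕ := {w | ∃ d, w / F / 2 ^ d = i}

theorem le_of_mem_area {F i w : ℕ} (h : w ∈ area F i) : i ≤ w / F := by
  obtain ⟨d, rfl⟩ := h
  exact Nat.div_le_self _ _

theorem div_eq_of_frame {F i w : ℕ} (h1 : i * F ≤ w) (h2 : w < i * F + F) : w / F = i := by
  refine Nat.div_eq_of_lt_le h1 ?_
  rwa [add_mul, one_mul]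

theorem mem_area_of_frame {F i w : ℕ} (h1 : i * F ≤ w) (h2 : w < i * F + F) : w ∈ area F i :=
  ⟨0, by rw [pow_zero, Nat.div_one, div_eq_of_frame h1 h2]⟩

theorem notMem_area_of_lt {F i j w : ℕ} (h2 : w < i * F + F) (hij : i < j) : w ∉ area F j := by
  intro h
  have h3 := le_of_mem_area h
  have h4 : w / F < i + 1 := Nat.div_lt_of_lt_mul (by linarith)
  omega

theorem area_two_mul_subset (F i : ℕ) : area F (2 * i) ⊆ area F i := by
  rintro w ⟨d, hd⟩
  refine ⟨d + 1, ?_⟩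
  rw [pow_succ, ← Nat.div_div_eq_div_mul, hd]
  omega

theorem area_two_mul_add_one_subset (F i : ℕ) : area F (2 * i + 1) ⊆ area F i := by
  rintro w ⟨d, hd⟩
  refine ⟨d + 1, ?_⟩
  rw [pow_succ, ← Nat.div_div_eq_div_mul, hd]
  omega

/-- Two ancestors of one index are equal if taken at the same height, and otherwise the higher one
is at most half of the lower one. For `i > 0` neither is possible for the siblings `2 * i` and `2 *
i + 1`. -/
theorem disjoint_area {F i : ℕ} (hi : 0 < i) : Disjoint (area F (2 * i + 1)) (area F (2 * i)) := by
  have key : ∀ x d e a b : ℕ, x / 2 ^ d = a → x / 2 ^ e = b → d < e → 2 * b ≤ a := by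
    rintro x d e a b rfl rfl hde
    obtain ⟨f, rfl⟩ := Nat.exists_eq_add_of_lt hde
    rw [add_assoc, pow_add, ← Nat.div_div_eq_div_mul]
    have h1 := Nat.div_mul_le_self (x / 2 ^ d) (2 ^ (f + 1))
    have h2 : 2 ≤ 2 ^ (f + 1) := Nat.le_self_pow (Nat.succ_ne_zero f) 2
    calc 2 * (x / 2 ^ d / 2 ^ (f + 1)) ≤ 2 ^ (f + 1) * (x / 2 ^ d / 2 ^ (f + 1)) :=
          Nat.mul_le_mul_right _ h2
      _ ≤ x / 2 ^ d := by rwa [mul_comm]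
  rw [Set.disjoint_left]
  rintro w ⟨d, hd⟩ ⟨e, he⟩
  rcases lt_trichotomy d e with h | h | h
  · have := key _ _ _ _ _ hd he h
    omega
  · subst h
    omega
  · have := key _ _ _ _ _ he hd h
    omega

/-! ### The sequence of operations -/

/-- Compute the bit of the node on the path wires and add its sign, by a query of a leaf. -/
def leafOps (β : ℕ) : List Op :=
  [.leaf 1 β] ++ [.had (β + 1), .not (β + 1), .had (β + 1)] ++ [.leaf 1 β]

/-- Use the bit on wire `p`: at the root it is the output, elsewhere its sign is added. -/
def midOps (k p : ℕ) : List Op := if k = 0 then [.cnot p 0] else [.had p, .not p, .had p]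

/-- Query with the label found on the wires from `β` on; then set the wire `β + N + 2` to the answer
if the label was right and to the wire `p` otherwise. -/
def verifyOps (N k β p : ℕ) : List Op :=
  [.node k 1 β (β + N), .cnot p (β + N + 2), .toffoli (β + N) (β + N + 1) (β + N + 2),
    .toffoli (β + N) p (β + N + 2)]

/-- One attempt to find the secret, where `D` computes the signs of the children. -/
def trialOps (n N k β σ p : ℕ) (D : List Op) : List Op :=
  hadOps β n ++ copyOps β σ n ++ D ++ (copyOps β σ n ++ [.sub false β] ++ verifyOps N k β p)

/-- The algorithm for the nodes at depth `l - K` when `ρ` attempts to find the secret remain. -/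
def treeOps (n l N R F : ℕ) : ℕ → ℕ → ℕ → ℕ → List Op
  | 0, _, β, _ => leafOps β
  | K + 1, 0, _, p => midOps (l - (K + 1)) p
  | K + 1, ρ + 1, β, p =>
    trialOps n N (l - (K + 1)) β (1 + (l - (K + 1)) * n) p
        (treeOps n l N R F K R (2 * β) (β + N + 3)) ++
      treeOps n l N R F (K + 1) ρ (2 * β + F) (β + N + 2) ++
      invOps (trialOps n N (l - (K + 1)) β (1 + (l - (K + 1)) * n) p
        (treeOps n l N R F K R (2 * β) (β + N + 3)))
  termination_by K ρ => (K, ρ)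

/-- The sequence has the form attempt, remaining attempts, inverse of the attempt, so it is its own
inverse by induction on the remaining attempts, whatever the recursive call for the children is. At
the root the middle operation is a `cnot`, also an involution. -/
theorem invOps_treeOps (n l N R F K ρ β p : ℕ) :
    invOps (treeOps n l N R F K ρ β p) = treeOps n l N R F K ρ β p := by
  induction ρ generalizing β p with
  | zero =>
    cases K with
    | zero => rw [treeOps]; rfl
    | succ K =>
      rw [treeOps, midOps]
      split <;> rfl
  | succ ρ ih =>
    cases K with
    | zero => rw [treeOps]; rfl
    | succ K =>
      rw [treeOps, invOps_append, invOps_append, invOps_invOps, ih, List.append_assoc]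

/-! ### Locality of an attempt -/

section Locality

variable {W : ℕ}

/-- The map `τ` may change wires outside `S`, since it is undone afterwards; it only has to respect
agreement outside `S`. Thus copying a string to a path slot, running the recursive call and removing
the copy does not count as acting on the slot. -/
theorem loc_conj {S : Set ℕ} {A : State W → State W} (hA : Loc S A)
    {τ : (Fin W → Bool) → Fin W → Bool} (hτ : Function.Involutive τ)
    (h : ∀ b b', (∀ w : Fin W, (w : ℕ) ∉ S → b w = b' w) →
      ∀ w : Fin W, (w : ℕ) ∉ S → τ b w = τ b' w) :
    Loc S fun Ψ => fun b => A (fun b => Ψ (τ b)) (τ b) := by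
  intro g hg Ψ
  have h1 := hA (fun b => g (τ b)) (fun b b' hb => hg _ _ (h b b' hb)) fun b => Ψ (τ b)
  funext b
  have h2 := congrFun h1 (τ b)
  simp only [Pi.mul_apply, hτ b] at h2 ⊢
  exact h2

theorem copyMap_involutive {β σ n : ℕ} (h : σ + n ≤ β) :
    Function.Involutive (copyMap (W := W) β σ n) := by
  intro b
  funext w
  by_cases hw : σ ≤ (w : ℕ) ∧ (w : ℕ) < σ + n
  · have h1 : rd (copyMap β σ n b) (β + (w - σ)) = rd b (β + (w - σ)) := by
      unfold rd
      split
      · rw [copyMap, if_neg (by simp; omega)]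
      · rfl
    rw [copyMap, if_pos hw, h1, copyMap, if_pos hw]
    simp
  · rw [copyMap, if_neg hw, copyMap, if_neg hw]

theorem loc_copy_conj {S : Set ℕ} {A : State W → State W} (hA : Loc S A) {β σ n : ℕ}
    (h : σ + n ≤ β) (hS : ∀ j < n, β + j ∉ S) :
    Loc S fun Ψ => fun b => A (fun b => Ψ (copyMap β σ n b)) (copyMap β σ n b) := by
  refine loc_conj hA (copyMap_involutive h) fun b b' hb w hw => ?_
  simp only [copyMap]
  split
  · rename_i h1
    rw [hb w hw, rd_congr hb (hS (w - σ) (by omega))]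
  · exact hb w hw

/-- The wires from `β` to `β + N - 1`. -/
def block (β N : ℕ) : Set ℕ := {w | β ≤ w ∧ w < β + N}

variable {n m l N : ℕ} (O : Query n m l → Option Bool) (C : List (TwoQubitGate N))

theorem Loc.append {S : Set ℕ} {L L' : List Op} (h : Loc (W := W) S (runL O C L))
    (h' : Loc (W := W) S (runL O C L')) : Loc (W := W) S (runL O C (L ++ L')) :=
  fun g hg Ψ => by rw [runL_append, runL_append, h g hg, h' g hg]

theorem loc_hadOps {β k : ℕ} {S : Set ℕ} (h : ∀ j < k, β + j ∈ S) :
    Loc (W := W) S (runL O C (hadOps β k)) := by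
  refine loc_runL O C fun o ho => ?_
  simp only [hadOps, List.mem_map, List.mem_range] at ho
  obtain ⟨j, hj, rfl⟩ := ho
  exact loc_had O C (h j hj)

theorem loc_search {S : Set ℕ} {β σ : ℕ} (hn : n ≤ N) (hσ : σ + n ≤ β) (hW : β + N ≤ W)
    (hS : ∀ j < N, β + j ∉ S) {D : List Op} (hD : Loc (W := W) S (runL O C D)) :
    Loc (W := W) (block β N ∪ S) (runL O C (hadOps β n ++ copyOps β σ n ++ D ++
      (copyOps β σ n ++ [.sub false β]))) := by
  have h1 : runL (W := W) O C (hadOps β n ++ copyOps β σ n ++ D ++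
      (copyOps β σ n ++ [.sub false β])) = fun Ψ => (Op.sub false β).apply O C
        ((fun Ψ => fun b => runL O C D (fun b => Ψ (copyMap β σ n b)) (copyMap β σ n b))
          (runL O C (hadOps β n) Ψ)) := by
    funext Ψ
    simp only [runL_append, runL_cons, runL_nil]
    rw [runL_copyOps O C hσ (by omega), runL_copyOps O C hσ (by omega)]
  rw [h1]
  have hblk : ∀ j < N, β + j ∈ block β N ∪ S := fun j hj => Or.inl ⟨by omega, by omega⟩
  refine Loc.comp (Loc.comp (loc_hadOps O C fun j hj => hblk j (by omega))
    ((loc_copy_conj hD hσ fun j hj => hS j (by omega)).mono Set.subset_union_right)) ?_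
  exact loc_sub O C hblk false

theorem loc_verifyOps {S : Set ℕ} {k β p : ℕ} (hS : ∀ j < N + 3, β + j ∈ S) (hp : p ∉ S)
    (hβ : 1 + l * n ≤ β) (hm : m ≤ N) (hpW : p < W) (hW : β + N + 2 < W) (hk : k < l) :
    Loc (W := W) S (runL O C (verifyOps N k β p)) := by
  have hkn : k * n ≤ l * n := Nat.mul_le_mul_right n hk.le
  have hmem : ∀ j, j < N + 3 → ∀ {w : Fin W}, (w : ℕ) ∉ S → (w : ℕ) ≠ β + j :=
    fun j hj w hw h => hw (h ▸ hS j hj)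
  have hacc : ∀ {w : Fin W}, (w : ℕ) ∉ S → (w : ℕ) ≠ β + N + 2 := hmem (N + 2) (by omega)
  have hpne : ∀ j, j < N + 3 → p ≠ β + j := fun j hj h => hp (h ▸ hS j hj)
  have hpne2 : p ≠ β + N + 2 := hpne (N + 2) (by omega)
  have hpne0 : p ≠ β + N := hpne N (by omega)
  refine loc_runL O C fun o ho => ?_
  simp only [verifyOps, List.mem_cons, List.not_mem_nil, or_false] at ho
  rcases ho with rfl | rfl | rfl | rfl
  · simp only [apply_node O C hk (by omega : 1 + k * n ≤ β) (by omega : β + m ≤ β + N)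
      (by omega : β + N + 1 < W)]
    refine loc_comp fun b w hw => ?_
    have h1 : (w : ℕ) ≠ β + N + 1 := hmem (N + 1) (by omega) hw
    rw [xorAt, if_neg h1, xorAt, if_neg (hmem N (by omega) hw)]
  · simp only [apply_cnot O C hpW hW hpne2]
    exact loc_comp fun b w hw => by rw [xorAt, if_neg (hacc hw)]
  · simp only [apply_toffoli O C (by omega : β + N < W) (by omega : β + N + 1 < W) hW
      (by omega) (by omega) (by omega)]
    exact loc_comp fun b w hw => by rw [xorAt, if_neg (hacc hw)]
  · simp only [apply_toffoli O C (by omega : β + N < W) hpW hW hpne0.symm (by omega) hpne2]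
    exact loc_comp fun b w hw => by rw [xorAt, if_neg (hacc hw)]

theorem trialOps_eq (n N k β σ p : ℕ) (D : List Op) : trialOps n N k β σ p D =
    (hadOps β n ++ copyOps β σ n ++ D ++ (copyOps β σ n ++ [.sub false β])) ++
      verifyOps N k β p := by
  simp [trialOps]

theorem loc_trialOps {F i k p : ℕ} (hi : 0 < i) (hF : l * n + N + 5 ≤ F) (hW : (i + 1) * F ≤ W)
    (hk : k < l) (hn : n ≤ N) (hm : m ≤ N) (hp : p ∉ area F i) (hpW : p < W) {D : List Op}
    (hD : Loc (W := W) (area F (2 * i)) (runL O C D)) :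
    Loc (W := W) (block (i * F) (N + 3) ∪ area F (2 * i))
      (runL O C (trialOps n N k (i * F) (1 + k * n) p D)) := by
  have hiF : F ≤ i * F := Nat.le_mul_of_pos_left F hi
  have hkn : (k + 1) * n ≤ l * n := Nat.mul_le_mul_right n hk
  rw [add_mul, one_mul] at hkn hW
  have hnot : ∀ j < N, i * F + j ∉ area F (2 * i) := fun j hj =>
    notMem_area_of_lt (i := i) (by omega) (by omega)
  rw [trialOps_eq]
  refine Loc.append O C ((loc_search O C (σ := 1 + k * n) hn (by omega) (by omega) hnot hD).mono ?_)
    (loc_verifyOps O C (fun j hj => Or.inl ⟨by omega, by omega⟩) ?_ (by omega) hm hpW (by omega) hk)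
  · exact Set.union_subset_union_left _ fun w hw => ⟨hw.1, by have := hw.2; omega⟩
  · rintro (⟨h1, h2⟩ | h)
    · exact hp (mem_area_of_frame h1 (by omega))
    · exact hp (area_two_mul_subset F i h)

theorem block_union_area_subset {F i : ℕ} (h : N + 3 ≤ F) :
    block (i * F) (N + 3) ∪ area F (2 * i) ⊆ area F i :=
  Set.union_subset (fun _ hw => mem_area_of_frame hw.1 (hw.2.trans_le (by omega)))
    (area_two_mul_subset F i)

theorem loc_leafOps {S : Set ℕ} {β : ℕ} (h0 : β ∈ S) (h1 : β + 1 ∈ S) (hβ : 1 + l * n ≤ β)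
    (hW : β + 1 < W) : Loc (W := W) S (runL O C (leafOps β)) := by
  have hleaf : Loc (W := W) S fun Ψ => (Op.leaf 1 β).apply O C Ψ := by
    simp only [apply_leaf O C (by omega : 1 + l * n ≤ β) hW]
    refine loc_comp fun b w hw => ?_
    have h2 : (w : ℕ) ≠ β := fun h => hw (h ▸ h0)
    have h3 : (w : ℕ) ≠ β + 1 := fun h => hw (h ▸ h1)
    rw [xorAt, if_neg h3, xorAt, if_neg h2]
  have hnot : Loc (W := W) S fun Ψ => (Op.not (β + 1)).apply O C Ψ := by
    simp only [apply_not O C hW]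
    refine loc_comp fun b w hw => ?_
    have h3 : (w : ℕ) ≠ β + 1 := fun h => hw (h ▸ h1)
    rw [xorAt, if_neg h3]
  refine loc_runL O C fun o ho => ?_
  simp only [leafOps, List.cons_append, List.nil_append, List.mem_cons, List.not_mem_nil,
    or_false] at ho
  rcases ho with rfl | rfl | rfl | rfl | rfl
  · exact hleaf
  · exact loc_had O C h1
  · exact hnot
  · exact loc_had O C h1
  · exact hleaf

/-- A diagonal operator commutes with every multiplier, so the wire `p` need not lie in `S`. -/
theorem loc_sign {S : Set ℕ} {p : ℕ} (hp : p < W) :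
    Loc (W := W) S (runL O C [.had p, .not p, .had p]) := by
  intro g _ Ψ
  rw [runL_had_not_had O C hp, runL_had_not_had O C hp, mul_left_comm]

/-- Everything fits into `W` wires below the heap node `i` when the recursion has height `h`. -/
def Fits (F i h W : ℕ) : Prop := (i + 1) * F * 2 ^ h ≤ W

theorem Fits.mono {F i j h h' W : ℕ} (H : Fits F i h W) (hh : h' < h) (hj : j ≤ 2 * i + 1) :
    Fits F j h' W := by
  unfold Fits at *
  calc (j + 1) * F * 2 ^ h' ≤ (2 * (i + 1)) * F * 2 ^ h' := by
        gcongr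
        omega
    _ = (i + 1) * F * 2 ^ (h' + 1) := by ring
    _ ≤ (i + 1) * F * 2 ^ h := by
        gcongr
        · norm_num
        · omega
    _ ≤ W := H

theorem Fits.le {F i h W : ℕ} (H : Fits F i h W) : (i + 1) * F ≤ W :=
  (Nat.le_mul_of_pos_right _ (by positivity)).trans H

/-- The height of the recursion. -/
def height (R K ρ : ℕ) : ℕ := K * (R + 1) + ρ

/-- The condition `K < l` excludes the root, where the middle operation writes to the output wire,
outside the area. The children use the area of `2 * i`, the remaining attempts that of `2 * i + 1`.
-/
theorem loc_treeOps (R : ℕ) {F : ℕ} (hF : l * n + N + 5 ≤ F) (hn : n ≤ N) (hm : m ≤ N)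
    (K ρ i p : ℕ) (hK : K < l) (hi : 0 < i) (hp : p ∉ area F i) (hpW : p < W)
    (hfit : Fits F i (height R K ρ) W) :
    Loc (W := W) (area F i) (runL O C (treeOps n l N R F K ρ (i * F) p)) := by
  have hiF : F ≤ i * F := Nat.le_mul_of_pos_left F hi
  have hW := hfit.le
  rw [add_mul, one_mul] at hW
  induction K generalizing ρ i p with
  | zero =>
    rw [treeOps]
    exact loc_leafOps O C (mem_area_of_frame (by omega) (by omega))
      (mem_area_of_frame (by omega) (by omega)) (by omega) (by omega)
  | succ K ih =>
    induction ρ generalizing i p with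
    | zero =>
      rw [treeOps, midOps, if_neg (by omega)]
      exact loc_sign O C hpW
    | succ ρ ihρ =>
      have hheight : height R K R < height R (K + 1) (ρ + 1) := by
        unfold height
        rw [add_mul]
        omega
      have hD := ih R (2 * i) (i * F + N + 3) (by omega) (by omega)
        (notMem_area_of_lt (i := i) (by omega) (by omega)) (by omega)
        (hfit.mono hheight (by omega)) (by rw [mul_assoc]; omega) (by
          have := (hfit.mono hheight (by omega : 2 * i ≤ 2 * i + 1)).le
          rwa [add_mul, one_mul] at this)
      have h2 : 2 * (i * F) + F = (2 * i + 1) * F := by ring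
      rw [mul_assoc] at hD
      rw [treeOps, h2]
      have hfit' : Fits F (2 * i + 1) (height R (K + 1) ρ) W :=
        hfit.mono (by unfold height; omega) le_rfl
      have hE := ihρ (2 * i + 1) (i * F + N + 2) (by omega)
        (notMem_area_of_lt (i := i) (by omega) (by omega)) (by omega) hfit'
        (by rw [← h2]; omega) (by
          have := hfit'.le
          rwa [add_mul _ 1 F, one_mul] at this)
      have hT := loc_trialOps O C hi hF (by rw [add_mul, one_mul]; omega : (i + 1) * F ≤ W)
        (by omega : l - (K + 1) < l) hn hm hp hpW hD
      have hT := hT.mono (block_union_area_subset (by omega))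
      exact Loc.append O C (Loc.append O C hT (hE.mono (area_two_mul_add_one_subset F i)))
        (loc_runL_invOps O C hT)

end Locality

/-! ### One attempt contracts the wrong part of the state -/

section Contraction

variable {W : ℕ}

/-- A reversible classical operation moves from the state to the indicator. Weights after a sequence
of such operations become weights of a pulled-back indicator on the original state. -/
theorem nm_mul_comp {τ : (Fin W → Bool) → Fin W → Bool} (hτ : Function.Involutive τ)
    (g Ψ : State W) : nm (g * fun b => Ψ (τ b)) = nm ((fun b => g (τ b)) * Ψ) := by
  refine nm_congr ?_
  rw [← Equiv.sum_comp hτ.toPerm]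
  simp only [Function.Involutive.coe_toPerm, Pi.mul_apply, hτ _]

theorem xorAt_involutive {j : ℕ} {v : (Fin W → Bool) → Bool}
    (hv : ∀ b x, v (xorAt b j x) = v b) : Function.Involutive fun b => xorAt b j (v b) := by
  intro b
  simp only [hv]
  funext w
  simp only [xorAt]
  split <;> simp

theorem xorAt_xorAt_involutive {i j : ℕ} (hij : i ≠ j) {u v : (Fin W → Bool) → Bool}
    (hu : ∀ b x y, u (xorAt (xorAt b i x) j y) = u b)
    (hv : ∀ b x y, v (xorAt (xorAt b i x) j y) = v b) :
    Function.Involutive fun b => xorAt (xorAt b i (u b)) j (v b) := by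
  intro b
  simp only [hu, hv]
  funext w
  simp only [xorAt]
  by_cases h1 : (w : ℕ) = i
  · have h2 : (w : ℕ) ≠ j := fun h => hij (h1 ▸ h)
    simp [h1, hij]
  · by_cases h2 : (w : ℕ) = j
    · simp [h2, hij.symm]
    · simp [h1, h2]

variable {n : ℕ} {P : SingleLevel n} {l : ℕ}

/-- The indicator of the states in which the wire `p` does not hold the bit of the node. -/
noncomputable def wrongBit (s : Secret P l) (b₀ : Bool) {k : ℕ} (hk : k ≤ l) (p : ℕ) : State W :=
  fun b => if rd b p = bitAt s b₀ hk b then 0 else 1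

/-- The sign of the bit of the node. -/
def signAt (s : Secret P l) (b₀ : Bool) {k : ℕ} (hk : k ≤ l) : State W :=
  fun b => sgn (bitAt s b₀ hk b)

theorem indepOf_bitAt {S : Set ℕ} (s : Secret P l) (b₀ : Bool) {k : ℕ} (hk : k ≤ l)
    (hS : ∀ w, 1 ≤ w → w < 1 + k * n → w ∉ S) :
    IndepOf (W := W) S fun b => bitAt s b₀ hk b :=
  fun _ _ hb => bitAt_congr hk fun w h1 h2 => rd_congr hb (hS w h1 h2)

theorem indepOf_signAt {S : Set ℕ} (s : Secret P l) (b₀ : Bool) {k : ℕ} (hk : k ≤ l)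
    (hS : ∀ w, 1 ≤ w → w < 1 + k * n → w ∉ S) :
    IndepOf S (signAt s b₀ hk : State W) :=
  fun b b' hb => congrArg sgn (indepOf_bitAt s b₀ hk hS b b' hb)

theorem indepOf_wrongBit {S : Set ℕ} (s : Secret P l) (b₀ : Bool) {k : ℕ} (hk : k ≤ l) {p : ℕ}
    (hS : ∀ w, 1 ≤ w → w < 1 + k * n → w ∉ S) (hp : p ∉ S) :
    IndepOf S (wrongBit s b₀ hk p : State W) :=
  fun b b' hb => by
    have h : bitAt s b₀ hk b = bitAt s b₀ hk b' := indepOf_bitAt s b₀ hk hS b b' hb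
    rw [wrongBit, wrongBit, h, rd_congr hb hp]

theorem nm_wrongBit_mul_le (s : Secret P l) (b₀ : Bool) {k : ℕ} (hk : k ≤ l) (p : ℕ)
    (Φ : State W) : nm (wrongBit s b₀ hk p * Φ) ≤ nm Φ := by
  refine (nm_le_mul_of_forall_le zero_le_one fun b => ?_).trans (one_mul _).le
  rw [Pi.mul_apply, norm_mul, wrongBit]
  split <;> simp

theorem nm_wrongLabel_mul_le (s : Secret P l) {k : ℕ} (hk : k < l) (β : ℕ)
    (Φ : State W) : nm (wrongLabel s hk β * Φ) ≤ nm Φ := by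
  refine (nm_le_mul_of_forall_le zero_le_one fun b => ?_).trans (one_mul _).le
  rw [Pi.mul_apply, norm_mul, wrongLabel]
  split <;> simp

theorem oracle_node_eq (s : Secret P l) (b₀ : Bool) {k : ℕ} (hk : k < l) (b : Fin W → Bool)
    (β : ℕ) : oracle P s b₀ (.node ⟨k, hk⟩ (fun i j => rd b (1 + i * n + j))
      (fun j => rd b (β + j))) =
      if (fun j : Fin P.m => rd b (β + j)) = (secretAt s hk b).1 then
        some (bitAt s b₀ hk.le b) else none := rfl

/-- The accumulator starts at zero and receives `p`; if the label was accepted, it then receives the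
answer and `p` again. It therefore holds the answer for a right label and `p` for a wrong one, so it
is wrong exactly when the label and `p` are both wrong. -/
theorem nm_wrongBit_verifyOps {N : ℕ} (C : List (TwoQubitGate N)) (s : Secret P l) (b₀ : Bool)
    {k β p : ℕ} (hk : k < l) (hβ : 1 + l * n ≤ β) (hm : P.m ≤ N) (hpW : p < W)
    (hW : β + N + 2 < W) (hp : ∀ j < N + 3, p ≠ β + j) (Ψ : State W)
    (hΨ : ∀ j < 3, ZeroOn {β + N + j} Ψ) :
    nm (wrongBit s b₀ hk.le (β + N + 2) * runL (oracle P s b₀) C (verifyOps N k β p) Ψ) =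
      nm (wrongLabel s hk β * (wrongBit s b₀ hk.le p * Ψ)) := by
  have hkn : k * n ≤ l * n := Nat.mul_le_mul_right n hk.le
  have hp0 : p ≠ β + N := hp N (by omega)
  have hp1 : p ≠ β + N + 1 := hp (N + 1) (by omega)
  have hp2 : p ≠ β + N + 2 := hp (N + 2) (by omega)
  have e1 : β + N ≠ β + N + 1 := by omega
  have e2 : β + N ≠ β + N + 2 := by omega
  have e3 : β + N + 1 ≠ β + N + 2 := by omega
  simp only [verifyOps, runL_cons, runL_nil]
  have hpath : ∀ (b : Fin W → Bool) x y,
      bitAt s b₀ hk.le (xorAt (xorAt b (β + N) x) (β + N + 1) y) = bitAt s b₀ hk.le b ∧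
      secretAt s hk (xorAt (xorAt b (β + N) x) (β + N + 1) y) = secretAt s hk b := by
    intro b x y
    constructor
    · exact bitAt_congr hk.le fun w _ _ => by
        rw [rd_xorAt_of_ne _ _ (by omega), rd_xorAt_of_ne _ _ (by omega)]
    · exact secretAt_congr hk fun w _ _ => by
        rw [rd_xorAt_of_ne _ _ (by omega), rd_xorAt_of_ne _ _ (by omega)]
  have hlab : ∀ (b : Fin W → Bool) x y,
      (fun j : Fin P.m => rd (xorAt (xorAt b (β + N) x) (β + N + 1) y) (β + j)) =
        fun j : Fin P.m => rd b (β + j) := by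
    intro b x y
    funext j
    have := j.2
    rw [rd_xorAt_of_ne _ _ (by omega), rd_xorAt_of_ne _ _ (by omega)]
  rw [apply_toffoli _ C (by omega : β + N < W) hpW hW hp0.symm e2 hp2,
    nm_mul_comp (τ := fun b => xorAt b (β + N + 2) (rd b (β + N) && rd b p))
      (xorAt_involutive fun b x => by rw [rd_xorAt_of_ne _ _ e2, rd_xorAt_of_ne _ _ hp2]),
    apply_toffoli _ C (by omega : β + N < W) (by omega : β + N + 1 < W) hW e1 e2 e3,
    nm_mul_comp (τ := fun b => xorAt b (β + N + 2) (rd b (β + N) && rd b (β + N + 1)))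
      (xorAt_involutive fun b x => by rw [rd_xorAt_of_ne _ _ e2, rd_xorAt_of_ne _ _ e3]),
    apply_cnot _ C hpW hW hp2,
    nm_mul_comp (τ := fun b => xorAt b (β + N + 2) (rd b p))
      (xorAt_involutive fun b x => by rw [rd_xorAt_of_ne _ _ hp2]),
    apply_node _ C hk (by omega : 1 + k * n ≤ β) (by omega : β + P.m ≤ β + N)
      (by omega : β + N + 1 < W)]
  simp only [oracle_node_eq]
  rw [nm_mul_comp (xorAt_xorAt_involutive e1
      (fun b x y => by rw [(hpath b x y).1, (hpath b x y).2, hlab])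
      (fun b x y => by rw [(hpath b x y).1, (hpath b x y).2, hlab]))]
  congr 1
  funext b
  simp only [Pi.mul_apply]
  -- The truth table is needed only on the support of `Ψ`, where the two answer wires and the
  -- accumulator are zero.
  by_cases hb : Ψ b = 0
  · simp [hb]
  have z0 : rd b (β + N) = false := (hΨ 0 (by omega)).rd_eq_false hb rfl
  have z1 : rd b (β + N + 1) = false := (hΨ 1 (by omega)).rd_eq_false hb rfl
  have z2 : rd b (β + N + 2) = false := (hΨ 2 (by omega)).rd_eq_false hb rfl
  rw [← mul_assoc]
  congr 1
  have hW0 : β + N < W := by omega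
  have hW1 : β + N + 1 < W := by omega
  have hbit : ∀ (b : Fin W → Bool) x, bitAt s b₀ hk.le (xorAt b (β + N + 2) x) =
      bitAt s b₀ hk.le b := fun b x =>
    bitAt_congr hk.le fun w _ _ => by rw [rd_xorAt_of_ne _ _ (by omega)]
  simp only [wrongBit, wrongLabel, hbit, (hpath _ _ _).1, rd_xorAt_self _ _ hW,
    rd_xorAt_of_ne _ _ e2, rd_xorAt_of_ne _ _ e3, rd_xorAt_of_ne _ _ hp2, rd_xorAt_of_ne _ _ hp1,
    rd_xorAt_of_ne _ _ hp0, rd_xorAt_of_ne _ _ e1, rd_xorAt_of_ne _ _ e1.symm,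
    rd_xorAt_of_ne _ _ e2.symm, rd_xorAt_of_ne _ _ e3.symm, rd_xorAt_self _ _ hW0,
    rd_xorAt_self _ _ hW1,
    z0, z1, z2]
  split
  · cases rd b p <;> cases bitAt s b₀ hk.le b <;> simp [encAnswer]
  · simp [encAnswer]

/-- The path wires below depth `k`. -/
def slots (n l k : ℕ) : Set ℕ := {w | 1 + k * n ≤ w ∧ w < 1 + l * n}

/-- After the attempt the accumulator is wrong only where `p` was wrong and the label found is
wrong. Being wrong at `p` is unaffected by the search, so the search may be applied to the wrong
part of `Φ` alone. There an exact computation of the signs leaves a fraction `√(1 - δ)` of the norm,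
and the actual `D` adds at most `ε`. -/
theorem nm_trialOps_le (U : IdCircuit n P.m) {δ ε : ℝ} (hδ : δ ≤ 1)
    (hU : ∀ a : P.A, δ ≤ successProb P U a) (s : Secret P l) (b₀ : Bool) {F i k p : ℕ}
    (hi : 0 < i) (hF : l * n + (n + U.work) + 5 ≤ F) (hW : (i + 1) * F ≤ W) (hk : k < l)
    (hp : p ∉ area F i) (hpW : p < W) {D : List Op}
    (hD : Loc (W := W) (area F (2 * i)) (runL (oracle P s b₀) U.gates D))
    (hDε : ∀ χ : State W, ZeroOn (area F (2 * i)) χ → ZeroOn (slots n l (k + 1)) χ →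
      nm (runL (oracle P s b₀) U.gates D χ - signAt s b₀ hk * χ) ≤ ε * nm χ)
    (Φ : State W) (hΦ : ZeroOn (area F i) Φ) (hΦ' : ZeroOn (slots n l k) Φ) :
    nm (wrongBit s b₀ hk.le (i * F + (n + U.work) + 2) *
      runL (oracle P s b₀) U.gates (trialOps n (n + U.work) k (i * F) (1 + k * n) p D) Φ) ≤
      (Real.sqrt (1 - δ) + ε) * nm (wrongBit s b₀ hk.le p * Φ) := by
  set O := oracle P s b₀ with hO
  set N := n + U.work with hN
  set β := i * F with hβ
  have hiF : F ≤ β := Nat.le_mul_of_pos_left F hi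
  have hkn : (k + 1) * n ≤ l * n := Nat.mul_le_mul_right n hk
  rw [add_mul, one_mul] at hkn hW
  have hnot : ∀ j, β + j < β + F → β + j ∉ area F (2 * i) := fun j hj =>
    notMem_area_of_lt (i := i) hj (by omega)
  have hmem : ∀ j, j < F → β + j ∈ area F i := fun j hj => mem_area_of_frame (by omega) (by omega)
  have hsmall : ∀ w, w < 1 + l * n → w ∉ area F i := fun w hw =>
    notMem_area_of_lt (i := 0) (by omega) hi
  have hsub := area_two_mul_subset F i
  have hm := U.out_le
  have hσ : 1 + k * n + n ≤ β := by omega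
  have hloc := loc_search (W := W) O U.gates (n := n) (by omega : n ≤ N) hσ (by omega : β + N ≤ W)
    (fun j hj => hnot j (by omega)) hD
  have hblock : ∀ w ∈ block β N ∪ area F (2 * i), w ∈ area F i := by
    rintro w (⟨h1, h2⟩ | h)
    · exact mem_area_of_frame h1 (by omega)
    · exact hsub h
  rw [trialOps_eq, runL_append, nm_wrongBit_verifyOps U.gates s b₀ hk (by omega) hm hpW (by omega)
    (fun j hj h => hp (h ▸ hmem j (by omega))) _ ?zero]
  case zero =>
    intro j hj
    refine ZeroOn.of_loc (hΦ.mono ?_) hloc ?_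
    · rintro _ rfl
      have := hmem (N + j) (by omega)
      rw [← add_assoc] at this
      exact this
    · rw [Set.disjoint_singleton_left]
      rintro (⟨h1, h2⟩ | h)
      · omega
      · have := hnot (N + j) (by omega)
        rw [← add_assoc] at this
        exact this h
  -- The projection on a wrong `p` commutes with the search because neither `p` nor the path of the
  -- node is touched by it.
  rw [← hloc _ (indepOf_wrongBit s b₀ hk.le (fun w _ h2 h => hsmall w (by omega) (hblock w h))
    fun h => hp (hblock p h))]
  set Φ₁ := wrongBit s b₀ hk.le p * Φ with hΦ₁
  have hz1 : ZeroOn (area F i) Φ₁ := hΦ.mul _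
  have hz2 : ZeroOn (slots n l k) Φ₁ := hΦ'.mul _
  clear_value Φ₁
  have hinv := copyMap_involutive (W := W) hσ
  set H := runL O U.gates (hadOps β n) Φ₁ with hH
  have hlocH : Loc (W := W) (block β N) (runL O U.gates (hadOps β n)) :=
    loc_hadOps O U.gates fun j hj => ⟨by omega, by omega⟩
  have hHslots : ZeroOn (slots n l k) H := ZeroOn.of_loc hz2 hlocH (by
    rw [Set.disjoint_left]
    rintro w ⟨_, h1⟩ ⟨h2, _⟩
    omega)
  have hHarea : ZeroOn (area F (2 * i)) H := ZeroOn.of_loc (hz1.mono hsub) hlocH (by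
    rw [Set.disjoint_right]
    rintro w ⟨h1, h2⟩
    exact notMem_area_of_lt (i := i) (by omega) (by omega))
  set χ : State W := runL O U.gates (copyOps β (1 + k * n) n) H with hχ
  have hχ' : χ = fun b => H (copyMap β (1 + k * n) n b) := by
    rw [hχ, runL_copyOps _ _ hσ (by omega)]
  have hloccopy : Loc (W := W) (block (1 + k * n) n)
      (runL O U.gates (copyOps β (1 + k * n) n)) := by
    have h1 : runL (W := W) O U.gates (copyOps β (1 + k * n) n) =
        fun Ψ b => Ψ (copyMap β (1 + k * n) n b) :=
      funext fun Ψ => runL_copyOps _ _ hσ (by omega) Ψ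
    rw [h1]
    refine loc_comp fun b w hw => ?_
    exact if_neg hw
  have hχ1 : ZeroOn (area F (2 * i)) χ := ZeroOn.of_loc hHarea hloccopy (by
    rw [Set.disjoint_right]
    rintro w ⟨h1, h2⟩ h
    exact hsmall w (by omega) (hsub h))
  have hχ2 : ZeroOn (slots n l (k + 1)) χ := by
    refine ZeroOn.of_loc (hHslots.mono ?_) hloccopy ?_
    · rintro w ⟨h1, h2⟩
      exact ⟨by rw [add_mul] at h1; omega, h2⟩
    · rw [Set.disjoint_left]
      rintro w ⟨h1, _⟩ ⟨_, h2⟩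
      rw [add_mul] at h1
      omega
  have hnmχ : nm χ = nm Φ₁ := by rw [hχ, nm_runL, hH, nm_runL]
  have hexp : runL O U.gates (hadOps β n ++ copyOps β (1 + k * n) n ++ D ++
      (copyOps β (1 + k * n) n ++ [.sub false β])) Φ₁ =
      runL O U.gates (copyOps β (1 + k * n) n ++ [.sub false β]) (runL O U.gates D χ) := by
    simp only [runL_append, hχ, hH]
  rw [hexp]
  set V := runL (W := W) O U.gates (copyOps β (1 + k * n) n ++ [.sub false β]) with hV
  -- The recursive call is replaced by the exact signs; the difference passes through operators that
  -- do not increase the norm.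
  have hsplit : wrongLabel s hk β * V (runL O U.gates D χ) =
      wrongLabel s hk β * V (runL O U.gates D χ - signAt s b₀ hk * χ) +
        wrongLabel s hk β * V (signAt s b₀ hk * χ) := by
    rw [hV, runL_sub, mul_sub, sub_add_cancel]
  rw [hsplit, add_mul, add_comm]
  refine (nm_add_le _ _).trans ?_
  refine add_le_add ?_ ?_
  -- The slot was zero before the copy, so the path of depth `k + 1` ends with the string in the
  -- block. Undoing the copy turns the sign of the child's bit into the sign in the definition of
  -- `phi`.
  · have hideal : V (signAt s b₀ hk * χ) = runCircuit β U.gates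
        ((fun b => sgn (P.f (secretAt s hk b) fun j => rd b (β + j))) * H) := by
      rw [hV, runL_append, runL_copyOps _ _ hσ (by omega), runL_cons, runL_nil]
      simp only [Op.apply, Bool.false_eq_true, if_false]
      congr 1
      funext b
      simp only [Pi.mul_apply, hχ', hinv b]
      by_cases hb : H b = 0
      · rw [hb, mul_zero, mul_zero]
      · congr 1
        have hsec : secretAt s hk (copyMap β (1 + k * n) n b) = secretAt s hk b :=
          secretAt_congr hk fun w _ h2 => by
            unfold rd
            split
            · rw [copyMap, if_neg (by simp; omega)]
            · rfl
        have hslot : (fun j : Fin n => rd (copyMap β (1 + k * n) n b) (1 + k * n + j)) =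
            fun j : Fin n => rd b (β + j) := by
          funext j
          have hj := j.2
          rw [rd_of_lt _ (by omega : 1 + k * n + (j : ℕ) < W), copyMap, if_pos (by simp),
            ← rd_of_lt b (by omega), hHslots.rd_eq_false hb ⟨by omega, by omega⟩]
          simp
        rw [signAt, bitAt_succ, hsec, hslot]
    rw [hideal]
    exact nm_wrongLabel_le U hδ hU s hk (by omega) (by omega) O Φ₁
      (hz1.mono fun w hw => mem_area_of_frame hw.1 (by have := hw.2; omega))
  · refine (nm_wrongLabel_mul_le s hk β _).trans ?_
    rw [hV, nm_runL]
    exact (hDε χ hχ1 hχ2).trans_eq (by rw [hnmχ])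

end Contraction

/-! ### Error analysis of the recursion -/

section Algorithm

variable {W n : ℕ} {P : SingleLevel n} {l : ℕ}

/-- The bit is computed into a clean wire, turned into a sign and uncomputed. The wire `β` receives
the flag, which is always one at a leaf; only the value wire has to start at zero. -/
theorem runL_leafOps {N : ℕ} (C : List (TwoQubitGate N)) (s : Secret P l) (b₀ : Bool) {β : ℕ}
    (hβ : 1 + l * n ≤ β) (hW : β + 1 < W) (Φ : State W) (hΦ : ZeroOn {β + 1} Φ) :
    runL (oracle P s b₀) C (leafOps β) Φ = signAt s b₀ le_rfl * Φ := by
  have hpath : ∀ (b : Fin W → Bool) x y,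
      bitAt s b₀ le_rfl (xorAt (xorAt b β x) (β + 1) y) = bitAt s b₀ le_rfl b := fun b x y =>
    bitAt_congr le_rfl fun w _ _ => by
      rw [rd_xorAt_of_ne _ _ (by omega), rd_xorAt_of_ne _ _ (by omega)]
  have horacle : ∀ b : Fin W → Bool, oracle P s b₀ (.leaf fun i j => rd b (1 + i * n + j)) =
      some (bitAt s b₀ le_rfl b) := fun _ => rfl
  have hinv := xorAt_xorAt_involutive (W := W) (by omega : β ≠ β + 1)
    (u := fun b => encAnswer (some (bitAt s b₀ le_rfl b)) 0)
    (v := fun b => encAnswer (some (bitAt s b₀ le_rfl b)) 1)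
    (fun b x y => by rw [hpath]) (fun b x y => by rw [hpath])
  rw [leafOps, runL_append, runL_append, runL_had_not_had _ _ hW, runL_cons, runL_nil, runL_cons,
    runL_nil, apply_leaf _ _ hβ hW, apply_leaf _ _ hβ hW]
  simp only [horacle]
  funext b
  simp only [Pi.mul_apply, hinv b]
  by_cases hb : Φ b = 0
  · rw [hb, mul_zero, mul_zero]
  · rw [rd_xorAt_self _ _ hW, rd_xorAt_of_ne _ _ (by omega), hΦ.rd_eq_false hb rfl, signAt]
    simp [encAnswer]

/-- Once an attempt has been made, the ancillas of the remaining attempts are still untouched. -/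
theorem zeroOn_trialOps {N m : ℕ} (O : Query n m l → Option Bool) (C : List (TwoQubitGate N))
    {F i k p : ℕ} (hi : 0 < i) (hF : l * n + N + 5 ≤ F) (hW : (i + 1) * F ≤ W)
    (hk : k < l) (hn : n ≤ N) (hm : m ≤ N) (hp : p ∉ area F i) (hpW : p < W) {D : List Op}
    (hD : Loc (W := W) (area F (2 * i)) (runL O C D)) {Φ : State W} (hΦ : ZeroOn (area F i) Φ) :
    ZeroOn (area F (2 * i + 1)) (runL O C (trialOps n N k (i * F) (1 + k * n) p D) Φ) ∧
      ∀ S : Set ℕ, (∀ w ∈ S, w < F) → ZeroOn S Φ →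
        ZeroOn S (runL O C (trialOps n N k (i * F) (1 + k * n) p D) Φ) := by
  have hloc := loc_trialOps O C hi hF hW hk hn hm hp hpW hD
  refine ⟨ZeroOn.of_loc (hΦ.mono (area_two_mul_add_one_subset F i)) hloc ?_,
    fun S hS h => ZeroOn.of_loc h (hloc.mono (block_union_area_subset (by omega))) ?_⟩
  · rw [Set.disjoint_union_right]
    refine ⟨?_, disjoint_area hi⟩
    rw [Set.disjoint_right]
    rintro w ⟨h1, h2⟩
    exact notMem_area_of_lt (i := i) (by omega) (by omega)
  · rw [Set.disjoint_left]
    exact fun w hw => notMem_area_of_lt (i := 0) (by have := hS w hw; omega) hi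

/-- The bound is stated in terms of the part of `Φ` on which `p` is wrong, so that it can be
iterated. With no attempts left the sign of `p` is added, which is exact where `p` is right and off
by at most `2` elsewhere. With one more attempt the error is that of the remaining attempts on the
state after the attempt, whose wrong part is smaller by the factor `√(1 - δ) + ε`. At the children
`R` attempts give error at most `2 * (√(1 - δ) + ε) ^ R ≤ ε`, which closes the induction over the
depth with the same `ε`. -/
theorem nm_treeOps_sub_le (U : IdCircuit n P.m) {δ ε : ℝ} (hδ : δ ≤ 1)
    (hU : ∀ a : P.A, δ ≤ successProb P U a) (s : Secret P l) (b₀ : Bool) {R F : ℕ} (hε : 0 ≤ ε)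
    (hR : 2 * (Real.sqrt (1 - δ) + ε) ^ R ≤ ε) (hF : l * n + (n + U.work) + 5 ≤ F)
    (K k : ℕ) (hk : k ≤ l) (hkK : k + K = l) (hk0 : 0 < k) (ρ i p : ℕ) (hi : 0 < i)
    (hp : p ∉ area F i) (hpW : p < W) (hfit : Fits F i (height R K ρ) W) (Φ : State W)
    (hΦ : ZeroOn (area F i) Φ) (hΦ' : ZeroOn (slots n l k) Φ) :
    nm (runL (oracle P s b₀) U.gates (treeOps n l (n + U.work) R F K ρ (i * F) p) Φ -
      signAt s b₀ hk * Φ) ≤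
      2 * (Real.sqrt (1 - δ) + ε) ^ ρ * nm (wrongBit s b₀ hk p * Φ) := by
  have hθ : 0 ≤ Real.sqrt (1 - δ) + ε := add_nonneg (Real.sqrt_nonneg _) hε
  induction K generalizing k ρ i p Φ with
  | zero =>
    obtain rfl : k = l := by omega
    have hiF : F ≤ i * F := Nat.le_mul_of_pos_left F hi
    have hW := hfit.le
    rw [add_mul, one_mul] at hW
    rw [treeOps, runL_leafOps U.gates s b₀ (by omega) (by omega) Φ (hΦ.mono ?_), sub_self]
    · have h0 : nm (0 : State W) = 0 := by simp [nm]
      rw [h0]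
      exact mul_nonneg (by positivity) (nm_nonneg _)
    · rintro _ rfl
      exact mem_area_of_frame (by omega) (by omega)
  | succ K ih =>
    have hkl : k < l := by omega
    have hlk : l - (K + 1) = k := by omega
    induction ρ generalizing i p Φ with
    | zero =>
      rw [treeOps, hlk, midOps, if_neg (by omega), runL_had_not_had _ _ hpW, pow_zero, mul_one]
      refine nm_le_mul_of_forall_le two_pos.le fun b => ?_
      simp only [Pi.sub_apply, Pi.mul_apply, signAt, wrongBit]
      by_cases h : rd b p = bitAt s b₀ hk b
      · simp [h]
      · rw [if_neg h, one_mul, ← sub_mul, norm_mul]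
        refine mul_le_mul_of_nonneg_right ?_ (norm_nonneg _)
        rw [sgn, sgn]
        split <;> split <;> norm_num
    | succ ρ ihρ =>
      have hiF : F ≤ i * F := Nat.le_mul_of_pos_left F hi
      have hm := U.out_le
      have hheight : height R K R < height R (K + 1) (ρ + 1) := by
        unfold height
        rw [add_mul]
        omega
      have hfitA : Fits F (2 * i) (height R K R) W := hfit.mono hheight (by omega)
      have hfitB : Fits F (2 * i + 1) (height R (K + 1) ρ) W :=
        hfit.mono (by unfold height; omega) le_rfl
      have hW := hfit.le
      have hWA := hfitA.le
      have hiF2 : 2 * (i * F) = 2 * i * F := by ring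
      have hz : i * F + (n + U.work) + 3 ∉ area F (2 * i) :=
        notMem_area_of_lt (i := i) (by omega) (by omega)
      have hzW : i * F + (n + U.work) + 3 < W := by
        rw [add_mul, one_mul] at hW
        omega
      have hD := loc_treeOps (oracle P s b₀) U.gates R hF (by omega) hm K R (2 * i)
        (i * F + (n + U.work) + 3) (by omega) (by omega) hz hzW hfitA
      have hT := loc_trialOps (oracle P s b₀) U.gates hi hF hW hkl (by omega) hm hp hpW hD
      have hT' := hT.mono (block_union_area_subset (by omega))
      obtain ⟨hzero, hzero'⟩ := zeroOn_trialOps (oracle P s b₀) U.gates hi hF hW hkl (by omega) hm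
        hp hpW hD hΦ
      have hcon := nm_trialOps_le U hδ hU s b₀ hi hF hW hkl hp hpW hD (ε := ε)
        (fun χ h1 h2 => (ih (k + 1) hkl (by omega) (by omega) R (2 * i) _ (by omega) hz hzW hfitA χ
          h1 h2).trans (mul_le_mul hR (nm_wrongBit_mul_le _ _ _ _ _) (nm_nonneg _) hε)) Φ hΦ hΦ'
      have hB : 2 * (i * F) + F = (2 * i + 1) * F := by ring
      rw [treeOps, hlk, runL_append, runL_append, hB, hiF2]
      set L := trialOps n (n + U.work) k (i * F) (1 + k * n) p
        (treeOps n l (n + U.work) R F K R (2 * i * F) (i * F + (n + U.work) + 3)) with hL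
      have hsmall : ∀ w < F, w ∉ area F i := fun w hw => notMem_area_of_lt (i := 0) (by omega) hi
      have hkn : k * n ≤ l * n := Nat.mul_le_mul_right n hk
      -- The exact sign depends only on the path, hence commutes with the attempt and can be placed
      -- between the attempt and its inverse. Both sides then end with the same isometry.
      have hsign : signAt s b₀ hk * Φ = runL (oracle P s b₀) U.gates (invOps L)
          (signAt s b₀ hk * runL (oracle P s b₀) U.gates L Φ) := by
        rw [← hT' _ (indepOf_signAt s b₀ hk fun w _ h2 => hsmall w (by omega)),
          (unitaryPair_runL _ _ L).inv]
      rw [hsign, ← runL_sub, nm_runL]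
      refine (ihρ (2 * i + 1) _ (by omega) (notMem_area_of_lt (i := i) (by omega) (by omega))
        (by rw [add_mul, one_mul] at hW; omega) hfitB _ hzero
        (hzero' _ (fun w hw => by have := hw.2; omega) hΦ')).trans ?_
      rw [pow_succ, ← mul_assoc 2, mul_assoc (2 * _ ^ ρ)]
      exact mul_le_mul_of_nonneg_left hcon (mul_nonneg two_pos.le (pow_nonneg hθ _))

/-- The indicator of the states in which the output wire does not hold `b₀`. -/
noncomputable def wrongOutput (b₀ : Bool) : State W := fun b => if rd b 0 = b₀ then 0 else 1

/-- The induction on attempts again, now for the root. The innermost operation copies the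
accumulator to the output wire, so the factor `2` of the sign error is absent. Undoing the attempts
leaves the output wire alone. -/
theorem nm_wrongOutput_treeOps_le (U : IdCircuit n P.m) {δ ε : ℝ} (hδ : δ ≤ 1)
    (hU : ∀ a : P.A, δ ≤ successProb P U a) (s : Secret P l) (b₀ : Bool) {R F : ℕ} (hε : 0 ≤ ε)
    (hR : 2 * (Real.sqrt (1 - δ) + ε) ^ R ≤ ε) (hF : l * n + (n + U.work) + 5 ≤ F)
    {K : ℕ} (hK : K + 1 = l) (ρ i p : ℕ) (hi : 0 < i) (hp0 : 0 < p)
    (hp : p ∉ area F i) (hpW : p < W) (hfit : Fits F i (height R (K + 1) ρ) W) (Φ : State W)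
    (hΦ : ZeroOn (area F i) Φ) (hΦ' : ZeroOn (slots n l 0) Φ) (hΦ0 : ZeroOn {0} Φ) :
    nm (wrongOutput b₀ *
      runL (oracle P s b₀) U.gates (treeOps n l (n + U.work) R F (K + 1) ρ (i * F) p) Φ) ≤
      (Real.sqrt (1 - δ) + ε) ^ ρ * nm (wrongBit s b₀ (Nat.zero_le l) p * Φ) := by
  have hθ : 0 ≤ Real.sqrt (1 - δ) + ε := add_nonneg (Real.sqrt_nonneg _) hε
  have hl : 0 < l := by omega
  have hlk : l - (K + 1) = 0 := by omega
  induction ρ generalizing i p Φ with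
  | zero =>
    rw [treeOps, hlk, midOps, if_pos rfl, runL_cons, runL_nil,
      apply_cnot _ _ hpW (by omega) (by omega), pow_zero, one_mul,
      nm_mul_comp (τ := fun b => xorAt b 0 (rd b p))
        (xorAt_involutive fun b x => by rw [rd_xorAt_of_ne _ _ (by omega)])]
    refine le_of_eq ?_
    congr 1
    funext b
    simp only [Pi.mul_apply, wrongOutput, wrongBit]
    by_cases hb : Φ b = 0
    · rw [hb, mul_zero, mul_zero]
    · rw [rd_xorAt_self _ _ (by omega), hΦ0.rd_eq_false hb rfl, Bool.false_xor]
      rfl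
  | succ ρ ihρ =>
    have hiF : F ≤ i * F := Nat.le_mul_of_pos_left F hi
    have hm := U.out_le
    have hheight : height R K R < height R (K + 1) (ρ + 1) := by
      unfold height
      rw [add_mul]
      omega
    have hfitA : Fits F (2 * i) (height R K R) W := hfit.mono hheight (by omega)
    have hfitB : Fits F (2 * i + 1) (height R (K + 1) ρ) W :=
      hfit.mono (by unfold height; omega) le_rfl
    have hW := hfit.le
    have hWA := hfitA.le
    have hiF2 : 2 * (i * F) = 2 * i * F := by ring
    have hz : i * F + (n + U.work) + 3 ∉ area F (2 * i) :=
      notMem_area_of_lt (i := i) (by omega) (by omega)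
    have hzW : i * F + (n + U.work) + 3 < W := by
      rw [add_mul, one_mul] at hW
      omega
    have hD := loc_treeOps (oracle P s b₀) U.gates R hF (by omega) hm K R (2 * i)
      (i * F + (n + U.work) + 3) (by omega) (by omega) hz hzW hfitA
    have hT := loc_trialOps (oracle P s b₀) U.gates hi hF hW hl (by omega) hm hp hpW hD
    have hT' := hT.mono (block_union_area_subset (by omega))
    obtain ⟨hzero, hzero'⟩ := zeroOn_trialOps (oracle P s b₀) U.gates hi hF hW hl (by omega) hm
      hp hpW hD hΦ
    have hcon := nm_trialOps_le U hδ hU s b₀ hi hF hW hl hp hpW hD (ε := ε)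
      (fun χ h1 h2 => (nm_treeOps_sub_le U hδ hU s b₀ hε hR hF K 1 hl (by omega) one_pos R (2 * i) _
        (by omega) hz hzW hfitA χ h1 h2).trans
        (mul_le_mul hR (nm_wrongBit_mul_le _ _ _ _ _) (nm_nonneg _) hε)) Φ hΦ hΦ'
    have hB : 2 * (i * F) + F = (2 * i + 1) * F := by ring
    rw [treeOps, hlk, runL_append, runL_append, hB, hiF2]
    set L := trialOps n (n + U.work) 0 (i * F) (1 + 0 * n) p
      (treeOps n l (n + U.work) R F K R (2 * i * F) (i * F + (n + U.work) + 3)) with hL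
    have hind : IndepOf (area F i) (wrongOutput b₀ : State W) := fun b b' hb => by
      rw [wrongOutput, wrongOutput, rd_congr hb (notMem_area_of_lt (i := 0) (by omega) hi)]
    rw [← loc_runL_invOps _ _ hT' _ hind, nm_runL]
    refine (ihρ (2 * i + 1) _ (by omega) (by omega)
      (notMem_area_of_lt (i := i) (by omega) (by omega))
      (by rw [add_mul, one_mul] at hW; omega) hfitB _ hzero
      (hzero' _ (fun w hw => by have := hw.2; omega) hΦ')
      (hzero' _ (fun w hw => by rw [Set.mem_singleton_iff.1 hw]; omega) hΦ0)).trans ?_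
    rw [pow_succ, mul_assoc]
    exact mul_le_mul_of_nonneg_left hcon (pow_nonneg hθ _)

/-- With `ε = δ / 4` and `√(1 - δ) ≤ 1 - δ / 2` the contraction factor is at most `1 - δ / 4`. The
amplitude of a wrong output is then at most `δ / 8 ≤ 1 / 8`. The root starts at heap node `1`; frame
`0` holds the output wire, the path slots and the initial `p`. -/
theorem outputProb_treeOps (U : IdCircuit n P.m) {δ : ℝ} (hδ0 : 0 < δ) (hδ : δ ≤ 1)
    (hU : ∀ a : P.A, δ ≤ successProb P U a) (hl : 0 < l) {R F : ℕ}
    (hR : 2 * (1 - δ / 4) ^ R ≤ δ / 4) (hF : F = l * n + (n + U.work) + 5)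
    (hW : W = 2 * F * 2 ^ height R l R) (s : Secret P l) (b₀ : Bool) :
    2 / 3 ≤ outputProb (runOps W (oracle P s b₀) U.gates
      (treeOps n l (n + U.work) R F l R F (1 + l * n))) b₀ := by
  have hsqrt : Real.sqrt (1 - δ) ≤ 1 - δ / 2 := by
    rw [Real.sqrt_le_left (by linarith)]
    nlinarith
  have hθ0 : 0 ≤ Real.sqrt (1 - δ) + δ / 4 := by positivity
  have hθ : (Real.sqrt (1 - δ) + δ / 4) ^ R ≤ (1 - δ / 4) ^ R :=
    pow_le_pow_left₀ hθ0 (by linarith) R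
  have hfit : Fits F 1 (height R l R) W := hW.ge
  have hFW : 2 * F ≤ W := hfit.le
  have hzero : ∀ S, ZeroOn S (zeroState W) := by
    rintro S b ⟨w, _, hb⟩
    refine Pi.single_eq_of_ne (fun h => ?_) _
    rw [h] at hb
    exact Bool.false_ne_true hb
  obtain ⟨K, rfl⟩ : ∃ K, l = K + 1 := ⟨l - 1, by omega⟩
  have hmain := nm_wrongOutput_treeOps_le (W := W) U hδ hU s b₀ (R := R) (F := F) (ε := δ / 4)
    (by positivity) (by linarith) hF.ge rfl R 1 (1 + (K + 1) * n) one_pos (by omega)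
    (notMem_area_of_lt (i := 0) (by omega) one_pos) (by omega) hfit
    (zeroState W) (hzero _) (hzero _)
    (hzero _)
  rw [one_mul] at hmain
  have hnm0 : nm (zeroState W) = 1 := by
    have : nm (zeroState W) ^ 2 = 1 := by
      rw [nm_sq, Finset.sum_eq_single (fun _ => false)]
      · simp [zeroState]
      · intro b _ hb
        simp [zeroState, hb]
      · simp
    exact (pow_eq_one_iff_of_nonneg (nm_nonneg _) two_ne_zero).1 this
  have hbad := hmain.trans (mul_le_mul_of_nonneg_left (nm_wrongBit_mul_le _ _ _ _ _)
    (by positivity))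
  rw [hnm0, mul_one] at hbad
  set Ψ := runL (oracle P s b₀) U.gates
    (treeOps n (K + 1) (n + U.work) R F (K + 1) R F (1 + (K + 1) * n)) (zeroState W) with hΨ
  have hnm : nm Ψ = 1 := by rw [hΨ, nm_runL, hnm0]
  have hsum : outputProb Ψ b₀ + nm (wrongOutput b₀ * Ψ) ^ 2 = nm Ψ ^ 2 := by
    rw [outputProb, nm_sq, nm_sq, ← Finset.sum_add_distrib]
    refine Finset.sum_congr rfl fun b _ => ?_
    have h0 : 0 < W := by omega
    have hiff : (∃ h : 0 < W, b ⟨0, h⟩ = b₀) ↔ rd b 0 = b₀ := by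
      rw [rd_of_lt b h0]
      exact ⟨fun h => h.2, fun h => ⟨h0, h⟩⟩
    simp only [hiff, Pi.mul_apply, wrongOutput]
    split <;> simp
  have hgoal : 2 / 3 ≤ outputProb Ψ b₀ := by
    have h1 : nm (wrongOutput b₀ * Ψ) ≤ 1 / 8 := by linarith
    have h2 : nm (wrongOutput b₀ * Ψ) ^ 2 ≤ (1 / 8) ^ 2 := pow_le_pow_left₀ (nm_nonneg _) h1 2
    rw [hnm] at hsum
    norm_num at h2
    linarith
  exact hgoal

end Algorithm

/-! ### The classical program that prints the operations -/

/-! ### Straight-line programs -/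

/-- Run programs one after the other. -/
def seqs : List Prog → Prog
  | [] => .const 29 0
  | [p] => p
  | p :: q :: ps => .seq p (seqs (q :: ps))

/-- The program has no branches and no loops. -/
def Prog.Straight : Prog → Prop
  | .seq p q => p.Straight ∧ q.Straight
  | .ite .. => False
  | .while .. => False
  | _ => True

/-- The memory after a straight-line program. -/
def Prog.effect : Prog → (ℕ → ℕ) → ℕ → ℕ
  | .const i c, M => Function.update M i c
  | .add i j k, M => Function.update M i (M j + M k)
  | .sub i j k, M => Function.update M i (M j - M k)
  | .load i j, M => Function.update M i (M (M j))
  | .store i j, M => Function.update M (M i) (M j)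
  | .seq p q, M => q.effect (p.effect M)
  | _, M => M

/-- The operations emitted by a straight-line program. -/
def Prog.output : Prog → (ℕ → ℕ) → List Op
  | .emit o, M => [o.map M]
  | .seq p q, M => p.output M ++ q.output (p.effect M)
  | _, _ => []

/-- The running time of a straight-line program. -/
def Prog.steps : Prog → ℕ
  | .seq p q => p.steps + q.steps
  | _ => 1

theorem Prog.Straight.exec {p : Prog} (h : p.Straight) (M : ℕ → ℕ) :
    Exec p M (p.output M) (p.effect M) p.steps := by
  induction p generalizing M with
  | const i c => exact Exec.const i c M
  | add i j k => exact Exec.add i j k M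
  | sub i j k => exact Exec.sub i j k M
  | load i j => exact Exec.load i j M
  | store i j => exact Exec.store i j M
  | emit o => exact Exec.emit o M
  | seq p q ihp ihq => exact Exec.seq (ihp h.1 M) (ihq h.2 _)
  | _ => exact h.elim

theorem Exec.congr {p : Prog} {M M' : ℕ → ℕ} {ops ops' : List Op} {t t' : ℕ}
    (h : Exec p M ops M' t) (hops : ops = ops') (ht : t = t') : Exec p M ops' M' t' :=
  hops ▸ ht ▸ h

/-! ### The program -/

/-- Load the topmost stack entry. -/
def loadEntry : Prog := seqs [.add 16 8 7, .load 10 16, .add 16 16 6, .load 11 16, .add 16 16 6,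
  .load 12 16, .add 16 16 6, .load 13 16, .add 16 16 6, .load 14 16, .add 16 16 6, .load 15 16]

/-- Compute the depth and the addresses of single wires. -/
def computeAddresses : Prog := seqs [.sub 17 3 11, .add 18 13 4, .add 19 18 6, .add 20 19 6,
  .add 21 20 6, .add 22 13 6]

/-- Emit the operation `o` for increasing values of the cells 25 and 26. -/
def loopUp (o : Op) : Prog := .seq (seqs [.add 24 0 23, .add 25 13 23, .add 26 15 23])
  (.while 24 (seqs [.emit o, .add 25 25 6, .add 26 26 6, .sub 24 24 6]))

/-- Emit the operation `o` for decreasing values of the cells 25 and 26. -/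
def loopDown (o : Op) : Prog := .seq (seqs [.add 24 0 23, .add 25 13 0, .add 26 15 0])
  (.while 24 (seqs [.sub 25 25 6, .sub 26 26 6, .emit o, .sub 24 24 6]))

/-- Remove the topmost stack entry. -/
def pop : Prog := seqs [.const 28 6, .sub 8 8 28]

/-- Push the cells 31 to 36 on the stack, after setting the first cell of the topmost entry to
`v`. -/
def push (v : ℕ) : Prog := seqs [.const 28 v, .add 16 8 7, .store 16 28, .const 28 6, .add 8 8 28,
  .add 16 8 7, .store 16 31, .add 16 16 6, .store 16 32, .add 16 16 6, .store 16 33, .add 16 16 6,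
  .store 16 34, .add 16 16 6, .store 16 35, .add 16 16 6, .store 16 36]

/-- The stack entry for a recursive call for the children of a node. -/
def childEntry : Prog := seqs [.const 31 0, .sub 32 11 6, .add 33 9 23, .add 34 13 13,
  .add 35 21 23, .add 36 15 0]

/-- The stack entry for the remaining attempts. -/
def nextEntry : Prog := seqs [.const 31 0, .add 32 11 23, .sub 33 12 6, .add 34 13 13, .add 34 34 5,
  .add 35 20 23, .add 36 15 23]

/-- An attempt is split at the recursive call for the children, and a call passes through four
stages: `pre` and a call for the children, `post` and a call for the remaining attempts, inverse of
`post` and a second call for the children, inverse of `pre` and return. Memory use: cells 0 to 9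
hold `n`, `m`, the workspace size, `l`, `N`, `F`, the constants 1 and 100, the stack height and `R`;
cells 10 to 15 hold the current stack entry (stage, remaining depth, attempts, `β`, `p`, slot
address); cells 17 to 22 hold the depth and wire addresses derived from it; cell 23 is zero; cells
31 to 36 hold the entry to be pushed; the others below 100 are scratch or unused. The stack begins
at 100. -/
def preProg : Prog := seqs [loopUp (.had 25), loopUp (.cnot 25 26)]

def preInvProg : Prog := seqs [loopDown (.cnot 25 26), loopDown (.had 25)]

def verifyProg : Prog := seqs [.emit (.sub false 13), .emit (.node 17 6 13 18), .emit (.cnot 14 20),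
  .emit (.toffoli 18 19 20), .emit (.toffoli 18 14 20)]

def verifyInvProg : Prog := seqs [.emit (.toffoli 18 14 20), .emit (.toffoli 18 19 20),
  .emit (.cnot 14 20), .emit (.node 17 6 13 18), .emit (.sub true 13)]

def postProg : Prog := .seq (loopUp (.cnot 25 26)) verifyProg

def postInvProg : Prog := .seq verifyInvProg (loopDown (.cnot 25 26))

def leafProg : Prog := seqs [.emit (.leaf 6 13), .emit (.had 22), .emit (.not 22), .emit (.had 22),
  .emit (.leaf 6 13)]

def midProg : Prog := .ite 17 (seqs [.emit (.had 14), .emit (.not 14), .emit (.had 14)])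
  (.emit (.cnot 14 23))

/-- The work at a node, depending on how many recursive calls have been completed. -/
def stageProg : Prog := .ite 10
  (.seq (.sub 27 10 6) (.ite 27
    (.seq (.sub 27 27 6) (.ite 27
      (.seq preInvProg pop)
      (.seq postInvProg (.seq childEntry (push 3)))))
    (.seq postProg (.seq nextEntry (push 2)))))
  (.seq preProg (.seq childEntry (push 1)))

/-- One step of the stack machine. -/
def mainBody : Prog := .seq (.seq loadEntry computeAddresses)
  (.ite 11 (.ite 12 stageProg (.seq midProg pop)) (.seq leafProg pop))

/-- Constants for the computation of the depth of the recursion. -/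
def setupProg (R : ℕ) : Prog := seqs [.const 6 1, .const 7 100, .const 9 R, .const 23 0, .add 4 0 2,
  .const 3 0, .const 5 0, .const 30 2, .add 24 0 6, .sub 24 24 30]

/-- Compute the depth of the recursion. -/
def depthProg : Prog := .while 24 (seqs [.add 3 3 6, .add 5 5 0, .add 30 30 30, .add 24 0 6,
  .sub 24 24 30])

/-- Compute the layout of the wires, and prepare the stack entry of the root. -/
def rootEntry : Prog := seqs [.add 35 5 6, .add 5 5 4, .const 28 5, .add 5 5 28, .const 8 0,
  .const 31 0, .add 32 3 23, .add 33 9 23, .add 34 5 23, .const 36 1]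

def initProg (R : ℕ) : Prog := .seq (setupProg R) (.seq depthProg (.seq rootEntry (push 0)))

/-- The program that prints the quantum algorithm which makes `R` attempts at each node. -/
def mainProg (R : ℕ) : Prog := .seq (initProg R) (.while 8 mainBody)

/-! ### Correctness of the program -/

/-- The cells that stay constant during the run of the stack machine. -/
structure Glob (n l N R F : ℕ) (M : ℕ → ℕ) : Prop where
  n : M 0 = n
  l : M 3 = l
  N : M 4 = N
  F : M 5 = F
  one : M 6 = 1
  hundred : M 7 = 100
  R : M 9 = R
  zero : M 23 = 0

/-- The stack entry at height `sp`. -/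
structure Entry (M : ℕ → ℕ) (sp stage K ρ β p σ : ℕ) : Prop where
  top0 : M (sp + 100) = stage
  top1 : M (sp + 101) = K
  top2 : M (sp + 102) = ρ
  top3 : M (sp + 103) = β
  top4 : M (sp + 104) = p
  top5 : M (sp + 105) = σ

theorem Glob.congr {n l N R F : ℕ} {M M' : ℕ → ℕ} (h : Glob n l N R F M)
    (hM : ∀ a, a < 8 ∨ a = 9 ∨ a = 23 → M' a = M a) : Glob n l N R F M' where
  n := by rw [hM _ (by simp), h.n]
  l := by rw [hM _ (by simp), h.l]
  N := by rw [hM _ (by simp), h.N]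
  F := by rw [hM _ (by simp), h.F]
  one := by rw [hM _ (by simp), h.one]
  hundred := by rw [hM _ (by simp), h.hundred]
  R := by rw [hM _ (by simp), h.R]
  zero := by rw [hM _ (by simp), h.zero]

/-- The cells that hold the current stack entry and the addresses computed from it. -/
structure Loaded (l N stage K ρ β p σ : ℕ) (M : ℕ → ℕ) : Prop where
  cstage : M 10 = stage
  cK : M 11 = K
  cρ : M 12 = ρ
  cβ : M 13 = β
  cp : M 14 = p
  cσ : M 15 = σ
  depth : M 17 = l - K
  ok : M 18 = β + N
  v : M 19 = β + N + 1
  acc : M 20 = β + N + 2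
  z : M 21 = β + N + 3
  sign : M 22 = β + 1

theorem Loaded.congr {l N stage K ρ β p σ : ℕ} {M M' : ℕ → ℕ}
    (h : Loaded l N stage K ρ β p σ M) (hM : ∀ a, 10 ≤ a → a < 23 → a ≠ 16 → M' a = M a) :
    Loaded l N stage K ρ β p σ M' where
  cstage := by rw [hM _ (by simp) (by simp) (by simp), h.cstage]
  cK := by rw [hM _ (by simp) (by simp) (by simp), h.cK]
  cρ := by rw [hM _ (by simp) (by simp) (by simp), h.cρ]
  cβ := by rw [hM _ (by simp) (by simp) (by simp), h.cβ]
  cp := by rw [hM _ (by simp) (by simp) (by simp), h.cp]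
  cσ := by rw [hM _ (by simp) (by simp) (by simp), h.cσ]
  depth := by rw [hM _ (by simp) (by simp) (by simp), h.depth]
  ok := by rw [hM _ (by simp) (by simp) (by simp), h.ok]
  v := by rw [hM _ (by simp) (by simp) (by simp), h.v]
  acc := by rw [hM _ (by simp) (by simp) (by simp), h.acc]
  z := by rw [hM _ (by simp) (by simp) (by simp), h.z]
  sign := by rw [hM _ (by simp) (by simp) (by simp), h.sign]

/-! ### Running the building blocks of the program -/

section Exec

variable {n l N R F : ℕ}

theorem exec_prologue {M : ℕ → ℕ} (hG : Glob n l N R F M) {sp stage K ρ β p σ : ℕ}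
    (hsp : M 8 = sp) (hE : Entry M sp stage K ρ β p σ) :
    ∃ M', Exec (.seq loadEntry computeAddresses) M [] M' 18 ∧ Loaded l N stage K ρ β p σ M' ∧
      ∀ a, a < 10 ∨ 23 ≤ a → M' a = M a := by
  refine ⟨_, Prog.Straight.exec (p := .seq loadEntry computeAddresses) ?_ M, ?_, ?_⟩
  · simp [loadEntry, computeAddresses, seqs, Prog.Straight]
  · constructor <;>
    simp [loadEntry, computeAddresses, seqs, Prog.effect, hsp, hG.hundred,
      hG.one, hG.N, hG.l, hE.top0, hE.top1, hE.top2, hE.top3, hE.top4, hE.top5]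
  · intro a ha
    have h1 : ∀ c, 10 ≤ c → c < 23 → a ≠ c := by omega
    simp [loadEntry, computeAddresses, seqs, Prog.effect, h1]

theorem exec_push {M : ℕ → ℕ} (h6 : M 6 = 1) (h7 : M 7 = 100) {sp : ℕ} (hsp : M 8 = sp) (v : ℕ) :
    ∃ M', Exec (push v) M [] M' 17 ∧ M' 8 = sp + 6 ∧ M' (sp + 100) = v ∧
      Entry M' (sp + 6) (M 31) (M 32) (M 33) (M 34) (M 35) (M 36) ∧
      (∀ a, a < 100 → a ≠ 8 → a ≠ 16 → a ≠ 28 → M' a = M a) ∧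
      ∀ a, 100 ≤ a → a ≠ sp + 100 → a < sp + 106 → M' a = M a := by
  refine ⟨_, Prog.Straight.exec (p := push v) ?_ M, ?_, ?_, ?_, ?_, ?_⟩
  · simp [push, seqs, Prog.Straight]
  · simp [push, seqs, Prog.effect, hsp, h6, h7]
  · simp [push, seqs, Prog.effect, hsp, h6, h7]
  · constructor <;>
    simp [push, seqs, Prog.effect, hsp, h6, h7]
  · intro a ha h8 h16 h28
    have h1 : ∀ c, 100 ≤ c → a ≠ c := by omega
    simp [push, seqs, Prog.effect, hsp, h6, h7, h8, h16, h28, h1]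
  · intro a ha h100 h106
    have h1 : ∀ c, c < 100 → a ≠ c := by omega
    simp [push, seqs, Prog.effect, Function.update_apply, hsp, h6, h7, h1]
    repeat rw [if_neg (by omega)]

theorem exec_pop {M : ℕ → ℕ} {sp : ℕ} (hsp : M 8 = sp) :
    ∃ M', Exec pop M [] M' 2 ∧ M' 8 = sp - 6 ∧ ∀ a, a ≠ 8 → a ≠ 28 → M' a = M a := by
  refine ⟨_, Prog.Straight.exec (p := pop) ?_ M, ?_, ?_⟩
  · simp [pop, seqs, Prog.Straight]
  · simp [pop, seqs, Prog.effect, hsp]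
  · intro a h8 h28
    simp [pop, seqs, Prog.effect, h8, h28]

/-- The function `g` expresses the emitted operation through the two running addresses; a Hadamard
gate ignores the second. -/
theorem exec_loopUp {o : Op} {g : ℕ → ℕ → Op} (ho : ∀ M, o.map M = g (M 25) (M 26)) {M : ℕ → ℕ}
    (hG : Glob n l N R F M) {β σ : ℕ} (hβ : M 13 = β) (hσ : M 15 = σ) :
    ∃ M', Exec (loopUp o) M ((List.range n).map fun j => g (β + j) (σ + j)) M' (5 * n + 4) ∧
      ∀ a, a < 24 ∨ 27 ≤ a → M' a = M a := by
  have key : ∀ (j a b : ℕ) (M : ℕ → ℕ), M 6 = 1 → M 24 = j → M 25 = a → M 26 = b →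
      ∃ M', Exec (.while 24 (seqs [.emit o, .add 25 25 6, .add 26 26 6, .sub 24 24 6])) M
        ((List.range j).map fun i => g (a + i) (b + i)) M' (5 * j + 1) ∧
        ∀ a, a < 24 ∨ 27 ≤ a → M' a = M a := by
    intro j
    induction j with
    | zero => exact fun a b M _ h _ _ => ⟨M, Exec.while_done h, fun _ _ => rfl⟩
    | succ j ih =>
      intro a b M h6 h24 h25 h26
      obtain ⟨M', hM', hk⟩ := ih (a + 1) (b + 1)
        ((seqs [.emit o, .add 25 25 6, .add 26 26 6, .sub 24 24 6]).effect M)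
        (by simp [seqs, Prog.effect, h6]) (by simp [seqs, Prog.effect, h6, h24])
        (by simp [seqs, Prog.effect, h6, h25]) (by simp [seqs, Prog.effect, h6, h26])
      refine ⟨M', ?_, fun c hc => ?_⟩
      · convert Exec.while_step (by omega : M 24 ≠ 0)
          (Prog.Straight.exec (p := seqs [.emit o, .add 25 25 6, .add 26 26 6, .sub 24 24 6])
            (by simp [seqs, Prog.Straight]) M) hM' using 1
        · simp [List.range_succ_eq_map, seqs, Prog.output, ho, h25, h26, add_assoc, add_comm 1,
            Function.comp_def]
        · simp [seqs, Prog.steps]; ring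
      · have h1 : ∀ d, 24 ≤ d → d < 27 → c ≠ d := by omega
        rw [hk c hc]
        simp [seqs, Prog.effect, h1]
  obtain ⟨M', hM', hk⟩ := key n β σ ((seqs [.add 24 0 23, .add 25 13 23, .add 26 15 23]).effect M)
    (by simp [seqs, Prog.effect, hG.one]) (by simp [seqs, Prog.effect, hG.n, hG.zero])
    (by simp [seqs, Prog.effect, hβ, hG.zero]) (by simp [seqs, Prog.effect, hσ, hG.zero])
  refine ⟨M', ?_, fun c hc => ?_⟩
  · exact (Exec.seq (Prog.Straight.exec (p := seqs [.add 24 0 23, .add 25 13 23, .add 26 15 23])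
      (by simp [seqs, Prog.Straight]) M) hM').congr rfl (by simp [seqs, Prog.steps]; ring)
  · have h1 : ∀ d, 24 ≤ d → d < 27 → c ≠ d := by omega
    rw [hk c hc]
    simp [seqs, Prog.effect, h1]

/-- Counting down prints the reversed list. For the self-inverse gates in question this is the
inverse sequence. -/
theorem exec_loopDown {o : Op} {g : ℕ → ℕ → Op} (ho : ∀ M, o.map M = g (M 25) (M 26)) {M : ℕ → ℕ}
    (hG : Glob n l N R F M) {β σ : ℕ} (hβ : M 13 = β) (hσ : M 15 = σ) :
    ∃ M', Exec (loopDown o) M ((List.range n).map fun j => g (β + j) (σ + j)).reverse M'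
        (5 * n + 4) ∧
      ∀ a, a < 24 ∨ 27 ≤ a → M' a = M a := by
  have key : ∀ (j : ℕ) (M : ℕ → ℕ), M 6 = 1 → M 24 = j → M 25 = β + j → M 26 = σ + j →
      ∃ M', Exec (.while 24 (seqs [.sub 25 25 6, .sub 26 26 6, .emit o, .sub 24 24 6])) M
        ((List.range j).map fun i => g (β + i) (σ + i)).reverse M' (5 * j + 1) ∧
        ∀ a, a < 24 ∨ 27 ≤ a → M' a = M a := by
    intro j
    induction j with
    | zero => exact fun M _ h _ _ => ⟨M, Exec.while_done h, fun _ _ => rfl⟩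
    | succ j ih =>
      intro M h6 h24 h25 h26
      obtain ⟨M', hM', hk⟩ := ih
        ((seqs [.sub 25 25 6, .sub 26 26 6, .emit o, .sub 24 24 6]).effect M)
        (by simp [seqs, Prog.effect, h6]) (by simp [seqs, Prog.effect, h6, h24])
        (by simp [seqs, Prog.effect, h6, h25]) (by simp [seqs, Prog.effect, h6, h26])
      refine ⟨M', ?_, fun c hc => ?_⟩
      · convert Exec.while_step (by omega : M 24 ≠ 0)
          (Prog.Straight.exec (p := seqs [.sub 25 25 6, .sub 26 26 6, .emit o, .sub 24 24 6])
            (by simp [seqs, Prog.Straight]) M) hM' using 1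
        · simp [List.range_succ, seqs, Prog.output, Prog.effect, ho, h6, h25, h26]
        · simp [seqs, Prog.steps]; ring
      · have h1 : ∀ d, 24 ≤ d → d < 27 → c ≠ d := by omega
        rw [hk c hc]
        simp [seqs, Prog.effect, h1]
  obtain ⟨M', hM', hk⟩ := key n ((seqs [.add 24 0 23, .add 25 13 0, .add 26 15 0]).effect M)
    (by simp [seqs, Prog.effect, hG.one]) (by simp [seqs, Prog.effect, hG.n, hG.zero])
    (by simp [seqs, Prog.effect, hβ, hG.n]) (by simp [seqs, Prog.effect, hσ, hG.n])
  refine ⟨M', ?_, fun c hc => ?_⟩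
  · exact (Exec.seq (Prog.Straight.exec (p := seqs [.add 24 0 23, .add 25 13 0, .add 26 15 0])
      (by simp [seqs, Prog.Straight]) M) hM').congr rfl (by simp [seqs, Prog.steps]; ring)
  · have h1 : ∀ d, 24 ≤ d → d < 27 → c ≠ d := by omega
    rw [hk c hc]
    simp [seqs, Prog.effect, h1]

end Exec

/-! ### Steps of the stack machine and the recursion -/

section Exec

variable {n l N R F : ℕ}

/-- The gates before the first recursive call. -/
def preOps (n β σ : ℕ) : List Op := hadOps β n ++ copyOps β σ n

/-- The gates between the first and the second recursive call. -/
def postOps (n N k β σ p : ℕ) : List Op := copyOps β σ n ++ [.sub false β] ++ verifyOps N k β p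

theorem exec_preProg {M : ℕ → ℕ} (hG : Glob n l N R F M) {β σ : ℕ} (hβ : M 13 = β)
    (hσ : M 15 = σ) :
    ∃ M', Exec preProg M (preOps n β σ) M' (10 * n + 8) ∧ ∀ a, a < 24 ∨ 27 ≤ a → M' a = M a := by
  obtain ⟨M₁, h1, hk1⟩ := exec_loopUp (o := .had 25) (g := fun a _ => .had a) (fun _ => rfl) hG
    hβ hσ
  have hG1 : Glob n l N R F M₁ := hG.congr fun a ha => hk1 a (by omega)
  obtain ⟨M₂, h2, hk2⟩ := exec_loopUp (o := .cnot 25 26) (g := .cnot) (fun _ => rfl) hG1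
    ((hk1 13 (by simp)).trans hβ) ((hk1 15 (by simp)).trans hσ)
  exact ⟨M₂, (h1.seq h2).congr rfl (by ring), fun a ha => (hk2 a ha).trans (hk1 a ha)⟩

theorem exec_preInvProg {M : ℕ → ℕ} (hG : Glob n l N R F M) {β σ : ℕ} (hβ : M 13 = β)
    (hσ : M 15 = σ) :
    ∃ M', Exec preInvProg M (invOps (preOps n β σ)) M' (10 * n + 8) ∧
      ∀ a, a < 24 ∨ 27 ≤ a → M' a = M a := by
  obtain ⟨M₁, h1, hk1⟩ := exec_loopDown (o := .cnot 25 26) (g := .cnot) (fun _ => rfl) hG hβ hσ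
  have hG1 : Glob n l N R F M₁ := hG.congr fun a ha => hk1 a (by omega)
  obtain ⟨M₂, h2, hk2⟩ := exec_loopDown (o := .had 25) (g := fun a _ => .had a) (fun _ => rfl) hG1
    ((hk1 13 (by simp)).trans hβ) ((hk1 15 (by simp)).trans hσ)
  refine ⟨M₂, (h1.seq h2).congr ?_ (by ring), fun a ha => (hk2 a ha).trans (hk1 a ha)⟩
  simp [preOps, invOps, hadOps, copyOps, Op.inv, Function.comp_def]

theorem exec_postProg {M : ℕ → ℕ} (hG : Glob n l N R F M) {stage K ρ β p σ : ℕ}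
    (hL : Loaded l N stage K ρ β p σ M) :
    ∃ M', Exec postProg M (postOps n N (l - K) β σ p) M'
      (5 * n + 9) ∧ ∀ a, a < 24 ∨ 27 ≤ a → M' a = M a := by
  obtain ⟨M₁, h1, hk1⟩ := exec_loopUp (o := .cnot 25 26) (g := .cnot) (fun _ => rfl) hG hL.cβ hL.cσ
  have hG1 : Glob n l N R F M₁ := hG.congr fun a ha => hk1 a (by omega)
  have hL1 := hL.congr fun a _ h _ => hk1 a (by omega)
  refine ⟨M₁, (h1.seq (Prog.Straight.exec (p := verifyProg) ?_ M₁)).congr ?_ ?_, hk1⟩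
  · simp [verifyProg, seqs, Prog.Straight]
  · simp [verifyProg, seqs, Prog.output, postOps, copyOps, verifyOps, Prog.effect, Op.map,
      hL1.cβ, hL1.cp, hL1.depth, hL1.ok, hL1.v, hL1.acc, hG1.one]
  · simp [verifyProg, seqs, Prog.steps]

theorem exec_postInvProg {M : ℕ → ℕ} (hG : Glob n l N R F M) {stage K ρ β p σ : ℕ}
    (hL : Loaded l N stage K ρ β p σ M) :
    ∃ M', Exec postInvProg M
      (invOps (postOps n N (l - K) β σ p)) M' (5 * n + 9) ∧ ∀ a, a < 24 ∨ 27 ≤ a → M' a = M a := by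
  obtain ⟨M₁, h1, hk1⟩ := exec_loopDown (o := .cnot 25 26) (g := .cnot) (fun _ => rfl) hG
    hL.cβ hL.cσ
  refine ⟨M₁, ((Prog.Straight.exec (p := verifyInvProg) ?_ M).seq h1).congr ?_ ?_, hk1⟩
  · simp [verifyInvProg, seqs, Prog.Straight]
  · simp [verifyInvProg, seqs, Prog.output, postOps, copyOps, verifyOps, Prog.effect, Op.map,
      invOps, Op.inv, Function.comp_def, hL.cβ, hL.cp, hL.depth, hL.ok, hL.v, hL.acc, hG.one]
  · simp [verifyInvProg, seqs, Prog.steps]; ring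

/-- The situation in which the stack has height `sp` and topmost entry `(stage, K, ρ, β, p, σ)`. -/
structure Top (n l N R F : ℕ) (M : ℕ → ℕ) (sp stage K ρ β p σ : ℕ) : Prop where
  glob : Glob n l N R F M
  height : M 8 = sp
  entry : Entry M sp stage K ρ β p σ

/-- A step of the stack machine that starts at height `sp` and ends by pushing an entry, after
replacing the first cell of the topmost one by `v`. -/
structure Pushed (n l N R F : ℕ) (M : ℕ → ℕ) (sp v : ℕ) (M' : ℕ → ℕ) (K ρ β p σ : ℕ) : Prop where
  top : Top n l N R F M' (sp + 6) 0 K ρ β p σ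
  stage : M' (sp + 100) = v
  keep : ∀ a, 100 ≤ a → a ≠ sp + 100 → a < sp + 106 → M' a = M a

/-- A step of the stack machine that starts at height `sp` and ends by removing the topmost
entry. -/
structure Popped (n l N R F : ℕ) (M : ℕ → ℕ) (sp : ℕ) (M' : ℕ → ℕ) : Prop where
  glob : Glob n l N R F M'
  height : M' 8 = sp - 6
  keep : ∀ a, 100 ≤ a → a < sp + 100 → M' a = M a

theorem exec_pop' {M : ℕ → ℕ} (hG : Glob n l N R F M) {sp : ℕ} (hsp : M 8 = sp) :
    ∃ M', Exec pop M [] M' 2 ∧ Popped n l N R F M sp M' := by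
  obtain ⟨M', h, h8, hk⟩ := exec_pop hsp
  exact ⟨M', h, hG.congr fun a ha => hk a (by omega) (by omega), h8,
    fun a ha _ => hk a (by omega) (by omega)⟩

theorem exec_childPush {M : ℕ → ℕ} (hG : Glob n l N R F M) {sp stage K ρ β p σ : ℕ}
    (hL : Loaded l N stage (K + 1) ρ β p σ M) (hsp : M 8 = sp) (v : ℕ) :
    ∃ M', Exec (.seq childEntry (push v)) M [] M' 23 ∧
      Pushed n l N R F M sp v M' K R (2 * β) (β + N + 3) (σ + n) := by
  have hk1 : ∀ a, a < 31 ∨ 37 ≤ a → childEntry.effect M a = M a := by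
    intro a ha
    have h1 : ∀ d, 31 ≤ d → d < 37 → a ≠ d := by omega
    simp [childEntry, seqs, Prog.effect, h1]
  have hG1 : Glob n l N R F (childEntry.effect M) := hG.congr fun a ha => hk1 a (by omega)
  obtain ⟨M', h, h8, hs, hE, hlow, hhigh⟩ := exec_push hG1.one hG1.hundred
    ((hk1 8 (by simp)).trans hsp) v
  refine ⟨M', ((Prog.Straight.exec (p := childEntry) ?_ M).seq h).congr ?_ ?_, ⟨?_, h8, ?_⟩, hs, ?_⟩
  · simp [childEntry, seqs, Prog.Straight]
  · simp [childEntry, seqs, Prog.output]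
  · simp [childEntry, seqs, Prog.steps]
  · exact hG1.congr fun a ha => hlow a (by omega) (by omega) (by omega) (by omega)
  · convert hE using 1 <;>
    simp [childEntry, seqs, Prog.effect, hG.one, hG.zero, hG.R, hG.n, hL.cK, hL.cβ, hL.z, hL.cσ]
    ring
  · exact fun a h1 h2 h3 => (hhigh a h1 h2 h3).trans (hk1 a (by omega))

theorem exec_nextPush {M : ℕ → ℕ} (hG : Glob n l N R F M) {sp stage K ρ β p σ : ℕ}
    (hL : Loaded l N stage K (ρ + 1) β p σ M) (hsp : M 8 = sp) (v : ℕ) :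
    ∃ M', Exec (.seq nextEntry (push v)) M [] M' 24 ∧
      Pushed n l N R F M sp v M' K ρ (2 * β + F) (β + N + 2) σ := by
  have hk1 : ∀ a, a < 31 ∨ 37 ≤ a → nextEntry.effect M a = M a := by
    intro a ha
    have h1 : ∀ d, 31 ≤ d → d < 37 → a ≠ d := by omega
    simp [nextEntry, seqs, Prog.effect, h1]
  have hG1 : Glob n l N R F (nextEntry.effect M) := hG.congr fun a ha => hk1 a (by omega)
  obtain ⟨M', h, h8, hs, hE, hlow, hhigh⟩ := exec_push hG1.one hG1.hundred
    ((hk1 8 (by simp)).trans hsp) v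
  refine ⟨M', ((Prog.Straight.exec (p := nextEntry) ?_ M).seq h).congr ?_ ?_, ⟨?_, h8, ?_⟩, hs, ?_⟩
  · simp [nextEntry, seqs, Prog.Straight]
  · simp [nextEntry, seqs, Prog.output]
  · simp [nextEntry, seqs, Prog.steps]
  · exact hG1.congr fun a ha => hlow a (by omega) (by omega) (by omega) (by omega)
  · convert hE using 1 <;>
    simp [nextEntry, seqs, Prog.effect, hG.one, hG.zero, hG.F, hL.cK, hL.cρ, hL.cβ, hL.acc, hL.cσ]
    ring
  · exact fun a h1 h2 h3 => (hhigh a h1 h2 h3).trans (hk1 a (by omega))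

/-- One step of the stack machine takes time less than `stepTime n`. -/
def stepTime (n : ℕ) : ℕ := 10 * n + 60

theorem exec_mainBody {M : ℕ → ℕ} {sp stage K ρ β p σ : ℕ} (hT : Top n l N R F M sp stage K ρ β p σ)
    {ops : List Op} {Q : (ℕ → ℕ) → Prop}
    (h : ∀ M₁, Glob n l N R F M₁ → M₁ 8 = sp → Loaded l N stage K ρ β p σ M₁ →
      (∀ a, 100 ≤ a → M₁ a = M a) → ∃ M' t, t + 20 ≤ stepTime n ∧
        Exec (.ite 11 (.ite 12 stageProg (.seq midProg pop)) (.seq leafProg pop)) M₁ ops M' t ∧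
          Q M') :
    ∃ M' t, t + 1 ≤ stepTime n ∧ Exec mainBody M ops M' t ∧ Q M' := by
  obtain ⟨M₁, h1, hL, hk⟩ := exec_prologue hT.glob hT.height hT.entry
  obtain ⟨M', t, ht, h2, hQ⟩ := h M₁ (hT.glob.congr fun a ha => hk a (by omega))
    ((hk 8 (by simp)).trans hT.height) hL fun a ha => hk a (by omega)
  exact ⟨M', 18 + t, by omega, h1.seq h2, hQ⟩

theorem Popped.congr {M M₁ M' : ℕ → ℕ} {sp : ℕ} (h : Popped n l N R F M₁ sp M')
    (hk : ∀ a, 100 ≤ a → M₁ a = M a) : Popped n l N R F M sp M' :=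
  ⟨h.glob, h.height, fun a h1 h2 => (h.keep a h1 h2).trans (hk a h1)⟩

theorem Pushed.congr {M M₁ M' : ℕ → ℕ} {sp v K ρ β p σ : ℕ}
    (h : Pushed n l N R F M₁ sp v M' K ρ β p σ) (hk : ∀ a, 100 ≤ a → M₁ a = M a) :
    Pushed n l N R F M sp v M' K ρ β p σ :=
  ⟨h.top, h.stage, fun a h1 h2 h3 => (h.keep a h1 h2 h3).trans (hk a h1)⟩

theorem step_leaf {M : ℕ → ℕ} {sp stage ρ β p σ : ℕ} (hT : Top n l N R F M sp stage 0 ρ β p σ) :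
    ∃ M' t, t + 1 ≤ stepTime n ∧ Exec mainBody M (leafOps β) M' t ∧ Popped n l N R F M sp M' := by
  refine exec_mainBody hT fun M₁ hG hsp hL hk => ?_
  obtain ⟨M', h, hP⟩ := exec_pop' hG hsp
  refine ⟨M', 8, by rw [stepTime]; omega, .ite_false hL.cK (((Prog.Straight.exec (p := leafProg)
    ?_ M₁).seq h).congr ?_ rfl), hP.congr hk⟩
  · simp [leafProg, seqs, Prog.Straight]
  · simp [leafProg, seqs, Prog.output, leafOps, Op.map, Prog.effect, hG.one, hL.cβ, hL.sign]

theorem step_mid {M : ℕ → ℕ} {sp stage K β p σ : ℕ}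
    (hT : Top n l N R F M sp stage (K + 1) 0 β p σ) :
    ∃ M' t, t + 1 ≤ stepTime n ∧ Exec mainBody M (midOps (l - (K + 1)) p) M' t ∧
      Popped n l N R F M sp M' := by
  refine exec_mainBody hT fun M₁ hG hsp hL hk => ?_
  obtain ⟨M', h, hP⟩ := exec_pop' hG hsp
  have h11 : M₁ 11 ≠ 0 := by simp [hL.cK]
  by_cases hlK : l - (K + 1) = 0
  · refine ⟨M', _, ?_, .ite_true h11 (.ite_false hL.cρ ((Exec.seq (.ite_false (hL.depth.trans hlK)
      (.emit _ _)) h).congr ?_ rfl)), hP.congr hk⟩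
    · simp [stepTime]
    · simp [midOps, hlK, Op.map, hL.cp, hG.zero]
  · have h17 : M₁ 17 ≠ 0 := by rwa [hL.depth]
    refine ⟨M', _, ?_, .ite_true h11 (.ite_false hL.cρ ((Exec.seq (.ite_true h17
      (Prog.Straight.exec ?_ M₁)) h).congr ?_ rfl)), hP.congr hk⟩
    · simp [stepTime, seqs, Prog.steps]
    · simp [seqs, Prog.Straight]
    · simp [midOps, hlK, Op.map, hL.cp, seqs, Prog.output, Prog.effect]

theorem step_zero {M : ℕ → ℕ} {sp K ρ β p σ : ℕ}
    (hT : Top n l N R F M sp 0 (K + 1) (ρ + 1) β p σ) :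
    ∃ M' t, t + 1 ≤ stepTime n ∧ Exec mainBody M (preOps n β σ) M' t ∧
      Pushed n l N R F M sp 1 M' K R (2 * β) (β + N + 3) (σ + n) := by
  refine exec_mainBody hT fun M₁ hG hsp hL hk => ?_
  obtain ⟨M₂, h2, hk2⟩ := exec_preProg hG hL.cβ hL.cσ
  obtain ⟨M', h, hP⟩ := exec_childPush (hG.congr fun a ha => hk2 a (by omega))
    (hL.congr fun a _ ha _ => hk2 a (by omega)) ((hk2 8 (by simp)).trans hsp) 1
  refine ⟨M', _, ?_, .ite_true (by simp [hL.cK]) (.ite_true (by simp [hL.cρ]) (.ite_false hL.cstage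
    ((h2.seq h).congr (by simp) rfl))), hP.congr fun a ha => (hk2 a (by omega)).trans (hk a ha)⟩
  rw [stepTime]; omega

theorem step_one {M : ℕ → ℕ} {sp K ρ β p σ : ℕ}
    (hT : Top n l N R F M sp 1 (K + 1) (ρ + 1) β p σ) :
    ∃ M' t, t + 1 ≤ stepTime n ∧ Exec mainBody M (postOps n N (l - (K + 1)) β σ p) M' t ∧
      Pushed n l N R F M sp 2 M' (K + 1) ρ (2 * β + F) (β + N + 2) σ := by
  refine exec_mainBody hT fun M₁ hG hsp hL hk => ?_
  have hk' : ∀ a, a ≠ 27 → Function.update M₁ 27 (M₁ 10 - M₁ 6) a = M₁ a := fun a ha => by simp [ha]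
  have hG' := hG.congr fun a ha => hk' a (by omega)
  have hL' := hL.congr fun a _ ha _ => hk' a (by omega)
  obtain ⟨M₂, h2, hk2⟩ := exec_postProg hG' hL'
  obtain ⟨M', h, hP⟩ := exec_nextPush (hG'.congr fun a ha => hk2 a (by omega))
    (hL'.congr fun a _ ha _ => hk2 a (by omega)) ((hk2 8 (by simp)).trans hsp) 2
  refine ⟨M', _, ?_, .ite_true (by simp [hL.cK]) (.ite_true (by simp [hL.cρ])
    (.ite_true (by simp [hL.cstage]) ((Exec.seq (.sub 27 10 6 M₁) (.ite_false
      (by simp [hL.cstage, hG.one]) (h2.seq h))).congr (by simp) rfl))),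
    hP.congr fun a ha => (hk2 a (by omega)).trans ((hk' a (by omega)).trans (hk a ha))⟩
  rw [stepTime]; omega

theorem step_two {M : ℕ → ℕ} {sp K ρ β p σ : ℕ}
    (hT : Top n l N R F M sp 2 (K + 1) (ρ + 1) β p σ) :
    ∃ M' t, t + 1 ≤ stepTime n ∧ Exec mainBody M (invOps (postOps n N (l - (K + 1)) β σ p)) M' t ∧
      Pushed n l N R F M sp 3 M' K R (2 * β) (β + N + 3) (σ + n) := by
  refine exec_mainBody hT fun M₁ hG hsp hL hk => ?_
  set M₀ := Function.update (Function.update M₁ 27 (M₁ 10 - M₁ 6)) 27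
    (Function.update M₁ 27 (M₁ 10 - M₁ 6) 27 - Function.update M₁ 27 (M₁ 10 - M₁ 6) 6) with hM₀
  have hk' : ∀ a, a ≠ 27 → M₀ a = M₁ a := fun a ha => by simp [hM₀, ha]
  have hG' := hG.congr fun a ha => hk' a (by omega)
  have hL' := hL.congr fun a _ ha _ => hk' a (by omega)
  obtain ⟨M₂, h2, hk2⟩ := exec_postInvProg hG' hL'
  obtain ⟨M', h, hP⟩ := exec_childPush (hG'.congr fun a ha => hk2 a (by omega))
    (hL'.congr fun a _ ha _ => hk2 a (by omega))
    ((hk2 8 (by simp)).trans ((hk' 8 (by simp)).trans hsp)) 3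
  refine ⟨M', _, ?_, .ite_true (by simp [hL.cK]) (.ite_true (by simp [hL.cρ])
    (.ite_true (by simp [hL.cstage]) ((Exec.seq (.sub 27 10 6 M₁) (.ite_true
      (by simp [hL.cstage, hG.one]) (.seq (.sub 27 27 6 _) (.ite_false
        (by simp [hL.cstage, hG.one]) (h2.seq h))))).congr (by simp) rfl))),
    hP.congr fun a ha => (hk2 a (by omega)).trans ((hk' a (by omega)).trans (hk a ha))⟩
  rw [stepTime]; omega

theorem step_three {M : ℕ → ℕ} {sp K ρ β p σ : ℕ}
    (hT : Top n l N R F M sp 3 (K + 1) (ρ + 1) β p σ) :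
    ∃ M' t, t + 1 ≤ stepTime n ∧ Exec mainBody M (invOps (preOps n β σ)) M' t ∧
      Popped n l N R F M sp M' := by
  refine exec_mainBody hT fun M₁ hG hsp hL hk => ?_
  set M₀ := Function.update (Function.update M₁ 27 (M₁ 10 - M₁ 6)) 27
    (Function.update M₁ 27 (M₁ 10 - M₁ 6) 27 - Function.update M₁ 27 (M₁ 10 - M₁ 6) 6) with hM₀
  have hk' : ∀ a, a ≠ 27 → M₀ a = M₁ a := fun a ha => by simp [hM₀, ha]
  have hG' := hG.congr fun a ha => hk' a (by omega)
  have hL' := hL.congr fun a _ ha _ => hk' a (by omega)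
  obtain ⟨M₂, h2, hk2⟩ := exec_preInvProg hG' hL'.cβ hL'.cσ
  obtain ⟨M', h, hP⟩ := exec_pop' (hG'.congr fun a ha => hk2 a (by omega))
    ((hk2 8 (by simp)).trans ((hk' 8 (by simp)).trans hsp))
  refine ⟨M', _, ?_, .ite_true (by simp [hL.cK]) (.ite_true (by simp [hL.cρ])
    (.ite_true (by simp [hL.cstage]) ((Exec.seq (.sub 27 10 6 M₁) (.ite_true
      (by simp [hL.cstage, hG.one]) (.seq (.sub 27 27 6 _) (.ite_true
        (by simp [hL.cstage, hG.one]) (h2.seq h))))).congr (by simp) rfl))),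
    hP.congr fun a ha => (hk2 a (by omega)).trans ((hk' a (by omega)).trans (hk a ha))⟩
  rw [stepTime]; omega

/-- The loop with body `p` gets from memory `M` to `M'`, emitting `ops`, in time at most `T`. -/
def Reach (p : Prog) (M : ℕ → ℕ) (ops : List Op) (M' : ℕ → ℕ) (T : ℕ) : Prop :=
  ∀ ops₂ M₂ t₂, Exec (.while 8 p) M' ops₂ M₂ t₂ →
    ∃ t ≤ T + t₂, Exec (.while 8 p) M (ops ++ ops₂) M₂ t

theorem Reach.step {p : Prog} {M M' : ℕ → ℕ} {ops : List Op} {t T : ℕ} (h8 : M 8 ≠ 0)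
    (h : Exec p M ops M' t) (ht : t + 1 ≤ T) : Reach p M ops M' T :=
  fun _ _ t₂ h₂ => ⟨t + t₂ + 1, by omega, .while_step h8 h h₂⟩

theorem Reach.trans {p : Prog} {M M₁ M' : ℕ → ℕ} {ops ops₁ : List Op} {T T₁ : ℕ}
    (h : Reach p M ops M₁ T) (h₁ : Reach p M₁ ops₁ M' T₁) :
    Reach p M (ops ++ ops₁) M' (T + T₁) := by
  intro ops₂ M₂ t₂ h₂
  obtain ⟨t₃, ht₃, h₃⟩ := h₁ _ _ _ h₂
  obtain ⟨t₄, ht₄, h₄⟩ := h _ _ _ h₃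
  exact ⟨t₄, by omega, List.append_assoc .. ▸ h₄⟩

/-- The entry below a finished call. -/
theorem Top.of_return {M M₁ M₂ : ℕ → ℕ} {sp stage v K ρ β p σ K' ρ' β' p' σ' : ℕ}
    (hT : Top n l N R F M sp stage K ρ β p σ)
    (h1 : Pushed n l N R F M sp v M₁ K' ρ' β' p' σ') (h2 : Popped n l N R F M₁ (sp + 6) M₂) :
    Top n l N R F M₂ sp v K ρ β p σ where
  glob := h2.glob
  height := h2.height
  entry := {
    top0 := by rw [h2.keep _ (by omega) (by omega), h1.stage]
    top1 := by rw [h2.keep _ (by omega) (by omega), h1.keep _ (by omega) (by omega) (by omega),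
      hT.entry.top1]
    top2 := by rw [h2.keep _ (by omega) (by omega), h1.keep _ (by omega) (by omega) (by omega),
      hT.entry.top2]
    top3 := by rw [h2.keep _ (by omega) (by omega), h1.keep _ (by omega) (by omega) (by omega),
      hT.entry.top3]
    top4 := by rw [h2.keep _ (by omega) (by omega), h1.keep _ (by omega) (by omega) (by omega),
      hT.entry.top4]
    top5 := by rw [h2.keep _ (by omega) (by omega), h1.keep _ (by omega) (by omega) (by omega),
      hT.entry.top5] }

/-- Undoing an attempt contains the same recursive call `D` and not its inverse, so one kind of
stack entry serves both calls for the children. -/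
theorem invOps_trialOps (n N k β σ p : ℕ) {D : List Op} (hD : invOps D = D) :
    invOps (trialOps n N k β σ p D) =
      invOps (postOps n N k β σ p) ++ D ++ invOps (preOps n β σ) := by
  rw [trialOps, ← preOps, ← postOps, invOps_append, invOps_append, hD, List.append_assoc]

/-- The induction follows `treeOps`. A call leaves all stack cells below its own entry unchanged, so
after its return the caller's entry is intact, with the stage advanced. The slack `2 * stepTime n`
in the time bound makes the recurrence close. -/
theorem reach_treeOps (K ρ : ℕ) {M : ℕ → ℕ} {sp β p : ℕ} (hK : K ≤ l) (hsp : sp ≠ 0)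
    (hT : Top n l N R F M sp 0 K ρ β p (1 + (l - K) * n)) :
    ∃ M' T, T + 2 * stepTime n ≤ 3 * stepTime n * 4 ^ height R K ρ ∧
      Reach mainBody M (treeOps n l N R F K ρ β p) M' T ∧ Popped n l N R F M sp M' := by
  induction K generalizing ρ M sp β p with
  | zero =>
    obtain ⟨M', t, ht, h, hP⟩ := step_leaf hT
    refine ⟨M', stepTime n, ?_, ?_, hP⟩
    rotate_left
    · rw [treeOps]
      exact Reach.step (hT.height ▸ hsp) h ht
    · nlinarith [Nat.one_le_pow (height R 0 ρ) 4 (by simp)]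
  | succ K ihK =>
    induction ρ generalizing M sp β p with
    | zero =>
      obtain ⟨M', t, ht, h, hP⟩ := step_mid hT
      refine ⟨M', stepTime n, ?_, ?_, hP⟩
      rotate_left
      · rw [treeOps]
        exact Reach.step (hT.height ▸ hsp) h ht
      · nlinarith [Nat.one_le_pow (height R (K + 1) 0) 4 (by simp)]
    | succ ρ ihρ =>
      have hσ : 1 + (l - (K + 1)) * n + n = 1 + (l - K) * n := by
        rw [show l - K = l - (K + 1) + 1 by omega]; ring
      obtain ⟨M₁, t₁, ht₁, h₁, hP₁⟩ := step_zero hT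
      have hT₁ := hP₁.top
      rw [hσ] at hT₁
      obtain ⟨M₂, T₂, hT₂, h₂, hP₂⟩ := ihK R (by omega) (by omega) hT₁
      have hS₂ := hT.of_return hP₁ hP₂
      obtain ⟨M₃, t₃, ht₃, h₃, hP₃⟩ := step_one hS₂
      obtain ⟨M₄, T₄, hT₄, h₄, hP₄⟩ := ihρ (by omega) hP₃.top
      have hS₄ := hS₂.of_return hP₃ hP₄
      obtain ⟨M₅, t₅, ht₅, h₅, hP₅⟩ := step_two hS₄
      have hT₅ := hP₅.top
      rw [hσ] at hT₅
      obtain ⟨M₆, T₆, hT₆, h₆, hP₆⟩ := ihK R (by omega) (by omega) hT₅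
      have hS₆ := hS₄.of_return hP₅ hP₆
      obtain ⟨M₇, t₇, ht₇, h₇, hP₇⟩ := step_three hS₆
      have hReach := (Reach.step (hT.height ▸ hsp) h₁ ht₁).trans <| h₂.trans <|
        (Reach.step (hS₂.height ▸ hsp) h₃ ht₃).trans <| h₄.trans <|
        (Reach.step (hS₄.height ▸ hsp) h₅ ht₅).trans <| h₆.trans
        (Reach.step (hS₆.height ▸ hsp) h₇ ht₇)
      refine ⟨M₇, stepTime n + (T₂ + (stepTime n + (T₄ + (stepTime n + (T₆ + stepTime n))))), ?_,
        ?_, ⟨hP₇.glob, hP₇.height, fun a ha ha' => ?_⟩⟩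
      rotate_left
      · rw [treeOps, invOps_trialOps _ _ _ _ _ _ (invOps_treeOps ..), trialOps, ← preOps, ← postOps]
        simpa only [List.append_assoc] using hReach
      · rw [hP₇.keep a ha ha', hP₆.keep a ha (by omega), hP₅.keep a ha (by omega) (by omega),
          hP₄.keep a ha (by omega), hP₃.keep a ha (by omega) (by omega),
          hP₂.keep a ha (by omega), hP₁.keep a ha (by omega) (by omega)]
      -- Three calls, each of time at most `3 * s * 4 ^ h - 2 * s` with `s = stepTime n`, and four
      -- further steps give at most `9 * s * 4 ^ h - 2 * s`. Base `4` is used because `4 ^ h` is the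
      -- square of `2 ^ h`, which also bounds the wires.
      · have e1 : height R (K + 1) (ρ + 1) = height R (K + 1) ρ + 1 := rfl
        have e2 : 4 ^ height R K R ≤ 4 ^ height R (K + 1) ρ :=
          Nat.pow_le_pow_right (by simp) (by simp only [height]; linarith [add_mul K 1 (R + 1)])
        have e3 := Nat.mul_le_mul_left (3 * stepTime n) e2
        rw [e1, pow_succ]
        linarith

end Exec

/-! ### Initialisation and the complete run -/

section Exec

variable {n R : ℕ}

/-- Cell 24 holds the truncated difference `n + 1 - 2 ^ (j + 1)`, which is nonzero exactly when `2 ^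
(j + 1) ≤ n`, so the loop stops at `j = Nat.log 2 n`. Cell 5 accumulates `j * n`, which avoids a
multiplication. The alternative `j = 0` also covers `n = 0`. -/
theorem exec_depthProg {M : ℕ → ℕ} {j : ℕ} (hj : j = 0 ∨ 2 ^ j ≤ n) (h0 : M 0 = n) (h6 : M 6 = 1)
    (h3 : M 3 = j) (h5 : M 5 = j * n) (h30 : M 30 = 2 ^ (j + 1))
    (h24 : M 24 = n + 1 - 2 ^ (j + 1)) :
    ∃ M' t, t ≤ 6 * (Nat.log 2 n - j) + 1 ∧ Exec depthProg M [] M' t ∧ M' 3 = Nat.log 2 n ∧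
      M' 5 = Nat.log 2 n * n ∧ ∀ a, a ≠ 3 → a ≠ 5 → a ≠ 24 → a ≠ 30 → M' a = M a := by
  obtain ⟨d, hd⟩ : ∃ d, d = Nat.log 2 n - j := ⟨_, rfl⟩
  have hle : j ≤ Nat.log 2 n := by
    rcases hj with rfl | hj
    · simp
    · exact Nat.le_log_of_pow_le (by simp) hj
  induction d generalizing j M with
  | zero =>
    have hjl : j = Nat.log 2 n := by omega
    have : n < 2 ^ (j + 1) := hjl ▸ Nat.lt_pow_succ_log_self (by simp) n
    exact ⟨M, 1, by omega, .while_done (by omega), h3.trans hjl, by rw [h5, hjl],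
      fun _ _ _ _ _ => rfl⟩
  | succ d ih =>
    have hn : n ≠ 0 := by rintro rfl; simp at hd
    have hpow : 2 ^ (j + 1) ≤ n := Nat.pow_le_of_le_log hn (by omega)
    obtain ⟨M', t, ht, h, hM3, hM5, hk⟩ := ih (j := j + 1) (M := (seqs [.add 3 3 6, .add 5 5 0,
        .add 30 30 30, .add 24 0 6, .sub 24 24 30]).effect M) (.inr hpow)
      (by simp [seqs, Prog.effect, h0]) (by simp [seqs, Prog.effect, h6])
      (by simp [seqs, Prog.effect, h3, h6]) (by simp [seqs, Prog.effect, h5, h0]; ring)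
      (by simp [seqs, Prog.effect, h30]; ring) (by simp [seqs, Prog.effect, h30, h0, h6]; omega)
      (by omega) (by omega)
    refine ⟨M', _, ?_, .while_step (by omega) (Prog.Straight.exec
      (by simp [seqs, Prog.Straight]) M) h,
      hM3, hM5, fun a h1 h2 h3 h4 => ?_⟩
    · simp only [seqs, Prog.steps]; omega
    · rw [hk a h1 h2 h3 h4]
      simp [seqs, Prog.effect, h1, h2, h3, h4]

theorem exec_initProg (R n m work : ℕ) {l F : ℕ} (hl : l = Nat.log 2 n)
    (hF : F = l * n + (n + work) + 5) :
    ∃ M' t, t ≤ 6 * l + 38 ∧ Exec (initProg R) (initMem n m work) [] M' t ∧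
      Top n l (n + work) R F M' 6 0 l R F (1 + l * n) 1 := by
  subst hF hl
  set M₁ := (setupProg R).effect (initMem n m work) with hM₁
  have h1 : Exec (setupProg R) (initMem n m work) [] M₁ 10 :=
    Prog.Straight.exec (p := setupProg R) (by simp [setupProg, seqs, Prog.Straight]) _
  obtain ⟨M₂, t, ht, h2, h23, h25, hk2⟩ := exec_depthProg (n := n) (M := M₁) (j := 0) (.inl rfl)
    (by simp [hM₁, setupProg, seqs, Prog.effect, initMem])
    (by simp [hM₁, setupProg, seqs, Prog.effect])
    (by simp [hM₁, setupProg, seqs, Prog.effect])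
    (by simp [hM₁, setupProg, seqs, Prog.effect])
    (by simp [hM₁, setupProg, seqs, Prog.effect])
    (by simp [hM₁, setupProg, seqs, Prog.effect, initMem])
  have e0 : M₂ 0 = n := by simp [hk2, hM₁, setupProg, seqs, Prog.effect, initMem]
  have e4 : M₂ 4 = n + work := by simp [hk2, hM₁, setupProg, seqs, Prog.effect, initMem]
  have e6 : M₂ 6 = 1 := by simp [hk2, hM₁, setupProg, seqs, Prog.effect]
  have e7 : M₂ 7 = 100 := by simp [hk2, hM₁, setupProg, seqs, Prog.effect]
  have e9 : M₂ 9 = R := by simp [hk2, hM₁, setupProg, seqs, Prog.effect]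
  have e23 : M₂ 23 = 0 := by simp [hk2, hM₁, setupProg, seqs, Prog.effect]
  set M₃ := rootEntry.effect M₂ with hM₃
  have h3 : Exec rootEntry M₂ [] M₃ 10 :=
    Prog.Straight.exec (p := rootEntry) (by simp [rootEntry, seqs, Prog.Straight]) _
  have hG : Glob n (Nat.log 2 n) (n + work) R (Nat.log 2 n * n + (n + work) + 5) M₃ := by
    constructor <;>
    simp [hM₃, rootEntry, seqs, Prog.effect, e0, e4, e6, e7, e9, e23, h23, h25]
  obtain ⟨M', h4, h8, -, hE, hk, -⟩ := exec_push hG.one hG.hundred (sp := 0)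
    (by simp [hM₃, rootEntry, seqs, Prog.effect]) 0
  refine ⟨M', 10 + (t + (10 + 17)), by omega, h1.seq (h2.seq (h3.seq h4)),
    hG.congr fun a ha => hk a (by omega) (by omega) (by omega) (by omega), h8, ?_⟩
  convert hE using 1 <;>
  simp [hM₃, rootEntry, seqs, Prog.effect, e4, e6, e9, e23, h23, h25, add_comm]

theorem exec_mainProg (R n m work : ℕ) {l F : ℕ} (hl : l = Nat.log 2 n)
    (hF : F = l * n + (n + work) + 5) :
    ∃ M' t, t ≤ 6 * l + 38 + 3 * stepTime n * 4 ^ height R l R ∧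
      Exec (mainProg R) (initMem n m work)
        (treeOps n l (n + work) R F l R F (1 + l * n)) M' t := by
  obtain ⟨M₁, t₁, ht₁, h₁, hT⟩ := exec_initProg R n m work hl hF
  obtain ⟨M', T, hT', hR, hP⟩ := reach_treeOps (sp := 6) l R le_rfl (by simp)
    (by simpa using hT)
  -- The root entry sits at height 6, so its removal brings the height in cell 8 to zero and the
  -- main loop ends.
  obtain ⟨t, ht, h⟩ := hR [] M' 1 (.while_done hP.height)
  refine ⟨M', t₁ + t, ?_, (h₁.seq h).congr (by simp) rfl⟩
  have : 1 ≤ stepTime n := by simp [stepTime]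
  omega

end Exec

/-! ### Costs -/

/-- Every emission takes a step, so the running time of the program also bounds the number of
operations and of queries. -/
theorem Exec.length_le {p : Prog} {M M' : ℕ → ℕ} {ops : List Op} {t : ℕ} (h : Exec p M ops M' t) :
    ops.length ≤ t := by
  induction h with
  | seq _ _ ih₁ ih₂ => simpa using add_le_add ih₁ ih₂
  | while_step _ _ _ ih₁ ih₂ => simpa using (add_le_add ih₁ ih₂).trans (Nat.le_succ _)
  | ite_true _ _ ih => exact ih.trans (Nat.le_succ _)
  | ite_false _ _ ih => exact ih.trans (Nat.le_succ _)
  | _ => simp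

theorem cost_inv (n m l sizeU : ℕ) (o : Op) : o.inv.cost n m l sizeU = o.cost n m l sizeU := by
  cases o <;> rfl

theorem cost_invOps {n m l sizeU C : ℕ} {L : List Op} (h : ∀ o ∈ L, o.cost n m l sizeU ≤ C) :
    ∀ o ∈ invOps L, o.cost n m l sizeU ≤ C := by
  intro o ho
  obtain ⟨o', ho', rfl⟩ := List.mem_map.1 (List.mem_reverse.1 ho)
  exact (cost_inv ..).trans_le (h o' ho')

theorem cost_le_of_mem_trialOps {n m l sizeU N k β σ p : ℕ} {D : List Op} (hk : k ≤ l)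
    (hD : ∀ o ∈ D, o.cost n m l sizeU ≤ l * n + m + 2 + sizeU) :
    ∀ o ∈ trialOps n N k β σ p D, o.cost n m l sizeU ≤ l * n + m + 2 + sizeU := by
  have hkn : k * n ≤ l * n := Nat.mul_le_mul_right n hk
  intro o ho
  simp only [trialOps, hadOps, copyOps, verifyOps, List.mem_append, List.mem_map, List.mem_cons,
    List.not_mem_nil, or_false] at ho
  rcases ho with ((⟨j, -, rfl⟩ | ⟨j, -, rfl⟩) | ho) | ((⟨j, -, rfl⟩ | rfl) | rfl | rfl | rfl | rfl)
  on_goal 3 => exact hD o ho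
  all_goals simp only [Op.cost]; omega

theorem cost_le_of_mem_treeOps {n m l sizeU N R F : ℕ} (K ρ β p : ℕ) :
    ∀ o ∈ treeOps n l N R F K ρ β p, o.cost n m l sizeU ≤ l * n + m + 2 + sizeU := by
  induction K generalizing ρ β p with
  | zero =>
    rw [treeOps]
    intro o ho
    simp only [leafOps, List.mem_append, List.mem_cons, List.not_mem_nil, or_false] at ho
    rcases ho with (rfl | rfl | rfl | rfl) | rfl <;> simp only [Op.cost] <;> omega
  | succ K ihK =>
    induction ρ generalizing β p with
    | zero =>
      rw [treeOps, midOps]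
      intro o ho
      split at ho
      · simp only [List.mem_cons, List.not_mem_nil, or_false] at ho
        subst ho
        simp only [Op.cost]; omega
      · simp only [List.mem_cons, List.not_mem_nil, or_false] at ho
        rcases ho with rfl | rfl | rfl <;> simp only [Op.cost] <;> omega
    | succ ρ ih =>
      rw [treeOps]
      have hT := cost_le_of_mem_trialOps (n := n) (N := N) (β := β) (p := p)
        (σ := 1 + (l - (K + 1)) * n) (Nat.sub_le l (K + 1)) (ihK R (2 * β) (β + N + 3))
      intro o ho
      rcases List.mem_append.1 ho with ho | ho
      · rcases List.mem_append.1 ho with ho | ho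
        · exact hT o ho
        · exact ih _ _ o ho
      · exact cost_invOps hT o ho

/-- Here the logarithmic depth and the constant `R` give polynomial cost: `2 ^ l ≤ n`, so the power
of two becomes a fixed power of `n` up to a constant. -/
theorem two_pow_height_le {n : ℕ} (hn : n ≠ 0) (R : ℕ) :
    2 ^ height R (Nat.log 2 n) R ≤ n ^ (R + 1) * 2 ^ R := by
  rw [height, pow_add, pow_mul]
  exact Nat.mul_le_mul_right _ (Nat.pow_le_pow_left (Nat.pow_log_le_self 2 hn) _)

open Polynomial in
/-- A bound for the running time. -/
noncomputable def timeBound (q : ℕ[X]) (R : ℕ) : ℕ[X] :=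
  let H : ℕ[X] := X ^ (R + 1) * C (2 ^ R)
  let T : ℕ[X] := C 6 * X + C 38 + C 3 * (C 10 * X + C 60) * H ^ 2
  T + T * (X * X + (X + q) + C 2 + q) + C 2 * (X * X + (X + q) + C 5) * H

theorem solvesWithin_mainProg {n : ℕ} (P : SingleLevel n) (U : IdCircuit n P.m) {q : Polynomial ℕ}
    (hq : U.gates.length + U.work ≤ q.eval n) {R : ℕ} (hn : n ≠ 0)
    (hsolves : ∀ W, W = 2 * (Nat.log 2 n * n + (n + U.work) + 5) * 2 ^ height R (Nat.log 2 n) R →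
      ∀ (s : Secret P (Nat.log 2 n)) (b : Bool), 2 / 3 ≤ outputProb (runOps W (oracle P s b) U.gates
        (treeOps n (Nat.log 2 n) (n + U.work) R (Nat.log 2 n * n + (n + U.work) + 5) (Nat.log 2 n) R
          (Nat.log 2 n * n + (n + U.work) + 5) (1 + Nat.log 2 n * n))) b) :
    SolvesWithin (mainProg R) P U (Nat.log 2 n) ((timeBound q R).eval n)
      ((timeBound q R).eval n) := by
  obtain ⟨M, t, ht, h⟩ := exec_mainProg R n P.m U.work rfl rfl
  set l := Nat.log 2 n with hl
  set ops := treeOps n l (n + U.work) R (l * n + (n + U.work) + 5) l R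
    (l * n + (n + U.work) + 5) (1 + l * n) with hops
  set H := n ^ (R + 1) * 2 ^ R with hH
  have hpow : 2 ^ height R l R ≤ H := two_pow_height_le hn R
  have hpow2 : 4 ^ height R l R ≤ H ^ 2 := by
    rw [show 4 = 2 ^ 2 by rfl, ← pow_mul, mul_comm, pow_mul]
    exact Nat.pow_le_pow_left hpow 2
  have hln : l ≤ n := Nat.log_le_self 2 n
  have hlnn : l * n ≤ n * n := Nat.mul_le_mul_right n hln
  have hm : P.m ≤ n + U.work := U.out_le
  set Q := q.eval n with hQ
  set T := 6 * n + 38 + 3 * (10 * n + 60) * H ^ 2 with hT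
  have htT : t ≤ T := by
    refine ht.trans ?_
    have := Nat.mul_le_mul_left (3 * (10 * n + 60)) hpow2
    rw [stepTime]
    omega
  have heval : (timeBound q R).eval n = T + T * (n * n + (n + Q) + 2 + Q) +
      2 * (n * n + (n + Q) + 5) * H := by
    simp [timeBound, hT, hH, hQ]
  rw [heval]
  have hcost : (ops.map (Op.cost n P.m l U.gates.length)).sum ≤ T * (n * n + (n + Q) + 2 + Q) := by
    refine (List.sum_le_card_nsmul _ (n * n + (n + Q) + 2 + Q) fun x hx => ?_).trans ?_
    · obtain ⟨o, ho, rfl⟩ := List.mem_map.1 hx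
      refine (cost_le_of_mem_treeOps _ _ _ _ o ho).trans ?_
      omega
    · rw [List.length_map, smul_eq_mul]
      exact Nat.mul_le_mul_right _ (h.length_le.trans htT)
  have hW : 2 * (l * n + (n + U.work) + 5) * 2 ^ height R l R ≤ 2 * (n * n + (n + Q) + 5) * H :=
    Nat.mul_le_mul (by omega) hpow
  refine ⟨ops, M, t, _, h, ?_, ?_, hsolves _ rfl⟩
  · exact (List.countP_le_length.trans (h.length_le.trans htT)).trans (by omega)
  · omega

theorem exists_attempts {δ : ℝ} (hδ : 0 < δ) : ∃ R : ℕ, 2 * (1 - δ / 4) ^ R ≤ δ / 4 := by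
  obtain ⟨R, hR⟩ := exists_pow_lt_of_lt_one (show 0 < δ / 8 by linarith)
    (show 1 - δ / 4 < 1 by linarith)
  exact ⟨R, by linarith⟩

end RecOracle

theorem theorem1
    (P : (n : ℕ) → RecOracle.SingleLevel n)
    (U : (n : ℕ) → RecOracle.IdCircuit n (P n).m)
    (hA : ∃ α : ℝ, 0 < α ∧ ∀ᶠ n : ℕ in atTop, (2 : ℝ) ^ (α * (n : ℝ)) ≤ ((P n).A.card : ℝ))
    (hTime : ∃ p : Polynomial ℕ, ∀ n : ℕ, (U n).gates.length + (U n).work ≤ p.eval n)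
    (hSolves : ∃ δ : ℝ, 0 < δ ∧
      ∀ᶠ n : ℕ in atTop, ∀ a : (P n).A, δ ≤ RecOracle.successProb (P n) (U n) a) :
    (∃ (prog : RecOracle.Prog) (p : Polynomial ℕ), ∀ᶠ n : ℕ in atTop,
      RecOracle.SolvesWithin prog (P n) (U n) (Nat.log 2 n) (p.eval n) (p.eval n)) ∧
    (∃ c : ℝ, 0 < c ∧ ∀ g : ℕ → ℝ, g =o[atTop] (fun n : ℕ => Real.log n) →
      ∀ᶠ n : ℕ in atTop, ∀ (D : RecOracle.ClassicalAlg (P n) (Nat.log 2 n)) (q : ℕ),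
        RecOracle.MakesAtMost D q →
        RecOracle.SucceedsWithProb D (1 / 2 + (n : ℝ) ^ (-g n)) →
        (n : ℝ) ^ (c * Real.log n) ≤ (q : ℝ)) := by
  constructor
  · obtain ⟨q, hq⟩ := hTime
    obtain ⟨δ, hδ, hU⟩ := hSolves
    -- The error analysis needs `δ ≤ 1`. Passing to the minimum avoids deriving this from the
    -- success probabilities.
    have hδ0 : 0 < min δ 1 := lt_min hδ one_pos
    obtain ⟨R, hR⟩ := RecOracle.exists_attempts hδ0
    refine ⟨RecOracle.mainProg R, RecOracle.timeBound q R, ?_⟩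
    -- For `n ≥ 2` the depth `Nat.log 2 n` is positive, so the root is an internal node.
    filter_upwards [hU, eventually_ge_atTop 2] with n hUn hn
    exact RecOracle.solvesWithin_mainProg (P n) (U n) (hq n) (by omega) fun W hW s b =>
      RecOracle.outputProb_treeOps (U n) hδ0 (min_le_right δ 1)
        (fun a => (min_le_left δ 1).trans (hUn a)) (Nat.log_pos (by simp) hn) hR rfl hW s b
  · obtain ⟨α, hα, hcard⟩ := hA
    exact ⟨1 / 4, by norm_num, fun g hg => RecOracle.classical_lower_bound P α hα hcard g hg⟩
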